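/- Let $N$ be an integer with $5\le N\le 12$, or $14\le N\le 17$, or $N=23$, and let $k$ be a positive integer. Let $F(s)=\sum_{n\ge 1}a_n n^{-s}$ ($a_n\in\mathbb C$) be a Dirichlet series with the following properties. (i) (EBV) $F(s)$ converges in some right half-plane and continues to an entire function such that $\Gamma(s)F(s)$ is entire and bounded in every vertical strip. (ii) (Functional equation of degree $2$, level $N$, weight $k$.) For a sign $\varepsilon\in\{1,-1\}$, the function $\Phi(s)=\left(\frac{\sqrt N}{2\pi}\right)^{s}\Gamma(s)F(s)$ satisfies $\Phi(s)=\varepsilon\,(-1)^{k/2}\,\Phi(k-s)$ for all $s$, where $(-1)^{k/2}=e^{\pi i k/2}$. (iii) (Euler product of degree $2$, level $N$, weight $k$.) In some right half-plane $F(s)=\prod_{p}F_p(s)$, the product over all primes $p$, where $$F_p(s)=\begin{cases}(1-a_pp^{-s}+p^{k-1-2s})^{-1}& p\nmid N,\\ (1-p^{k/2-1-s})^{-1}& p\,\|\,N,\\ 1& p^2\mid N.\end{cases}$$ (iv) If $N\in\{9,16\}$ and $\varepsilon=-1$, then moreover there is a $\delta>0$ such that $F(s)$ converges absolutely for $\operatorname{Re}s>k-\delta$.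 Then the series $f(z)=\sum_{n\ge 1}a_n e^{2\pi i n z}$ converges for every $z$ in the upper half-plane, and $f$ is a cusp form of weight $k$ for $\Gamma_0(N)$, i.e. $f\in S_k(\Gamma_0(N))$. -/

import Mathlib

open Complex

/-- The condition EBV for the Dirichlet series `∑_{n ≥ 1} a n / n ^ s`: it converges in some right
half-plane, it continues to the entire function `F`, and `Γ(s) F(s)` is (the restriction of) the
entire function `Λ`, which is bounded in every vertical strip. Since Mathlib's `Gamma` takes a
conventional value at its poles, `Λ` is compared with `Γ F` only away from them; by continuity this
determines `Λ`. The value `a 0` plays no role. Convergence in some half-plane is equivalent to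
absolute convergence in some (smaller) half-plane, which is the form used here. -/
structure IsEBV (a : ℕ → ℂ) (F Λ : ℂ → ℂ) : Prop where
  hasSum : ∃ σ : ℝ, ∀ s : ℂ, σ < s.re → LSeriesHasSum a s (F s)
  entire : Differentiable ℂ F
  entire_completed : Differentiable ℂ Λ
  completed_eq : ∀ s : ℂ, (∀ n : ℕ, s ≠ -(n : ℂ)) → Λ s = Gamma s * F s
  bounded_strips : ∀ α β : ℝ, ∃ C : ℝ, ∀ s : ℂ, α ≤ s.re → s.re ≤ β → ‖Λ s‖ ≤ C

/-- The functional equation of degree 2, level `N`, weight `k` and sign `ε`: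
`Φ(s) = ε (-1)^{k/2} Φ(k - s)` with `Φ(s) = (√N / 2π)^s Λ(s)`, where `Λ(s) = Γ(s) F(s)`. -/
def HasFunctionalEquation (Λ : ℂ → ℂ) (N : ℕ) (k : ℤ) (ε : ℂ) : Prop :=
  ∀ s : ℂ, ((√(N : ℝ) / (2 * Real.pi) : ℝ) : ℂ) ^ s * Λ s =
    ε * (-1 : ℂ) ^ ((k : ℂ) / 2) *
      (((√(N : ℝ) / (2 * Real.pi) : ℝ) : ℂ) ^ ((k : ℂ) - s) * Λ ((k : ℂ) - s))

/-- The local factor at the prime `p` of an Euler product of degree 2, level `N`, weight `k`. -/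
noncomputable def eulerFactor (a : ℕ → ℂ) (N : ℕ) (k : ℤ) (p : ℕ) (s : ℂ) : ℂ :=
  if p ^ 2 ∣ N then 1
  else if p ∣ N then (1 - (p : ℂ) ^ ((k : ℂ) / 2 - 1 - s))⁻¹
  else (1 - a p * (p : ℂ) ^ (-s) + (p : ℂ) ^ ((k : ℂ) - 1 - 2 * s))⁻¹

/-- `F` has an Euler product of degree 2, level `N`, weight `k`: in some right half-plane `F(s)` is
the product of the local factors over all primes. -/
def HasEulerProduct (a : ℕ → ℂ) (F : ℂ → ℂ) (N : ℕ) (k : ℤ) : Prop :=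
  ∃ σ : ℝ, ∀ s : ℂ, σ < s.re →
    HasProd (fun p : Nat.Primes => eulerFactor a N k p s) (F s)

/-! For odd `k`, applying the functional equation twice multiplies `Λ` by `-1`, so all coefficients
vanish and the zero form works. Let `k = 2 m`.

By a Mellin argument (`act_fricke_qSeries`) the functional equation says `f | H = ε f` for the
Fricke involution `H` of level `N`; moreover `f` has period 1. The Euler product supplies further
symmetries, because it makes `f` an eigenfunction of the Hecke operators at 2 and 3. The operator at
2 expresses `f(z + 1/2)` through dilates `f(a z)` with `a ∣ 4` (`a ∣ 2` if 2 exactly divides `N`,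
`-f` itself if `4 ∣ N`). A Fricke involution of higher level permutes such dilates, and conjugating
back gives semi-invariance of `f` under an involution with centre `1/2`. For `N = 5, ..., 10, 12,
16` this is enough.

For `N = 11, 14, 15, 17, 23` the denominators 3, 4, 6 are needed, and there only the sum of `f(z +
1/q)` and `f(z - 1/q)` is controlled. This yields one linear relation between the defects `g = f - χ
f|X` and `h = f - χ f|Y` of two involutions with centres `± 1/q`. A second link between `g` and `h`
(`eq_of_dual_relations`, `eq_of_link`) turns it into `g | E = ± g` with `E` elliptic of infinite
order, and a holomorphic function with this property is zero (`eq_zero_of_act_elliptic`). Given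
enough semi-invariances, invariance under `Γ₀(N)` follows by a Euclidean descent
(`act_eq_of_cover`).

For cuspidality, polynomial growth of the coefficients gives `f` a limit at every cusp. If a limit
is nonzero, comparing constant terms in the Hecke relations (`hecke_relation_at_cusp`) forces `a_p =
1 + p^(k-1)` for all `p ∤ N`. Then `F` has non-negative coefficients, hence `F(0) > 0` by Landau,
while `F(0) = 0` because `Γ(s) F(s)` is entire. For `N = 9, 16` some Hecke operators exchange two
cusps whose limits differ by the factor `ε`; if `ε = -1` one only gets `|a_p| = 1 + p^(k-1)`, which
contradicts absolute convergence at `s = k`. -/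

open UpperHalfPlane ModularForm Matrix

/-! ### The action of integral matrices -/

/-- An integral matrix of positive determinant as an element of `GL(2, ℝ)`. -/
noncomputable def intGL (A : Matrix (Fin 2) (Fin 2) ℤ) (h : 0 < A.det) : GL (Fin 2) ℝ :=
  GeneralLinearGroup.mkOfDetNeZero (A.map (Int.castRingHom ℝ)) (by
    rw [← RingHom.mapMatrix_apply, ← RingHom.map_det, eq_intCast]; exact_mod_cast h.ne')

lemma coe_intGL (A : Matrix (Fin 2) (Fin 2) ℤ) (h : 0 < A.det) :
    (intGL A h : Matrix (Fin 2) (Fin 2) ℝ) = A.map (Int.castRingHom ℝ) := rfl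

lemma intGL_apply (A : Matrix (Fin 2) (Fin 2) ℤ) (h : 0 < A.det) (i j : Fin 2) :
    intGL A h i j = (A i j : ℝ) := rfl

lemma det_intGL (A : Matrix (Fin 2) (Fin 2) ℤ) (h : 0 < A.det) :
    (intGL A h).det.val = (A.det : ℝ) := by
  rw [GeneralLinearGroup.val_det_apply, coe_intGL, ← RingHom.mapMatrix_apply, ← RingHom.map_det]
  rfl

lemma intGL_mul (A B : Matrix (Fin 2) (Fin 2) ℤ) (hA : 0 < A.det) (hB : 0 < B.det)
    (hAB : 0 < (A * B).det) : intGL (A * B) hAB = intGL A hA * intGL B hB := by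
  ext i j
  simp only [coe_intGL, Matrix.map_mul, GeneralLinearGroup.coe_mul]

open Classical in
/-- The weight `2 * m` action of integral matrices of positive determinant on functions on `ℍ`,
normalised so that scalar matrices act trivially. -/
noncomputable def act (m : ℤ) (A : Matrix (Fin 2) (Fin 2) ℤ) : (ℍ → ℂ) →ₗ[ℂ] (ℍ → ℂ) :=
  if h : 0 < A.det then
    { toFun := fun f => ((A.det : ℂ) ^ (1 - m)) • (f ∣[2 * m] intGL A h)
      map_add' := fun f g => by simp
      map_smul' := fun c f => by
        have : σ (intGL A h) c = c := by
          rw [σ, if_pos (by rw [det_intGL]; exact_mod_cast h)]; rfl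
        simp [smul_slash, this, smul_comm c] }
  else 0

lemma act_def (m : ℤ) (A : Matrix (Fin 2) (Fin 2) ℤ) (h : 0 < A.det) (f : ℍ → ℂ) :
    act m A f = ((A.det : ℂ) ^ (1 - m)) • (f ∣[2 * m] intGL A h) := by
  simp [act, h]

lemma act_act (m : ℤ) {A B : Matrix (Fin 2) (Fin 2) ℤ} (hA : 0 < A.det) (hB : 0 < B.det)
    (f : ℍ → ℂ) : act m B (act m A f) = act m (A * B) f := by
  have hAB : 0 < (A * B).det := by rw [det_mul]; positivity
  have hs : ∀ c : ℂ, σ (intGL B hB) c = c := fun c => by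
    rw [σ, if_pos (by rw [det_intGL]; exact_mod_cast hB)]; rfl
  rw [act_def m A hA, act_def m B hB, act_def m _ hAB, intGL_mul A B hA hB, SlashAction.slash_mul,
    smul_slash, hs, smul_smul, det_mul, Int.cast_mul, mul_zpow, mul_comm]

lemma denom_intGL (A : Matrix (Fin 2) (Fin 2) ℤ) (h : 0 < A.det) (z : ℍ) :
    denom (intGL A h) z = (A 1 0 : ℂ) * z + A 1 1 := by
  simp [denom, intGL_apply]

lemma coe_intGL_smul (A : Matrix (Fin 2) (Fin 2) ℤ) (h : 0 < A.det) (z : ℍ) :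
    ((intGL A h • z : ℍ) : ℂ) = ((A 0 0 : ℂ) * z + A 0 1) / ((A 1 0 : ℂ) * z + A 1 1) := by
  rw [coe_smul_of_det_pos (by rw [det_intGL]; exact_mod_cast h), denom_intGL]
  simp [num, intGL_apply]

lemma act_apply (m : ℤ) {A : Matrix (Fin 2) (Fin 2) ℤ} (h : 0 < A.det) (f : ℍ → ℂ) (z : ℍ) :
    act m A f z = (A.det : ℂ) ^ m * ((A 1 0 : ℂ) * z + A 1 1) ^ (-(2 * m)) *
      f (intGL A h • z) := by
  have hd : (A.det : ℂ) ≠ 0 := by exact_mod_cast h.ne'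
  rw [act_def m A h, Pi.smul_apply, slash_apply, det_intGL, denom_intGL, σ,
    if_pos (by rw [det_intGL]; exact_mod_cast h), abs_of_pos (by exact_mod_cast h)]
  have : (A.det : ℂ) ^ m = (A.det : ℂ) ^ (1 - m) * (A.det : ℂ) ^ (2 * m - 1) := by
    rw [← zpow_add₀ hd]; congr 1; ring
  rw [this]
  simp only [ContinuousAlgEquiv.refl_apply, ofReal_intCast, smul_eq_mul]
  ring

lemma act_apply_of_eq (m : ℤ) {A : Matrix (Fin 2) (Fin 2) ℤ} (h : 0 < A.det) (f : ℍ → ℂ)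
    {z w : ℍ} (hw : (w : ℂ) * ((A 1 0 : ℂ) * z + A 1 1) = (A 0 0 : ℂ) * z + A 0 1) :
    act m A f z = (A.det : ℂ) ^ m * ((A 1 0 : ℂ) * z + A 1 1) ^ (-(2 * m)) * f w := by
  have hne : (A 1 0 : ℂ) * z + A 1 1 ≠ 0 := by
    rw [← denom_intGL A h]; exact denom_ne_zero _ _
  rw [act_apply m h]
  congr 2
  ext
  rw [coe_intGL_smul, ← hw, mul_div_assoc, div_self hne, mul_one]

/-- The factors `det ^ m` and `(c z + d) ^ (-2 m)` scale inversely. This is what allows products of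
involutions to be compared only up to a scalar. -/
lemma act_smul_matrix (m : ℤ) {A : Matrix (Fin 2) (Fin 2) ℤ} {c : ℤ} (hc : c ≠ 0) (f : ℍ → ℂ) :
    act m (c • A) f = act m A f := by
  have hdet : (c • A).det = c ^ 2 * A.det := by
    rw [det_fin_two, det_fin_two]; simp only [Matrix.smul_apply, smul_eq_mul]; ring
  have hc2 : 0 < c ^ 2 := by positivity
  by_cases h : 0 < A.det
  · have h' : 0 < (c • A).det := by rw [hdet]; positivity
    have hcc : (c : ℂ) ≠ 0 := by exact_mod_cast hc
    ext z
    have hne : (A 1 0 : ℂ) * z + A 1 1 ≠ 0 := by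
      rw [← denom_intGL A h]; exact denom_ne_zero _ _
    rw [act_apply m h, act_apply_of_eq m h' (w := intGL A h • z), hdet]
    · simp only [Matrix.smul_apply, smul_eq_mul, Int.cast_mul, Int.cast_pow]
      rw [show (c : ℂ) * A 1 0 * z + c * A 1 1 = c * (A 1 0 * z + A 1 1) by ring, mul_zpow,
        mul_zpow, ← zpow_natCast, ← _root_.zpow_mul]
      have : (c : ℂ) ^ ((2 : ℕ) * m : ℤ) * (c : ℂ) ^ (-(2 * m)) = 1 := by
        rw [← zpow_add₀ hcc]; simp
      linear_combination ((A.det : ℂ) ^ m * ((A 1 0 : ℂ) * z + A 1 1) ^ (-(2 * m)) *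
        f (intGL A h • z)) * this
    · rw [coe_intGL_smul]
      simp only [Matrix.smul_apply, smul_eq_mul, Int.cast_mul]
      rw [show (c : ℂ) * A 1 0 * z + c * A 1 1 = (A 1 0 * z + A 1 1) * c by ring, ← mul_assoc,
        div_mul_cancel₀ _ hne]
      ring
  · have h' : ¬ 0 < (c • A).det := by
      rw [hdet]; intro h2; exact h (pos_of_mul_pos_right h2 hc2.le)
    rw [act, act, dif_neg h, dif_neg h']

lemma act_one (m : ℤ) (f : ℍ → ℂ) : act m 1 f = f := by
  ext z
  rw [act_apply_of_eq m (by simp) f (w := z) (by simp)]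
  simp

/-- A scalar multiple of the identity acts trivially. -/
lemma act_scalar (m : ℤ) {c : ℤ} (hc : c ≠ 0) (f : ℍ → ℂ) : act m (c • 1) f = f := by
  rw [act_smul_matrix m hc, act_one]

lemma act_SL (m : ℤ) (γ : SpecialLinearGroup (Fin 2) ℤ) (f : ℍ → ℂ) :
    act m γ.1 f = f ∣[2 * m] γ := by
  have h : 0 < γ.1.det := by rw [γ.2]; exact one_pos
  have h1 : (γ.1.det : ℂ) ^ (1 - m) = 1 := by rw [γ.2]; simp
  rw [act_def m _ h, SL_slash, h1, one_smul]
  congr 1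
  ext i j
  rfl

open scoped Manifold in
lemma mdifferentiable_act {f : ℍ → ℂ} (hf : MDiff f) (m : ℤ) (A : Matrix (Fin 2) (Fin 2) ℤ) :
    MDiff (act m A f) := by
  by_cases h : 0 < A.det
  · rw [act_def m A h]
    exact (hf.slash _ _).const_smul _
  · simp only [act, h, dif_neg, not_false_eq_true]
    exact mdifferentiable_const

/-! ### Elliptic transformations of infinite order -/

/-- The point of `ℍ` fixed by an integral elliptic matrix. -/
lemma exists_fixed_point {A : Matrix (Fin 2) (Fin 2) ℤ} (hell : A.trace ^ 2 < 4 * A.det) :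
    ∃ z : ℍ, (z : ℂ) * ((A 1 0 : ℂ) * z + A 1 1) = (A 0 0 : ℂ) * z + A 0 1 := by
  rw [trace_fin_two, det_fin_two] at hell
  set a := A 0 0
  set b := A 0 1
  set c := A 1 0
  set d := A 1 1
  have hc : c ≠ 0 := by
    intro h; rw [h] at hell; nlinarith [sq_nonneg (a - d)]
  have hcR : (c : ℝ) ≠ 0 := by exact_mod_cast hc
  set D : ℝ := 4 * (a * d - b * c) - (a + d) ^ 2 with hD
  have hDpos : 0 < D := by
    have : ((a + d : ℤ) : ℝ) ^ 2 < 4 * ((a * d - b * c : ℤ) : ℝ) := by exact_mod_cast hell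
    push_cast at this
    linarith
  have hsq : (√D) ^ 2 = D := Real.sq_sqrt hDpos.le
  have hac : |(c : ℝ)| ^ 2 = (c : ℝ) ^ 2 := sq_abs _
  -- The root of `c X² + (d - a) X - b` in the upper half-plane; `|c|` makes the imaginary part
  -- positive for either sign of `c`.
  refine ⟨⟨((a - d) / (2 * c) : ℝ) + ((√D / (2 * |(c : ℝ)|) : ℝ) : ℂ) * Complex.I, ?_⟩, ?_⟩
  · have h1 : 0 < √D / (2 * |(c : ℝ)|) :=
      div_pos (Real.sqrt_pos.mpr hDpos) (mul_pos two_pos (abs_pos.mpr hcR))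
    rw [add_im, ofReal_im, zero_add, im_ofReal_mul, Complex.I_im, mul_one]
    exact h1
  · have e1 : (((√D / (2 * |(c : ℝ)|) : ℝ) : ℂ) * Complex.I) ^ 2 = -((D / (4 * (c : ℝ) ^ 2) : ℝ) : ℂ) := by
      rw [mul_pow, I_sq, ← ofReal_pow, div_pow, mul_pow, hac, hsq]; push_cast; ring
    have hcC : (c : ℂ) ≠ 0 := by exact_mod_cast hc
    dsimp only
    generalize ((√D / (2 * |(c : ℝ)|) : ℝ) : ℂ) * Complex.I = y at e1
    push_cast [hD] at e1 ⊢
    field_simp at e1 ⊢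
    linear_combination e1

open Filter Topology in
open scoped Manifold in
/-- A holomorphic function on `ℍ` which is, up to sign, invariant under an elliptic transformation
of infinite order vanishes. -/
theorem eq_zero_of_act_elliptic {m : ℤ} (hm : 0 < m) {A : Matrix (Fin 2) (Fin 2) ℤ}
    (hell : A.trace ^ 2 < 4 * A.det) (hdvd : ¬ A.det ∣ A.trace ^ 2) {g : ℍ → ℂ} (hg : MDiff g)
    {χ : ℂ} (hχ : χ ^ 2 = 1) (hA : act m A g = χ • g) : g = 0 := by
  have hdet : 0 < A.det := by nlinarith [sq_nonneg A.trace]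
  obtain ⟨z, hz⟩ := exists_fixed_point hell
  have hdC : (A.det : ℂ) ≠ 0 := by exact_mod_cast hdet.ne'
  set G : ℂ → ℂ := g ∘ ofComplex with hG
  have hGd : DifferentiableOn ℂ G {w | 0 < w.im} := UpperHalfPlane.mdifferentiable_iff.mp hg
  have hzU : {w : ℂ | 0 < w.im} ∈ 𝓝 (z : ℂ) := isOpen_upperHalfPlaneSet.mem_nhds z.im_pos
  have hGa : AnalyticAt ℂ G z := hGd.analyticAt hzU
  by_contra hne
  have htop : analyticOrderAt G z ≠ ⊤ := by
    intro htop
    rw [analyticOrderAt_eq_top] at htop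
    apply hne
    refine UpperHalfPlane.eq_zero_of_frequently (τ := z) hg (Eventually.frequently ?_)
    have := (continuous_coe.tendsto z).eventually htop
    filter_upwards [nhdsWithin_le_nhds this] with w hw
    simpa [hG] using hw
  -- Write `g = (w - z)^n h` near the fixed point `z`, with `h z ≠ 0`, and compare leading terms in
  -- `g | A = χ g`.
  obtain ⟨h, hha, hh0, hev⟩ := hGa.analyticOrderAt_ne_top.mp htop
  set n := analyticOrderNatAt G z
  set j : ℂ → ℂ := fun w => (A 1 0 : ℂ) * w + A 1 1 with hj
  set M : ℂ → ℂ := fun w => ((A 0 0 : ℂ) * w + A 0 1) / j w with hM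
  have hj0 : ∀ w : ℍ, j w ≠ 0 := fun w => by
    simp only [hj]; rw [← denom_intGL A hdet]; exact denom_ne_zero _ _
  have hjz := hj0 z
  have hMz : M z = z := by
    simp only [hM]; rw [← hz]; exact mul_div_cancel_right₀ _ hjz
  have hjc : ContinuousAt j z := by simp only [hj]; fun_prop
  have hMc : ContinuousAt M z := by
    refine ContinuousAt.div ?_ hjc hjz
    fun_prop
  have hdetC : (A.det : ℂ) = A 0 0 * A 1 1 - A 0 1 * A 1 0 := by
    rw [det_fin_two]; push_cast; ring
  -- `A` multiplies `w - z` by a factor tending to its multiplier `det A / j(z)²` as `w → z`.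
  have hdiff : ∀ w : ℍ, M w - z = (w - z) * (A.det / (j w * j z)) := fun w => by
    have h1 := hj0 w
    simp only [hM]
    field_simp
    rw [hdetC]
    simp only [hj] at *
    linear_combination (-(A 1 0 : ℂ) * w - A 1 1) * hz
  have hkey : ∀ᶠ w in 𝓝[≠] (z : ℂ), (A.det : ℂ) ^ m * j w ^ (-(2 * m)) *
      ((A.det / (j w * j z)) ^ n * h (M w)) = χ * h w := by
    have hMt : Tendsto M (𝓝 z) (𝓝 z) := by simpa [ContinuousAt, hMz] using hMc
    filter_upwards [nhdsWithin_le_nhds hev, nhdsWithin_le_nhds (hMt.eventually hev),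
      nhdsWithin_le_nhds hzU, self_mem_nhdsWithin] with w h1 h2 h3 h4
    have hw := congrFun hA ⟨w, h3⟩
    have hMw : M w = (intGL A hdet • (⟨w, h3⟩ : ℍ) : ℍ) := by
      rw [coe_intGL_smul]
    rw [act_apply m hdet] at hw
    have e1 : g (intGL A hdet • (⟨w, h3⟩ : ℍ)) = G (M w) := by
      rw [hMw]; simp [hG]
    have e2 : g ⟨w, h3⟩ = G w := by
      simp [hG, ofComplex_apply_of_im_pos h3]
    rw [Pi.smul_apply, smul_eq_mul, e1, e2, h1, h2, smul_eq_mul, smul_eq_mul,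
      hdiff ⟨w, h3⟩, mul_pow] at hw
    have hwz : (w - z) ^ n ≠ 0 := pow_ne_zero _ (sub_ne_zero.mpr h4)
    apply mul_left_cancel₀ hwz
    simp only [hj] at hw ⊢
    linear_combination hw
  have hlim : (A.det : ℂ) ^ m * j z ^ (-(2 * m)) * ((A.det / (j z * j z)) ^ n * h z) = χ * h z := by
    have hc1 : ContinuousAt (fun w => (A.det : ℂ) ^ m * j w ^ (-(2 * m)) *
      ((A.det / (j w * j z)) ^ n * h (M w))) z := by
      have : ContinuousAt (fun w => h (M w)) z := by
        apply ContinuousAt.comp _ hMc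
        rw [hMz]; exact hha.continuousAt
      refine (continuousAt_const.mul (hjc.zpow₀ _ (Or.inl hjz))).mul (ContinuousAt.mul ?_ this)
      exact (continuousAt_const.div (hjc.mul continuousAt_const) (mul_ne_zero hjz hjz)).pow _
    have hc2 : ContinuousAt (fun w => χ * h w) z := continuousAt_const.mul hha.continuousAt
    have := tendsto_nhds_unique_of_eventuallyEq (hc1.tendsto.mono_left nhdsWithin_le_nhds)
      (hc2.tendsto.mono_left (nhdsWithin_le_nhds (s := {(z : ℂ)}ᶜ))) hkey
    simpa only [hMz] using this
  set μ : ℂ := A.det / (j z * j z) with hμ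
  have hμ0 : μ ≠ 0 := div_ne_zero hdC (mul_ne_zero hjz hjz)
  have hpow : μ ^ (m + n) = χ := by
    apply mul_right_cancel₀ hh0
    rw [← hlim, zpow_add₀ hμ0, zpow_natCast, hμ, div_zpow, ← sq, ← zpow_natCast (j z), ← _root_.zpow_mul,
      _root_.zpow_neg, div_eq_mul_inv]
    push_cast
    ring
  -- Since `m > 0`, the exponent `m + n` is positive and `μ` is a root of unity. Hence `μ` and `μ⁻¹`
  -- are algebraic integers, and so is the rational number `tr² / det = μ + μ⁻¹ + 2`; it is thus an
  -- integer, against `hdvd`.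
  obtain ⟨r, hr⟩ : ∃ r : ℕ, m + n = r := ⟨(m + n).toNat, by omega⟩
  have hr0 : 0 < r := by omega
  rw [hr, zpow_natCast] at hpow
  have hroot : μ ^ (r * 2) = 1 := by rw [pow_mul, hpow, hχ]
  have hint : IsIntegral ℤ μ := IsIntegral.of_pow (n := r * 2) (by omega) (by rw [hroot]; exact isIntegral_one)
  have hint' : IsIntegral ℤ μ⁻¹ :=
    IsIntegral.of_pow (n := r * 2) (by omega) (by rw [inv_pow, hroot, inv_one]; exact isIntegral_one)
  have hsum : ((A.trace ^ 2 / A.det : ℚ) : ℂ) = μ + μ⁻¹ + 2 := by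
    -- `j(z)` is an eigenvalue of `A`, so `μ` is the quotient of the two eigenvalues.
    have hchar : j z ^ 2 - (A 0 0 + A 1 1) * j z + A.det = 0 := by
      rw [hdetC]; simp only [hj]; linear_combination (A 1 0 : ℂ) * hz
    have htr : ((A.trace : ℤ) : ℂ) = A 0 0 + A 1 1 := by rw [trace_fin_two]; push_cast; ring
    simp only [Rat.cast_div, Rat.cast_pow, Rat.cast_intCast]
    rw [htr, hμ]
    have : (A 0 0 + A 1 1 : ℂ) = (j z ^ 2 + A.det) / j z := by
      field_simp; linear_combination -hchar
    rw [this]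
    field_simp
    ring
  have hq : IsIntegral ℤ ((A.trace ^ 2 / A.det : ℚ)) := by
    rw [← isIntegral_algebraMap_iff (algebraMap ℚ ℂ).injective]
    rw [eq_ratCast, hsum]
    exact (hint.add hint').add (isIntegral_algebraMap (R := ℤ) (x := 2))
  obtain ⟨y, hy⟩ := IsIntegrallyClosed.isIntegral_iff.mp hq
  apply hdvd
  refine ⟨y, ?_⟩
  have hdQ : (A.det : ℚ) ≠ 0 := by exact_mod_cast hdet.ne'
  rw [eq_div_iff hdQ] at hy
  have : ((A.trace ^ 2 : ℤ) : ℚ) = ((A.det * y : ℤ) : ℚ) := by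
    rw [Int.cast_pow, Int.cast_mul, ← hy, mul_comm]; rfl
  exact_mod_cast this

/-! ### Semi-invariance and descent in `Γ₀(N)` -/

lemma act_comp (m : ℤ) {A B C : Matrix (Fin 2) (Fin 2) ℤ} {c : ℤ} (hA : 0 < A.det)
    (hB : 0 < B.det) (hc : c ≠ 0) (h : A * B = c • C) (f : ℍ → ℂ) :
    act m B (act m A f) = act m C f := by
  rw [act_act m hA hB, h, act_smul_matrix m hc]

/-- `f` is an eigenfunction, with eigenvalue `c`, for the action of `A`. -/
def IsSemiInvariant (m : ℤ) (f : ℍ → ℂ) (A : Matrix (Fin 2) (Fin 2) ℤ) (c : ℂ) : Prop :=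
  0 < A.det ∧ act m A f = c • f

namespace IsSemiInvariant

variable {m : ℤ} {f : ℍ → ℂ} {A B : Matrix (Fin 2) (Fin 2) ℤ} {c d : ℂ}

lemma mul (hA : IsSemiInvariant m f A c) (hB : IsSemiInvariant m f B d) :
    IsSemiInvariant m f (A * B) (c * d) := by
  refine ⟨by rw [det_mul]; exact mul_pos hA.1 hB.1, ?_⟩
  rw [← act_act m hA.1 hB.1, hA.2, map_smul, hB.2, smul_smul]

lemma of_eq_smul (hA : IsSemiInvariant m f A c) {k : ℤ} (hk : k ≠ 0) (h : A = k • B) :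
    IsSemiInvariant m f B c := by
  have hd : A.det = k ^ 2 * B.det := by
    rw [h, det_fin_two, det_fin_two]; simp only [Matrix.smul_apply, smul_eq_mul]; ring
  have h2 : 0 < k ^ 2 := by positivity
  refine ⟨pos_of_mul_pos_right (hd ▸ hA.1) h2.le, ?_⟩
  rw [← act_smul_matrix m hk, ← h, hA.2]

lemma act_eq (hA : IsSemiInvariant m f A c) {k : ℤ} (hk : k ≠ 0) (h : A = k • B) (hc : c = 1) :
    act m B f = f := by
  rw [(hA.of_eq_smul hk h).2, hc, one_smul]

end IsSemiInvariant

lemma act_unipotent {m : ℤ} {f : ℍ → ℂ} (hT : act m !![1, 1; 0, 1] f = f) (n : ℤ) :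
    act m !![1, n; 0, 1] f = f := by
  have hadd : ∀ a b : ℤ, (!![1, a; 0, 1] : Matrix (Fin 2) (Fin 2) ℤ) * !![1, b; 0, 1] =
      !![1, b + a; 0, 1] := fun a b => by simp
  have hpos : ∀ a : ℤ, 0 < (!![1, a; 0, 1] : Matrix (Fin 2) (Fin 2) ℤ).det := fun a => by simp
  have hnat : ∀ n : ℕ, act m !![1, (n : ℤ); 0, 1] f = f := by
    intro n
    induction n with
    | zero => simpa [Matrix.one_fin_two] using act_one m f
    | succ n ih =>
      have := act_act m (hpos n) (hpos 1) f
      rw [ih, hT, hadd, add_comm] at this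
      exact_mod_cast this.symm
  obtain ⟨k, rfl | rfl⟩ := n.eq_nat_or_neg
  · exact hnat k
  · have := act_act m (hpos k) (hpos (-k)) f
    rw [hnat, hadd] at this
    rw [this]
    simpa [Matrix.one_fin_two] using act_one m f

lemma isSemiInvariant_unipotent {m : ℤ} {f : ℍ → ℂ} (hT : act m !![1, 1; 0, 1] f = f) (n : ℤ) :
    IsSemiInvariant m f !![1, n; 0, 1] 1 :=
  ⟨by simp, by rw [act_unipotent hT, one_smul]⟩

/-- Invariance under `Γ₀(N)` follows from invariance under finitely many elements whose isometric
circles cover the cusps equivalent to `∞`. -/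
theorem act_eq_of_cover {m : ℤ} {f : ℍ → ℂ} (hT : act m !![1, 1; 0, 1] f = f) {N : ℤ}
    {R : Set (ℤ × ℤ)}
    (hR : ∀ r ∈ R, N ∣ r.1 ∧ ∃ a b : ℤ, a * r.2 - b * r.1 = 1 ∧ act m !![a, b; r.1, r.2] f = f)
    (hcov : ∀ u v : ℤ, 0 < u → 0 ≤ v → v < u → N ∣ u → IsCoprime u v →
      ∃ r ∈ R, |u * r.2 - v * r.1| < u) (a b c d : ℤ) (hdet : a * d - b * c = 1) (hc : N ∣ c) :
    act m !![a, b; c, d] f = f := by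
  induction hn : c.natAbs using Nat.strong_induction_on generalizing a b c d with
  | _ n ih =>
  have hpos : ∀ c : ℤ, 0 < c → c.natAbs = n → N ∣ c → ∀ a b d : ℤ, a * d - b * c = 1 →
      act m !![a, b; c, d] f = f := by
    intro c hc0 hcn hNc a b d hdet
    -- A translation on the right reduces to `0 ≤ v < c` without changing `c`.
    set v := d % c with hv
    set q := d / c with hq
    have hd : d = v + c * q := by rw [hv, hq]; exact (Int.emod_add_mul_ediv d c).symm
    have hcop : IsCoprime c v := ⟨-(b - a * q), a, by rw [hd] at hdet; linarith⟩
    obtain ⟨⟨r, s⟩, hmem, hlt⟩ := hcov c v hc0 (Int.emod_nonneg _ hc0.ne') (Int.emod_lt_of_pos _ hc0) hNc hcop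
    obtain ⟨hNr, x, y, hxy, hfix⟩ := hR _ hmem
    simp only at hNr hxy hfix hlt
    -- This matrix is `[a, b - a q; c, v]` times the inverse of `[x, y; r, s]`. Its lower left entry
    -- `c s - v r` is smaller than `c` exactly because `-v / c` lies inside the isometric circle `|r
    -- z + s| = 1`.
    have hsmall : act m !![a * s - (b - a * q) * r, -a * y + (b - a * q) * x; c * s - v * r,
        -c * y + v * x] f = f := by
      refine ih (c * s - v * r).natAbs ?_ _ _ _ _ ?_ ?_ rfl
      · rw [abs_lt] at hlt; rw [← hcn]; omega
      · linear_combination hdet + (a * d - b * c) * hxy + (a * x * s - a * y * r) * hd.symm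
      · exact dvd_sub (hNc.mul_right _) (hNr.mul_left _)
    have hd1 : 0 < (!![a * s - (b - a * q) * r, -a * y + (b - a * q) * x; c * s - v * r,
        -c * y + v * x] : Matrix (Fin 2) (Fin 2) ℤ).det := by
      rw [det_fin_two_of]
      have : (a * s - (b - a * q) * r) * (-c * y + v * x) -
        (-a * y + (b - a * q) * x) * (c * s - v * r) = 1 := by
        linear_combination hdet + (a * d - b * c) * hxy + (a * x * s - a * y * r) * hd.symm
      omega
    have hd2 : 0 < (!![x, y; r, s] : Matrix (Fin 2) (Fin 2) ℤ).det := by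
      rw [det_fin_two_of]; omega
    have hprod : !![a * s - (b - a * q) * r, -a * y + (b - a * q) * x; c * s - v * r,
        -c * y + v * x] * !![x, y; r, s] = !![a, b - a * q; c, v] := by
      rw [Matrix.mul_fin_two]
      congr 1
      ext i j; fin_cases i <;> fin_cases j <;> simp
      · linear_combination a * hxy
      · linear_combination (b - a * q) * hxy
      · linear_combination c * hxy
      · linear_combination v * hxy
    have h1 := act_act m hd1 hd2 f
    rw [hsmall, hfix, hprod] at h1
    have hd3 : 0 < (!![a, b - a * q; c, v] : Matrix (Fin 2) (Fin 2) ℤ).det := by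
      rw [det_fin_two_of]
      have : a * v - (b - a * q) * c = 1 := by rw [hd] at hdet; linarith
      omega
    have h2 := act_act m hd3 (by simp : 0 < (!![1, q; 0, 1] : Matrix (Fin 2) (Fin 2) ℤ).det) f
    rw [← h1, act_unipotent hT] at h2
    refine Eq.trans ?_ h2.symm
    congr 2
    rw [Matrix.mul_fin_two]
    ext i j; fin_cases i <;> fin_cases j <;> simp
    · linarith
  rcases lt_trichotomy c 0 with h | h | h
  · have := hpos (-c) (by omega) (by omega) (by simpa using hc) (-a) (-b) (-d) (by linarith)
    rw [← act_smul_matrix m (c := -1) (by norm_num)]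
    simpa using this
  · subst h
    simp only [mul_zero, sub_zero] at hdet
    rcases Int.eq_one_or_neg_one_of_mul_eq_one hdet with rfl | rfl
    · obtain rfl : d = 1 := by linarith
      exact act_unipotent hT b
    · obtain rfl : d = -1 := by linarith
      rw [← act_smul_matrix m (c := -1) (by norm_num)]
      simpa using act_unipotent hT (-b)
  · exact hpos c h hn hc a b d hdet

/-! ### Hecke relations as identities between translates and dilates -/

section Relations

variable {m : ℤ} {f : ℍ → ℂ} {N : ℤ} {ε : ℂ}

/-- Up to a scalar, `[a, 0; 0, 1] [0, -1; N a b, 0] = [0, -1; N, 0] [b, 0; 0, 1]`. Consequently a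
combination of dilates whose coefficients are symmetric under `a ↔ b` is an eigenfunction of the
Fricke involution of level `N a b`; the relations at 2, 3, 4 and 6 below all rest on this. -/
lemma act_fricke_act_diag (hN : 0 < N) (hH : act m !![0, -1; N, 0] f = ε • f) {a b M : ℤ}
    (ha : 0 < a) (hb : 0 < b) (hM : M = N * (a * b)) :
    act m !![0, -1; M, 0] (act m !![a, 0; 0, 1] f) = ε • act m !![b, 0; 0, 1] f := by
  have h1 : 0 < (!![a, 0; 0, 1] : Matrix (Fin 2) (Fin 2) ℤ).det := by simpa using ha
  have h2 : 0 < (!![b, 0; 0, 1] : Matrix (Fin 2) (Fin 2) ℤ).det := by simpa using hb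
  have h3 : 0 < (!![0, -1; M, 0] : Matrix (Fin 2) (Fin 2) ℤ).det := by
    rw [hM]; simpa using by positivity
  have h4 : 0 < (!![0, -1; N, 0] : Matrix (Fin 2) (Fin 2) ℤ).det := by simpa using hN
  rw [act_comp m (C := !![0, -1; N, 0] * !![b, 0; 0, 1]) h1 h3 ha.ne', ← act_act m h4 h2, hH,
    map_smul]
  simp [hM]; ring

lemma act_diag_one : act m !![1, 0; 0, 1] f = f := by
  simpa [Matrix.one_fin_two] using act_one m f

/-- Translation by `x / q`, for `x` in a fixed residue class modulo `q`. -/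
lemma act_translation_congr (hT : act m !![1, 1; 0, 1] f = f) {q x y : ℤ} (hq : 0 < q)
    (h : q ∣ x - y) : act m !![q, x; 0, q] f = act m !![q, y; 0, q] f := by
  obtain ⟨n, hn⟩ := h
  have h1 : 0 < (!![q, y; 0, q] : Matrix (Fin 2) (Fin 2) ℤ).det := by simpa using by positivity
  have := act_act m (by simp : 0 < (!![1, n; 0, 1] : Matrix (Fin 2) (Fin 2) ℤ).det) h1 f
  rw [act_unipotent hT] at this
  rw [this]
  congr 2
  ext i j; fin_cases i <;> fin_cases j <;> simp
  linarith

lemma act_translation_act_diag {q x : ℤ} (hq : 0 < q) {a : ℤ} (ha : 0 < a) :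
    act m !![q, x; 0, q] (act m !![a, 0; 0, 1] f) =
      act m !![a, 0; 0, 1] (act m !![q, a * x; 0, q] f) := by
  have h1 : 0 < (!![q, x; 0, q] : Matrix (Fin 2) (Fin 2) ℤ).det := by simpa using by positivity
  have h2 : 0 < (!![q, a * x; 0, q] : Matrix (Fin 2) (Fin 2) ℤ).det := by simpa using by positivity
  have h3 : 0 < (!![a, 0; 0, 1] : Matrix (Fin 2) (Fin 2) ℤ).det := by simpa using ha
  rw [act_act m h3 h1, act_act m h2 h3]
  congr 2
  ext i j; fin_cases i <;> fin_cases j <;> simp [mul_comm]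

lemma act_translation_act_translation {q r x y : ℤ} (hq : 0 < q) (hr : 0 < r) :
    act m !![q, x; 0, q] (act m !![r, y; 0, r] f) = act m !![q * r, x * r + y * q; 0, q * r] f := by
  have h1 : 0 < (!![q, x; 0, q] : Matrix (Fin 2) (Fin 2) ℤ).det := by simpa using by positivity
  have h2 : 0 < (!![r, y; 0, r] : Matrix (Fin 2) (Fin 2) ℤ).det := by simpa using by positivity
  rw [act_act m h2 h1]
  congr 2
  ext i j; fin_cases i <;> fin_cases j <;> simp [mul_comm]

lemma act_translation_scale {q r x : ℤ} (hr : 0 < r) :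
    act m !![r * q, r * x; 0, r * q] f = act m !![q, x; 0, q] f := by
  rw [← act_smul_matrix m (A := !![q, x; 0, q]) hr.ne']
  simp

lemma act_diag_act_diag {a b : ℤ} (ha : 0 < a) (hb : 0 < b) :
    act m !![a, 0; 0, 1] (act m !![b, 0; 0, 1] f) = act m !![a * b, 0; 0, 1] f := by
  have h1 : 0 < (!![a, 0; 0, 1] : Matrix (Fin 2) (Fin 2) ℤ).det := by simpa using ha
  have h2 : 0 < (!![b, 0; 0, 1] : Matrix (Fin 2) (Fin 2) ℤ).det := by simpa using hb
  rw [act_act m h2 h1]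
  simp [mul_comm]

/-- The action of the matrices `[1, j; 0, p]`, followed by `[p, 0; 0, 1]`, is translation. -/
lemma act_diag_act_hecke {p j : ℤ} (hp : 0 < p) :
    act m !![p, 0; 0, 1] (act m !![1, j; 0, p] f) = act m !![p, j; 0, p] f := by
  have h1 : 0 < (!![p, 0; 0, 1] : Matrix (Fin 2) (Fin 2) ℤ).det := by simpa using hp
  have h2 : 0 < (!![1, j; 0, p] : Matrix (Fin 2) (Fin 2) ℤ).det := by simpa using hp
  rw [act_act m h2 h1]
  simp

lemma act_translation_zero {q : ℤ} (hq : 0 < q) : act m !![q, 0; 0, q] f = f := by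
  refine Eq.trans ?_ (act_scalar m hq.ne' f)
  congr 2
  ext i j; fin_cases i <;> fin_cases j <;> simp

section HeckeTwo

variable {l : ℂ}
  (h2 : act m !![1, 0; 0, 2] f + act m !![1, 1; 0, 2] f + act m !![2, 0; 0, 1] f = l • f)

-- Dilating the Hecke relation by 2 turns the matrices `[1, j; 0, 2]` into translations by `j / 2`.
-- The outcome is symmetric under `a ↔ 4 / a`.
include h2 in
lemma translation_half : act m !![2, 1; 0, 2] f =
    l • act m !![2, 0; 0, 1] f - f - act m !![4, 0; 0, 1] f := by
  have := congrArg (act m !![2, 0; 0, 1]) h2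
  simp only [map_add, map_smul, act_diag_act_hecke two_pos,
    act_diag_act_diag (m := m) (f := f) two_pos two_pos, act_translation_zero two_pos] at this
  norm_num at this
  rw [← this]; abel

-- Translate the formula for `f(z + 1/2)` by `1/4`: the left side becomes `f(z + 3/4)`, and the term
-- `f(2 z + 1/2)` on the right is expanded by the same formula. The outcome is symmetric under `a ↔
-- 16 / a`.
include h2 in
lemma translation_quarter (hT : act m !![1, 1; 0, 1] f = f) :
    act m !![4, 1; 0, 4] f + act m !![4, -1; 0, 4] f =
      (l ^ 2 - 1) • act m !![4, 0; 0, 1] f - l • act m !![2, 0; 0, 1] f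
        - l • act m !![8, 0; 0, 1] f := by
  have h := translation_half h2
  have h' := congrArg (act m !![4, 1; 0, 4]) h
  simp only [map_sub, map_smul, act_translation_act_diag (m := m) (f := f) four_pos two_pos,
    act_translation_act_diag (m := m) (f := f) four_pos four_pos] at h'
  rw [act_translation_act_translation (m := m) four_pos two_pos,
    show (!![4 * 2, 1 * 2 + 1 * 4; 0, 4 * 2] : Matrix (Fin 2) (Fin 2) ℤ) =
      !![2 * 4, 2 * 3; 0, 2 * 4] by norm_num, act_translation_scale two_pos,
    act_translation_congr hT four_pos (by norm_num : (4 : ℤ) ∣ 3 - -1),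
    show (!![4, 2 * 1; 0, 4] : Matrix (Fin 2) (Fin 2) ℤ) = !![2 * 2, 2 * 1; 0, 2 * 2] by norm_num,
    act_translation_scale two_pos, h,
    act_translation_congr hT four_pos (by norm_num : (4 : ℤ) ∣ 4 * 1 - 0),
    act_translation_zero four_pos] at h'
  simp only [map_sub, map_smul, act_diag_act_diag (m := m) (f := f) two_pos two_pos,
    act_diag_act_diag (m := m) (f := f) two_pos four_pos] at h'
  norm_num at h'
  rw [h']
  module

include h2 in
lemma act_fricke_translation_half (hN : 0 < N) (hH : act m !![0, -1; N, 0] f = ε • f) :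
    act m !![0, -1; 4 * N, 0] (act m !![2, 1; 0, 2] f) = ε • act m !![2, 1; 0, 2] f := by
  have e0 := act_fricke_act_diag hN hH one_pos four_pos (M := 4 * N) (by ring)
  have e1 := act_fricke_act_diag hN hH two_pos two_pos (M := 4 * N) (by ring)
  have e2 := act_fricke_act_diag hN hH four_pos one_pos (M := 4 * N) (by ring)
  rw [act_diag_one] at e0 e2
  rw [translation_half h2]
  simp only [map_sub, map_smul, e0, e1, e2]
  module

include h2 in
lemma act_fricke_translation_quarter (hT : act m !![1, 1; 0, 1] f = f) (hN : 0 < N)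
    (hH : act m !![0, -1; N, 0] f = ε • f) :
    act m !![0, -1; 16 * N, 0] (act m !![4, 1; 0, 4] f + act m !![4, -1; 0, 4] f) =
      ε • (act m !![4, 1; 0, 4] f + act m !![4, -1; 0, 4] f) := by
  have e1 := act_fricke_act_diag hN hH two_pos (by norm_num : (0 : ℤ) < 8) (M := 16 * N) (by ring)
  have e2 := act_fricke_act_diag hN hH four_pos four_pos (M := 16 * N) (by ring)
  have e3 := act_fricke_act_diag hN hH (by norm_num : (0 : ℤ) < 8) two_pos (M := 16 * N) (by ring)
  rw [translation_quarter h2 hT]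
  simp only [map_sub, map_smul, e1, e2, e3]
  module

end HeckeTwo

section HeckeThree

variable {l₃ : ℂ}
  (h3 : act m !![1, 0; 0, 3] f + act m !![1, 1; 0, 3] f + act m !![1, 2; 0, 3] f +
    act m !![3, 0; 0, 1] f = l₃ • f)

-- The relation at 3 gives only the sum of the two translates. This is why `twist_relation` couples
-- two involutions instead of yielding a semi-invariance.
include h3 in
lemma translation_third (hT : act m !![1, 1; 0, 1] f = f) :
    act m !![3, 1; 0, 3] f + act m !![3, -1; 0, 3] f =
      l₃ • act m !![3, 0; 0, 1] f - f - act m !![9, 0; 0, 1] f := by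
  have := congrArg (act m !![3, 0; 0, 1]) h3
  simp only [map_add, map_smul, act_diag_act_hecke three_pos,
    act_diag_act_diag (m := m) (f := f) three_pos three_pos, act_translation_zero three_pos] at this
  norm_num at this
  rw [← this, act_translation_congr hT three_pos (by norm_num : (3 : ℤ) ∣ 2 - -1)]; abel

include h3 in
lemma act_fricke_translation_third (hT : act m !![1, 1; 0, 1] f = f) (hN : 0 < N)
    (hH : act m !![0, -1; N, 0] f = ε • f) :
    act m !![0, -1; 9 * N, 0] (act m !![3, 1; 0, 3] f + act m !![3, -1; 0, 3] f) =
      ε • (act m !![3, 1; 0, 3] f + act m !![3, -1; 0, 3] f) := by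
  have h9 : (0 : ℤ) < 9 := by norm_num
  have e0 := act_fricke_act_diag hN hH one_pos h9 (M := 9 * N) (by ring)
  have e1 := act_fricke_act_diag hN hH three_pos three_pos (M := 9 * N) (by ring)
  have e2 := act_fricke_act_diag hN hH h9 one_pos (M := 9 * N) (by ring)
  rw [act_diag_one] at e0 e2
  rw [translation_third h3 hT]
  simp only [map_sub, map_smul, e0, e1, e2]
  module

variable {l : ℂ}
  (h2 : act m !![1, 0; 0, 2] f + act m !![1, 1; 0, 2] f + act m !![2, 0; 0, 1] f = l • f)

-- Sum the translates by `± 1/3` of the formula for `f(z + 1/2)` and apply `translation_third` to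
-- each dilate. The outcome is symmetric under `a ↔ 36 / a`.
include h2 h3 in
lemma translation_sixth (hT : act m !![1, 1; 0, 1] f = f) :
    act m !![6, 1; 0, 6] f + act m !![6, -1; 0, 6] f =
      l • (l₃ • act m !![6, 0; 0, 1] f - act m !![2, 0; 0, 1] f - act m !![18, 0; 0, 1] f)
      - (l₃ • act m !![3, 0; 0, 1] f - f - act m !![9, 0; 0, 1] f)
      - (l₃ • act m !![12, 0; 0, 1] f - act m !![4, 0; 0, 1] f - act m !![36, 0; 0, 1] f) := by
  have h9 : (0 : ℤ) < 9 := by norm_num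
  have h := translation_half h2
  have t := translation_third h3 hT
  have h' := congrArg (fun g => act m !![3, 1; 0, 3] g + act m !![3, -1; 0, 3] g) h
  simp only [map_sub, map_smul, act_translation_act_diag (m := m) (f := f) three_pos two_pos,
    act_translation_act_diag (m := m) (f := f) three_pos four_pos,
    act_translation_act_translation (m := m) (f := f) three_pos two_pos] at h'
  rw [act_translation_congr hT three_pos (by norm_num : (3 : ℤ) ∣ 2 * 1 - -1),
    act_translation_congr hT three_pos (by norm_num : (3 : ℤ) ∣ 2 * -1 - 1),
    act_translation_congr hT three_pos (by norm_num : (3 : ℤ) ∣ 4 * 1 - 1),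
    act_translation_congr hT three_pos (by norm_num : (3 : ℤ) ∣ 4 * -1 - -1),
    act_translation_congr hT (by norm_num) (by norm_num : (3 * 2 : ℤ) ∣ (1 * 2 + 1 * 3) - -1),
    act_translation_congr hT (by norm_num) (by norm_num : (3 * 2 : ℤ) ∣ (-1 * 2 + 1 * 3) - 1)] at h'
  have t2 := congrArg (act m !![2, 0; 0, 1]) t
  have t4 := congrArg (act m !![4, 0; 0, 1]) t
  simp only [map_add, map_sub, map_smul, act_diag_act_diag (m := m) (f := f) two_pos three_pos,
    act_diag_act_diag (m := m) (f := f) two_pos h9,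
    act_diag_act_diag (m := m) (f := f) four_pos three_pos,
    act_diag_act_diag (m := m) (f := f) four_pos h9] at t2 t4
  norm_num at h' t2 t4
  rw [← t, ← t2, ← t4, add_comm, h']
  module

include h2 h3 in
lemma act_fricke_translation_sixth (hT : act m !![1, 1; 0, 1] f = f) (hN : 0 < N)
    (hH : act m !![0, -1; N, 0] f = ε • f) :
    act m !![0, -1; 36 * N, 0] (act m !![6, 1; 0, 6] f + act m !![6, -1; 0, 6] f) =
      ε • (act m !![6, 1; 0, 6] f + act m !![6, -1; 0, 6] f) := by
  have e : ∀ a b : ℤ, 0 < a → 0 < b → a * b = 36 →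
      act m !![0, -1; 36 * N, 0] (act m !![a, 0; 0, 1] f) = ε • act m !![b, 0; 0, 1] f :=
    fun a b ha hb hab => act_fricke_act_diag hN hH ha hb (by rw [hab]; ring)
  have e0 := e 1 36 (by norm_num) (by norm_num) (by norm_num)
  have e9 := e 36 1 (by norm_num) (by norm_num) (by norm_num)
  rw [act_diag_one] at e0 e9
  rw [translation_sixth h3 h2 hT]
  simp only [map_sub, map_smul, e0, e9, e 2 18 (by norm_num) (by norm_num) (by norm_num),
    e 18 2 (by norm_num) (by norm_num) (by norm_num), e 3 12 (by norm_num) (by norm_num) (by norm_num),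
    e 12 3 (by norm_num) (by norm_num) (by norm_num), e 4 9 (by norm_num) (by norm_num) (by norm_num),
    e 9 4 (by norm_num) (by norm_num) (by norm_num), e 6 6 (by norm_num) (by norm_num) (by norm_num)]
  module

end HeckeThree

/-- The symmetry of the twists under the Fricke involutions, in terms of the involutions of level
`N` with centres `± 1 / q`. -/
lemma twist_relation {q t : ℤ} (hq : 0 < q) (hN : 0 < N) (ht : q * t = N + 1) (hε : ε ^ 2 = 1)
    (h : act m !![0, -1; q ^ 2 * N, 0] (act m !![q, 1; 0, q] f + act m !![q, -1; 0, q] f) =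
      ε • (act m !![q, 1; 0, q] f + act m !![q, -1; 0, q] f)) :
    act m !![q, 1; 0, q] (f - ε • act m !![N, -t; q * N, -N] f) +
      act m !![q, -1; 0, q] (f - ε • act m !![-N, -t; q * N, N] f) = 0 := by
  have hd1 : ∀ x : ℤ, 0 < (!![q, x; 0, q] : Matrix (Fin 2) (Fin 2) ℤ).det := fun x => by
    simpa using by positivity
  have hd2 : 0 < (!![0, -1; q ^ 2 * N, 0] : Matrix (Fin 2) (Fin 2) ℤ).det := by
    simpa using by positivity
  have hd3 : 0 < (!![N, -t; q * N, -N] : Matrix (Fin 2) (Fin 2) ℤ).det := by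
    rw [det_fin_two_of]; nlinarith
  have hd4 : 0 < (!![-N, -t; q * N, N] : Matrix (Fin 2) (Fin 2) ℤ).det := by
    rw [det_fin_two_of]; nlinarith
  -- The hypothesis `q t = N + 1` makes the conjugate of the Fricke matrix of level `q² N` by `z ↦ z
  -- + 1/q` proportional to an integral matrix of determinant `N`.
  have e1 : act m !![q, 1; 0, q] (act m !![N, -t; q * N, -N] f) =
      act m !![0, -1; q ^ 2 * N, 0] (act m !![q, 1; 0, q] f) := by
    rw [act_comp m (hd1 1) hd2 (C := !![N, -t; q * N, -N] * !![q, 1; 0, q]) hq.ne',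
      act_act m hd3 (hd1 1)]
    ext i j; fin_cases i <;> fin_cases j <;> simp <;>
      first | (left; ring1) | (right; ring1) | ring1 | linear_combination q * ht
  have e2 : act m !![q, -1; 0, q] (act m !![-N, -t; q * N, N] f) =
      act m !![0, -1; q ^ 2 * N, 0] (act m !![q, -1; 0, q] f) := by
    rw [act_comp m (hd1 (-1)) hd2 (C := !![-N, -t; q * N, N] * !![q, -1; 0, q]) hq.ne',
      act_act m hd4 (hd1 (-1))]
    ext i j; fin_cases i <;> fin_cases j <;> simp <;>
      first | (left; ring1) | (right; ring1) | ring1 | linear_combination q * ht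
  rw [map_sub, map_sub, map_smul, map_smul, e1, e2]
  rw [map_add] at h
  have h' := congrArg (ε • ·) h
  simp only [smul_smul, ← sq, hε, one_smul, smul_add] at h'
  rw [sub_add_sub_comm, h', sub_self]

end Relations

/-! ### Vanishing of the defects of the coupled involutions -/

section Vanishing

variable {m : ℤ} {f : ℍ → ℂ} {N : ℤ} {ε : ℂ}

lemma act_translation_neg_cancel {q : ℤ} (hq : 0 < q) (g : ℍ → ℂ) :
    act m !![q, 1; 0, q] (act m !![q, -1; 0, q] g) = g := by
  rw [act_translation_act_translation hq hq, show (1 : ℤ) * q + -1 * q = 0 by ring,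
    act_translation_zero (by positivity)]

lemma act_translation_twice {q : ℤ} (hq : 0 < q) (g : ℍ → ℂ) :
    act m !![q, 1; 0, q] (act m !![q, 1; 0, q] g) = act m !![q, 2; 0, q] g := by
  rw [act_translation_act_translation hq hq, ← act_translation_scale (q := q) (x := 2) hq]
  congr 2
  ext i j; fin_cases i <;> fin_cases j <;> simp <;> ring

lemma eq_neg_act_of_translation_relation {q : ℤ} (hq : 0 < q) {g h : ℍ → ℂ}
    (hrel : act m !![q, 1; 0, q] g + act m !![q, -1; 0, q] h = 0) :
    h = -act m !![q, 2; 0, q] g := by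
  have := congrArg (act m !![q, 1; 0, q]) hrel
  rw [map_add, map_zero, act_translation_neg_cancel hq, act_translation_twice hq] at this
  exact eq_neg_of_add_eq_zero_right this

-- Let `g`, `h` be the defects of `X`, `Y` and `τ` the translation by `1/q`. The relation reads `h =
-- -g | τ²`; the link `S Y S' ~ X` gives `g = s h | S'`; and `X² ~ 1` gives `g | X = -χ g`. Chained
-- together, these make `g` an eigenfunction of `X τ² S'`, which `hell` and `hdvd` make elliptic of
-- infinite order.
open scoped Manifold in
lemma eq_of_link (hm : 0 < m) (hf : MDiff f) {X Y S S' : Matrix (Fin 2) (Fin 2) ℤ} {χ s : ℂ}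
    (hχ : χ ^ 2 = 1) (hs : s ^ 2 = 1) (hS : IsSemiInvariant m f S s)
    (hS' : IsSemiInvariant m f S' s) (hX : 0 < X.det) (hY : 0 < Y.det)
    {k l : ℤ} (hk : k ≠ 0) (hXX : X * X = k • 1) (hl : l ≠ 0) (hXY : S * Y * S' = l • X)
    {q : ℤ} (hq : 0 < q)
    (hrel : act m !![q, 1; 0, q] (f - χ • act m X f) +
      act m !![q, -1; 0, q] (f - χ • act m Y f) = 0)
    (hell : (X * !![q, 2; 0, q] * S').trace ^ 2 < 4 * (X * !![q, 2; 0, q] * S').det)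
    (hdvd : ¬ (X * !![q, 2; 0, q] * S').det ∣ (X * !![q, 2; 0, q] * S').trace ^ 2) :
    act m X f = χ • f ∧ act m Y f = χ • f := by
  set g := f - χ • act m X f with hg
  set h := f - χ • act m Y f with hh
  have hd : 0 < (!![q, 2; 0, q] : Matrix (Fin 2) (Fin 2) ℤ).det := by simpa using by positivity
  have hhg := eq_neg_act_of_translation_relation hq hrel
  have hXg : act m X g = -χ • g := by
    have h1 : act m X (act m X f) = f := by rw [act_act m hX hX, hXX, act_scalar m hk]
    rw [hg, map_sub, map_smul, h1, smul_sub, smul_smul, neg_mul, ← sq, hχ]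
    module
  have hgh : g = s • act m S' h := by
    have h1 : act m X f = s • act m S' (act m Y f) := by
      rw [← act_smul_matrix m hl, ← hXY, ← act_act m (by rw [det_mul]; exact mul_pos hS.1 hY) hS'.1,
        ← act_act m hS.1 hY, hS.2, map_smul, map_smul]
    rw [hh, map_sub, map_smul, hS'.2, smul_sub, smul_smul, ← sq, hs, one_smul, hg, h1,
      smul_comm s χ]
  have hE : act m (X * !![q, 2; 0, q] * S') g = (χ * s) • g := by
    have e : act m S' (act m !![q, 2; 0, q] g) = -(s • g) := by
      conv_rhs => rw [hgh, hhg]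
      rw [map_neg, smul_neg, smul_neg, smul_smul, ← sq, hs, one_smul, neg_neg]
    rw [← act_act m (by rw [det_mul]; exact mul_pos hX hd) hS'.1, ← act_act m hX hd, hXg, map_smul,
      map_smul, e]
    module
  have hg0 : g = 0 := by
    refine eq_zero_of_act_elliptic hm hell hdvd ?_ (χ := χ * s) (by rw [mul_pow, hχ, hs, one_mul]) hE
    exact hf.sub ((mdifferentiable_act hf m X).const_smul χ)
  have hh0 : h = 0 := by rw [hhg, hg0, map_zero, neg_zero]
  have key : ∀ Z : Matrix (Fin 2) (Fin 2) ℤ, f - χ • act m Z f = 0 → act m Z f = χ • f := by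
    intro Z hZ
    rw [sub_eq_zero] at hZ
    conv_rhs => rw [hZ]
    rw [smul_smul, ← sq, hχ, one_smul]
  exact ⟨key X hg0, key Y hh0⟩

open scoped Manifold in
/-- If `N + 1 = q * r` and `f` satisfies the relations with denominators `q` and `r`, then `f` is
semi-invariant under the involutions with centres `± 1 / q`. -/
lemma eq_of_dual_relations (hm : 0 < m) (hf : MDiff f) (hε : ε ^ 2 = 1) {q r : ℤ} (hq : 0 < q)
    (hr : 0 < r) (hN : N = q * r - 1) (hN3 : 3 < N) (hH : act m !![0, -1; N, 0] f = ε • f)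
    (hrelq : act m !![q, 1; 0, q] (f - ε • act m !![N, -r; q * N, -N] f) +
      act m !![q, -1; 0, q] (f - ε • act m !![-N, -r; q * N, N] f) = 0)
    (hrelr : act m !![r, 1; 0, r] (f - ε • act m !![N, -q; r * N, -N] f) +
      act m !![r, -1; 0, r] (f - ε • act m !![-N, -q; r * N, N] f) = 0) :
    act m !![N, -r; q * N, -N] f = ε • f ∧ act m !![-N, -r; q * N, N] f = ε • f := by
  have hN0 : 0 < N := by omega
  have hdH : 0 < (!![0, -1; N, 0] : Matrix (Fin 2) (Fin 2) ℤ).det := by simpa using hN0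
  have hdX : 0 < (!![N, -r; q * N, -N] : Matrix (Fin 2) (Fin 2) ℤ).det := by
    rw [det_fin_two_of]; nlinarith
  have hdY : 0 < (!![-N, -r; q * N, N] : Matrix (Fin 2) (Fin 2) ℤ).det := by
    rw [det_fin_two_of]; nlinarith
  have hdq : 0 < (!![q, 2; 0, q] : Matrix (Fin 2) (Fin 2) ℤ).det := by simpa using by positivity
  have hdr : 0 < (!![r, 2; 0, r] : Matrix (Fin 2) (Fin 2) ℤ).det := by simpa using by positivity
  set g := f - ε • act m !![N, -r; q * N, -N] f with hg
  set h := f - ε • act m !![-N, -r; q * N, N] f with hh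
  have hHH : ∀ k : ℍ → ℂ, act m !![0, -1; N, 0] (act m !![0, -1; N, 0] k) = k := fun k => by
    rw [act_comp m (c := -N) (C := 1) hdH hdH (by omega), act_one]
    ext i j; fin_cases i <;> fin_cases j <;> simp
  -- As `N + 1 = q r`, conjugation by `H` exchanges the involutions with centres `∓ 1/q` and `±
  -- 1/r`. The relation for `r` thus becomes one between `g | H` and `h | H`.
  have hconj : ∀ A B : Matrix (Fin 2) (Fin 2) ℤ, 0 < A.det →
      !![0, -1; N, 0] * A * !![0, -1; N, 0] = (-N) • B →
      f - ε • act m B f = ε • act m !![0, -1; N, 0] (f - ε • act m A f) := by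
    intro A B hA hAB
    rw [← act_smul_matrix m (c := -N) (by omega) (A := B), ← hAB,
      ← act_act m (by rw [det_mul]; exact mul_pos hdH hA) hdH, ← act_act m hdH hA, hH, map_smul,
      map_smul, map_sub, hH, map_smul, smul_sub, smul_smul, ← sq, hε, one_smul, smul_smul, ← sq, hε,
      one_smul]
  have e1 : f - ε • act m !![N, -q; r * N, -N] f = ε • act m !![0, -1; N, 0] h := by
    refine hconj _ _ hdY ?_
    ext i j; fin_cases i <;> fin_cases j <;> simp <;> ring
  have e2 : f - ε • act m !![-N, -q; r * N, N] f = ε • act m !![0, -1; N, 0] g := by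
    refine hconj _ _ hdX ?_
    ext i j; fin_cases i <;> fin_cases j <;> simp <;> ring
  have hhg := eq_neg_act_of_translation_relation hq hrelq
  rw [e1, e2] at hrelr
  have hgh := eq_neg_act_of_translation_relation hr hrelr
  have hε0 : ε ≠ 0 := by rintro rfl; simp at hε
  rw [map_smul, ← smul_neg] at hgh
  have hgh' := smul_right_injective _ hε0 hgh
  -- Going round: translation by `2/q` takes `g` to `-h`, translation by `2/r` takes `h | H` to `-g
  -- | H`, and `H` is an involution up to a scalar.
  have hE : act m (!![q, 2; 0, q] * !![0, -1; N, 0] * !![r, 2; 0, r] * !![0, -1; N, 0]) g =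
      (1 : ℂ) • g := by
    rw [← act_act m (by simp only [det_mul]; positivity) hdH,
      ← act_act m (by simp only [det_mul]; positivity) hdr, ← act_act m hdq hdH, one_smul]
    have : act m !![q, 2; 0, q] g = -h := by rw [hhg, neg_neg]
    rw [this, map_neg, map_neg, ← hgh', hHH]
  have hprod : !![q, 2; 0, q] * !![0, -1; N, 0] * !![r, 2; 0, r] * !![0, -1; N, 0] =
      !![N * (4 * N - q * r), -(2 * N * r); 2 * q * N ^ 2, -(q * r * N)] := by
    ext i j; fin_cases i <;> fin_cases j <;> simp <;> ring
  rw [hprod] at hE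
  have htr : (!![N * (4 * N - q * r), -(2 * N * r); 2 * q * N ^ 2, -(q * r * N)] :
      Matrix (Fin 2) (Fin 2) ℤ).trace = N * (2 * (N - 1)) := by
    rw [trace_fin_two_of, hN]; ring
  have hdet : (!![N * (4 * N - q * r), -(2 * N * r); 2 * q * N ^ 2, -(q * r * N)] :
      Matrix (Fin 2) (Fin 2) ℤ).det = N ^ 2 * (N + 1) ^ 2 := by
    rw [det_fin_two_of, hN]; ring
  have hg0 : g = 0 := by
    refine eq_zero_of_act_elliptic hm ?_ ?_ ?_ (χ := 1) (by norm_num) hE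
    · rw [htr, hdet]
      nlinarith [mul_pos hN0 hN0, mul_pos (mul_pos hN0 hN0) hN0]
    -- If `det` divided `tr²`, then `N + 1` would divide `2 (N - 1)`, hence 4; this is where `N > 3`
    -- is needed.
    · rw [htr, hdet, mul_pow, Int.mul_dvd_mul_iff_left (by positivity), Int.pow_dvd_pow_iff two_ne_zero]
      intro hd
      have : (N + 1) ∣ 4 := by
        have := dvd_sub (Dvd.intro_left 2 (rfl : 2 * (N + 1) = _)) hd
        rwa [show 2 * (N + 1) - 2 * (N - 1) = 4 by ring] at this
      have := Int.le_of_dvd (by norm_num) this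
      omega
    · exact hf.sub ((mdifferentiable_act hf m _).const_smul ε)
  have hh0 : h = 0 := by rw [hhg, hg0, map_zero, neg_zero]
  have key : ∀ Z : Matrix (Fin 2) (Fin 2) ℤ, f - ε • act m Z f = 0 → act m Z f = ε • f := by
    intro Z hZ
    rw [sub_eq_zero] at hZ
    conv_rhs => rw [hZ]
    rw [smul_smul, ← sq, hε, one_smul]
  exact ⟨key _ hg0, key _ hh0⟩

/-- Semi-invariance under the involution with centre `1 / 2`, from a symmetry of `f (z + 1 / 2)`. -/
lemma isSemiInvariant_half {M : ℤ} {χ : ℂ} {a b c : ℤ} (hM : 0 < M)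
    (h : act m !![0, -1; M, 0] (act m !![2, 1; 0, 2] f) = χ • act m !![2, 1; 0, 2] f)
    {k : ℤ} (hk : k ≠ 0) (hprod : !![2, 1; 0, 2] * !![0, -1; M, 0] * !![2, -1; 0, 2] =
      k • !![a, b; c, -a]) : IsSemiInvariant m f !![a, b; c, -a] χ := by
  have h1 : 0 < (!![2, 1; 0, 2] : Matrix (Fin 2) (Fin 2) ℤ).det := by simp
  have h2 : 0 < (!![0, -1; M, 0] : Matrix (Fin 2) (Fin 2) ℤ).det := by simpa using hM
  have h3 : 0 < (!![2, -1; 0, 2] : Matrix (Fin 2) (Fin 2) ℤ).det := by simp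
  have : IsSemiInvariant m f (!![2, 1; 0, 2] * !![0, -1; M, 0] * !![2, -1; 0, 2]) χ := by
    refine ⟨by simp only [det_mul]; positivity, ?_⟩
    rw [← act_act m (by simp only [det_mul]; positivity) h3, ← act_act m h1 h2, h, map_smul,
      act_translation_act_translation two_pos two_pos,
      show (-1 : ℤ) * 2 + 1 * 2 = 0 by norm_num, act_translation_zero (by norm_num)]
  exact this.of_eq_smul hk hprod

end Vanishing

/-! ### Coverings, relations at primes dividing `N`, and the levels one by one -/

lemma IsSemiInvariant.of_eq_smul_one {m : ℤ} {f : ℍ → ℂ} {A B : Matrix (Fin 2) (Fin 2) ℤ} {c d : ℂ}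
    (hA : IsSemiInvariant m f A c) (h : A = B) (hc : c = d) : IsSemiInvariant m f B d := by
  rwa [← h, ← hc]

/-- In lowest terms `v / u` has denominator `u ≥ N`, so it is none of the fractions with denominator
below `N`. These include the points that the open intervals of a covering leave out. -/
lemma mul_ne_of_isCoprime {N u v : ℤ} (hu : 0 < u) (hN : N ∣ u) (h : IsCoprime u v) (i j : ℤ)
    (hj : 0 < j) (hjN : j < N) : j * v ≠ i * u := by
  intro he
  have h1 : u ∣ j := h.dvd_of_dvd_mul_right ⟨i, by linarith⟩
  have := Int.le_of_dvd hu hN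
  have := Int.le_of_dvd hj h1
  omega

/-- The intervals `((j - 1)/N, (j + 1)/N)` with `1 ≤ j < N` cover `(0, 1)`, and `v ≠ 0`. For `j`
take the integer part of `N v / u`, or 1 if that is 0. -/
lemma cover_of_prime_level {N : ℤ} (hN : 1 < N) (u v : ℤ) (hu : 0 < u) (hv : 0 ≤ v) (hvu : v < u)
    (hdvd : N ∣ u) (hcop : IsCoprime u v) :
    ∃ r ∈ {r : ℤ × ℤ | r.1 = N ∧ 1 ≤ r.2 ∧ r.2 < N}, |u * r.2 - v * r.1| < u := by
  have h0 : v ≠ 0 := by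
    have := mul_ne_of_isCoprime hu hdvd hcop 0 1 one_pos hN
    simpa using this
  have hv' : 0 < v := by omega
  have h1 := Int.emod_add_mul_ediv (N * v) u
  have h2 := Int.emod_nonneg (N * v) hu.ne'
  have h3 := Int.emod_lt_of_pos (N * v) hu
  set j := N * v / u
  have hj0 : 0 ≤ j := Int.ediv_nonneg (by positivity) hu.le
  have hjN : j < N := by
    by_contra hcon
    nlinarith
  rcases hj0.eq_or_lt with hj | hj
  · refine ⟨(N, 1), ⟨rfl, le_rfl, hN⟩, ?_⟩
    have : 0 < N * v := by positivity
    rw [← hj] at h1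
    rw [abs_lt]
    constructor <;> simp only <;> nlinarith
  · refine ⟨(N, j), ⟨rfl, hj, hjN⟩, ?_⟩
    rw [abs_lt]
    constructor <;> simp only <;> nlinarith

/-- Here `f(z + 1/2)` is the dilate of `f` by 2 minus `f`. The involution of level `2 N` exchanges
the two terms up to `ε`; antisymmetry gives the sign `-ε`. -/
lemma act_fricke_translation_half_steinberg {m : ℤ} {f : ℍ → ℂ} {N : ℤ} {ε : ℂ}
    (h2 : act m !![1, 0; 0, 2] f + act m !![1, 1; 0, 2] f = f) (hN : 0 < N)
    (hH : act m !![0, -1; N, 0] f = ε • f) :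
    act m !![0, -1; 2 * N, 0] (act m !![2, 1; 0, 2] f) = (-ε) • act m !![2, 1; 0, 2] f := by
  have h := congrArg (act m !![2, 0; 0, 1]) h2
  simp only [map_add, act_diag_act_hecke two_pos, act_translation_zero two_pos] at h
  have e0 := act_fricke_act_diag hN hH one_pos two_pos (M := 2 * N) (by ring)
  have e1 := act_fricke_act_diag hN hH two_pos one_pos (M := 2 * N) (by ring)
  rw [act_diag_one] at e0 e1
  rw [eq_sub_of_add_eq' h]
  simp only [map_sub, e0, e1]
  module

/-- The hypothesis amounts to `f(z + 1/2) = -f(z)`. So for `4 ∣ N` the translation by `1/2` is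
itself available as a letter, with eigenvalue `-1`. -/
lemma isSemiInvariant_translation_half {m : ℤ} {f : ℍ → ℂ} (hT : act m !![1, 1; 0, 1] f = f)
    (h2 : act m !![1, 0; 0, 2] f + act m !![1, 1; 0, 2] f = 0) :
    IsSemiInvariant m f !![2, 1; 0, 2] (-1) ∧ IsSemiInvariant m f !![2, -1; 0, 2] (-1) := by
  have h := congrArg (act m !![2, 0; 0, 1]) h2
  simp only [map_add, map_zero, act_diag_act_hecke two_pos, act_translation_zero two_pos] at h
  have h' : act m !![2, 1; 0, 2] f = (-1 : ℂ) • f := by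
    rw [neg_one_smul]; exact eq_neg_of_add_eq_zero_right h
  refine ⟨⟨by simp, h'⟩, by simp, ?_⟩
  rw [act_translation_congr hT two_pos (by norm_num : (2 : ℤ) ∣ -1 - 1), h']

/-- The translates by `± 1/3` sum to the dilate by 3 minus `f`, which the Fricke involution of level
45 multiplies by `-ε`. Conjugated by the translations, that involution becomes a matrix of
determinant 5, not 15. -/
lemma act_fricke_translation_third_fifteen {m : ℤ} {f : ℍ → ℂ} {ε : ℂ}
    (h3 : act m !![1, 0; 0, 3] f + act m !![1, 1; 0, 3] f + act m !![1, 2; 0, 3] f = f)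
    (hT : act m !![1, 1; 0, 1] f = f) (hε : ε ^ 2 = 1) (hH : act m !![0, -1; 15, 0] f = ε • f) :
    act m !![3, 1; 0, 3] (f - (-ε) • act m !![5, -2; 15, -5] f) +
      act m !![3, -1; 0, 3] (f - (-ε) • act m !![-5, -2; 15, 5] f) = 0 := by
  have h := congrArg (act m !![3, 0; 0, 1]) h3
  simp only [map_add, act_diag_act_hecke three_pos, act_translation_zero three_pos] at h
  rw [act_translation_congr hT three_pos (by norm_num : (3 : ℤ) ∣ 2 - -1), add_assoc] at h
  have e0 := act_fricke_act_diag (N := 15) (by norm_num) hH one_pos three_pos (M := 45) (by norm_num)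
  have e1 := act_fricke_act_diag (N := 15) (by norm_num) hH three_pos one_pos (M := 45) (by norm_num)
  rw [act_diag_one] at e0 e1
  have h' := eq_sub_of_add_eq' h
  have h'' := congrArg (act m !![0, -1; 45, 0]) h'
  rw [map_sub, e0, e1] at h''
  have s1 : act m !![3, 1; 0, 3] (act m !![5, -2; 15, -5] f) =
      act m !![0, -1; 45, 0] (act m !![3, 1; 0, 3] f) := by
    rw [act_act m (by decide) (by decide), act_act m (by decide) (by decide),
      ← act_smul_matrix m (A := !![5, -2; 15, -5] * !![3, 1; 0, 3]) (c := 3) (by norm_num)]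
    congr 2
    decide
  have s2 : act m !![3, -1; 0, 3] (act m !![-5, -2; 15, 5] f) =
      act m !![0, -1; 45, 0] (act m !![3, -1; 0, 3] f) := by
    rw [act_act m (by decide) (by decide), act_act m (by decide) (by decide),
      ← act_smul_matrix m (A := !![-5, -2; 15, 5] * !![3, -1; 0, 3]) (c := 3) (by norm_num)]
    congr 2
    decide
  rw [map_sub, map_sub, map_smul, map_smul, s1, s2, sub_add_sub_comm, ← smul_add, ← map_add, h', map_sub,
    e0, e1, smul_sub, smul_smul, smul_smul, neg_mul, ← sq, hε]
  module

/-- Each residue `j` occurs as lower right entry of an element of `Γ₀(5)` which is, up to the scalar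
`k`, a word in `H`, translations and the involution `I` with centre `1/2`. The word contains an even
number of letters with eigenvalue `ε`, so it fixes `f`. The other levels follow the same pattern
with other letters. -/
lemma act_eq_of_level_five {m : ℤ} {f : ℍ → ℂ}
    {ε : ℂ} (hε : ε ^ 2 = 1) (hT' : act m !![1, 1; 0, 1] f = f)
    (hH' : act m !![0, -1; 5, 0] f = ε • f)
    {l : ℂ} (h2 : act m !![1, 0; 0, 2] f + act m !![1, 1; 0, 2] f + act m !![2, 0; 0, 1] f = l • f)
    (a b c d : ℤ) (hdet : a * d - b * c = 1) (hc : 5 ∣ c) : act m !![a, b; c, d] f = f := by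
  have hH : IsSemiInvariant m f !![0, -1; 5, 0] ε := ⟨by simp, hH'⟩
  have hT := isSemiInvariant_unipotent hT'
  have hI : IsSemiInvariant m f !![5, -3; 10, -5] ε :=
    isSemiInvariant_half (by norm_num) (act_fricke_translation_half h2 (by norm_num) hH') (k := 8)
      (by norm_num)
      (by decide)
  refine act_eq_of_cover hT' (R := {r | r.1 = 5 ∧ 1 ≤ r.2 ∧ r.2 < 5}) ?_ (cover_of_prime_level (by norm_num))
    a b c d hdet hc
  rintro ⟨_, j⟩ ⟨rfl, h1, h2⟩
  refine ⟨dvd_rfl, ?_⟩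
  simp only at h1 h2 ⊢
  interval_cases j
  · exact ⟨1, 0, by norm_num, ((hH.mul (hT (-1))).mul hH).act_eq (k := -5)
        (by norm_num) (by decide) (by linear_combination hε)⟩
  · exact ⟨-2, -1, by norm_num, ((hH.mul hI).mul (hT 1)).act_eq (k := 5)
        (by norm_num) (by decide) (by linear_combination hε)⟩
  · exact ⟨2, 1, by norm_num, (((hH.mul (hT (-1))).mul hI).mul (hT 1)).act_eq (k := -5)
        (by norm_num) (by decide) (by linear_combination hε)⟩
  · exact ⟨-1, -1, by norm_num, (((hH.mul (hT 1)).mul hH).mul (hT 1)).act_eq (k := 5)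
        (by norm_num) (by decide) (by linear_combination hε)⟩

lemma act_eq_of_level_six {m : ℤ} {f : ℍ → ℂ}
    {ε : ℂ} (hε : ε ^ 2 = 1) (hT' : act m !![1, 1; 0, 1] f = f)
    (hH' : act m !![0, -1; 6, 0] f = ε • f)
    (h2 : act m !![1, 0; 0, 2] f + act m !![1, 1; 0, 2] f = f)
    (a b c d : ℤ) (hdet : a * d - b * c = 1) (hc : 6 ∣ c) : act m !![a, b; c, d] f = f := by
  have hH : IsSemiInvariant m f !![0, -1; 6, 0] ε := ⟨by simp, hH'⟩
  have hT := isSemiInvariant_unipotent hT'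
  have hJ : IsSemiInvariant m f !![3, -2; 6, -3] (-ε) :=
    isSemiInvariant_half (by norm_num) (act_fricke_translation_half_steinberg h2 (by norm_num) hH') (k := 8)
      (by norm_num) (by decide)
  refine act_eq_of_cover hT' (N := 6) (R := {(6, 1), (6, 5), (12, 5), (12, 7)}) ?_ ?_
    a b c d hdet hc
  · simp only [Set.mem_insert_iff, Set.mem_singleton_iff, forall_eq_or_imp, forall_eq]
    refine ⟨⟨by norm_num, ?_⟩, ⟨by norm_num, ?_⟩, ⟨by norm_num, ?_⟩, ⟨by norm_num, ?_⟩⟩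
    · exact ⟨1, 0, by norm_num, ((hH.mul (hT (-1))).mul hH).act_eq (k := -6)
        (by norm_num) (by decide) (by linear_combination hε)⟩
    · exact ⟨-1, -1, by norm_num, (((hH.mul (hT 1)).mul hH).mul (hT 1)).act_eq (k := 6)
        (by norm_num) (by decide) (by linear_combination hε)⟩
    · exact ⟨5, 2, by norm_num, (((hJ.mul (hT 1)).mul hJ).mul (hT 1)).act_eq (k := 3)
        (by norm_num) (by decide) (by linear_combination hε)⟩
    · exact ⟨7, 4, by norm_num, (((hJ.mul (hT (-1))).mul hJ).mul (hT 1)).act_eq (k := -3)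
        (by norm_num) (by decide) (by linear_combination hε)⟩
  · intro u v hu hv hvu hdvd hcop
    -- The intervals of radius `1 / r.1` about `r.2 / r.1` cover `[0, 1)` except for `0, 1/3, 1/2,
    -- 2/3`, which `v / u` avoids. Composite levels below are treated likewise.
    have hne := mul_ne_of_isCoprime hu hdvd hcop
    have := hne 0 1 (by norm_num) (by norm_num)
    have := hne 1 3 (by norm_num) (by norm_num)
    have := hne 1 2 (by norm_num) (by norm_num)
    have := hne 2 3 (by norm_num) (by norm_num)
    simp only [Set.mem_insert_iff, Set.mem_singleton_iff, exists_eq_or_imp, exists_eq_left, abs_lt]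
    omega

lemma act_eq_of_level_seven {m : ℤ} {f : ℍ → ℂ}
    {ε : ℂ} (hε : ε ^ 2 = 1) (hT' : act m !![1, 1; 0, 1] f = f)
    (hH' : act m !![0, -1; 7, 0] f = ε • f)
    {l : ℂ} (h2 : act m !![1, 0; 0, 2] f + act m !![1, 1; 0, 2] f + act m !![2, 0; 0, 1] f = l • f)
    (a b c d : ℤ) (hdet : a * d - b * c = 1) (hc : 7 ∣ c) : act m !![a, b; c, d] f = f := by
  have hH : IsSemiInvariant m f !![0, -1; 7, 0] ε := ⟨by simp, hH'⟩
  have hT := isSemiInvariant_unipotent hT'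
  have hI : IsSemiInvariant m f !![7, -4; 14, -7] ε :=
    isSemiInvariant_half (by norm_num) (act_fricke_translation_half h2 (by norm_num) hH') (k := 8)
      (by norm_num)
      (by decide)
  refine act_eq_of_cover hT' (R := {r | r.1 = 7 ∧ 1 ≤ r.2 ∧ r.2 < 7}) ?_ (cover_of_prime_level (by norm_num))
    a b c d hdet hc
  rintro ⟨_, j⟩ ⟨rfl, h1, h2⟩
  refine ⟨dvd_rfl, ?_⟩
  simp only at h1 h2 ⊢
  interval_cases j
  · exact ⟨1, 0, by norm_num, ((hH.mul (hT (-1))).mul hH).act_eq (k := -7)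
        (by norm_num) (by decide) (by linear_combination hε)⟩
  · exact ⟨4, 1, by norm_num, (hI.mul hH).act_eq (k := -7)
        (by norm_num) (by decide) (by linear_combination hε)⟩
  · exact ⟨-2, -1, by norm_num, ((hH.mul hI).mul (hT 1)).act_eq (k := 7)
        (by norm_num) (by decide) (by linear_combination hε)⟩
  · exact ⟨2, 1, by norm_num, (((hH.mul (hT (-1))).mul hI).mul (hT 1)).act_eq (k := -7)
        (by norm_num) (by decide) (by linear_combination hε)⟩
  · exact ⟨3, 2, by norm_num, (((hI.mul (hT 1)).mul hH).mul (hT 1)).act_eq (k := 7)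
        (by norm_num) (by decide) (by linear_combination hε)⟩
  · exact ⟨-1, -1, by norm_num, (((hH.mul (hT 1)).mul hH).mul (hT 1)).act_eq (k := 7)
        (by norm_num) (by decide) (by linear_combination hε)⟩

lemma act_eq_of_level_eight {m : ℤ} {f : ℍ → ℂ}
    {ε : ℂ} (hε : ε ^ 2 = 1) (hT' : act m !![1, 1; 0, 1] f = f)
    (hH' : act m !![0, -1; 8, 0] f = ε • f)
    (h2 : act m !![1, 0; 0, 2] f + act m !![1, 1; 0, 2] f = 0)
    (a b c d : ℤ) (hdet : a * d - b * c = 1) (hc : 8 ∣ c) : act m !![a, b; c, d] f = f := by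
  have hH : IsSemiInvariant m f !![0, -1; 8, 0] ε := ⟨by simp, hH'⟩
  have hT := isSemiInvariant_unipotent hT'
  have hS := isSemiInvariant_translation_half hT' h2
  refine act_eq_of_cover hT' (N := 8) (R := {(8, 1), (8, 3), (8, 5), (8, 7)}) ?_ ?_
    a b c d hdet hc
  · simp only [Set.mem_insert_iff, Set.mem_singleton_iff, forall_eq_or_imp, forall_eq]
    refine ⟨⟨by norm_num, ?_⟩, ⟨by norm_num, ?_⟩, ⟨by norm_num, ?_⟩, ⟨by norm_num, ?_⟩⟩
    · exact ⟨1, 0, by norm_num, ((hH.mul (hT (-1))).mul hH).act_eq (k := -8)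
        (by norm_num) (by decide) (by linear_combination hε)⟩
    · exact ⟨3, 1, by norm_num, ((((hS.1.mul hH).mul (hT 1)).mul hH).mul hS.1).act_eq (k := 32)
        (by norm_num) (by decide) (by linear_combination hε)⟩
    · exact ⟨5, 3, by norm_num, ((((hS.1.mul hH).mul (hT (-1))).mul hH).mul hS.1).act_eq (k := -32)
        (by norm_num) (by decide) (by linear_combination hε)⟩
    · exact ⟨-1, -1, by norm_num, (((hH.mul (hT 1)).mul hH).mul (hT 1)).act_eq (k := 8)
        (by norm_num) (by decide) (by linear_combination hε)⟩
  · intro u v hu hv hvu hdvd hcop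
    have hne := mul_ne_of_isCoprime hu hdvd hcop
    have := hne 0 1 (by norm_num) (by norm_num)
    have := hne 1 4 (by norm_num) (by norm_num)
    have := hne 1 2 (by norm_num) (by norm_num)
    have := hne 3 4 (by norm_num) (by norm_num)
    simp only [Set.mem_insert_iff, Set.mem_singleton_iff, exists_eq_or_imp, exists_eq_left, abs_lt]
    omega

lemma act_eq_of_level_nine {m : ℤ} {f : ℍ → ℂ}
    {ε : ℂ} (hε : ε ^ 2 = 1) (hT' : act m !![1, 1; 0, 1] f = f)
    (hH' : act m !![0, -1; 9, 0] f = ε • f)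
    {l : ℂ} (h2 : act m !![1, 0; 0, 2] f + act m !![1, 1; 0, 2] f + act m !![2, 0; 0, 1] f = l • f)
    (a b c d : ℤ) (hdet : a * d - b * c = 1) (hc : 9 ∣ c) : act m !![a, b; c, d] f = f := by
  have hH : IsSemiInvariant m f !![0, -1; 9, 0] ε := ⟨by simp, hH'⟩
  have hT := isSemiInvariant_unipotent hT'
  have hI : IsSemiInvariant m f !![9, -5; 18, -9] ε :=
    isSemiInvariant_half (by norm_num) (act_fricke_translation_half h2 (by norm_num) hH') (k := 8)
      (by norm_num)
      (by decide)
  refine act_eq_of_cover hT' (N := 9) (R := {(9, 1), (9, 2), (9, 4), (9, 5), (9, 7), (9, 8)}) ?_ ?_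
    a b c d hdet hc
  · simp only [Set.mem_insert_iff, Set.mem_singleton_iff, forall_eq_or_imp, forall_eq]
    refine ⟨⟨by norm_num, ?_⟩, ⟨by norm_num, ?_⟩, ⟨by norm_num, ?_⟩, ⟨by norm_num, ?_⟩, ⟨by norm_num, ?_⟩, ⟨by norm_num, ?_⟩⟩
    · exact ⟨1, 0, by norm_num, ((hH.mul (hT (-1))).mul hH).act_eq (k := -9)
        (by norm_num) (by decide) (by linear_combination hε)⟩
    · exact ⟨5, 1, by norm_num, (hI.mul hH).act_eq (k := -9)
        (by norm_num) (by decide) (by linear_combination hε)⟩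
    · exact ⟨-2, -1, by norm_num, ((hH.mul hI).mul (hT 1)).act_eq (k := 9)
        (by norm_num) (by decide) (by linear_combination hε)⟩
    · exact ⟨2, 1, by norm_num, (((hH.mul (hT (-1))).mul hI).mul (hT 1)).act_eq (k := -9)
        (by norm_num) (by decide) (by linear_combination hε)⟩
    · exact ⟨4, 3, by norm_num, (((hI.mul (hT 1)).mul hH).mul (hT 1)).act_eq (k := 9)
        (by norm_num) (by decide) (by linear_combination hε)⟩
    · exact ⟨-1, -1, by norm_num, (((hH.mul (hT 1)).mul hH).mul (hT 1)).act_eq (k := 9)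
        (by norm_num) (by decide) (by linear_combination hε)⟩
  · intro u v hu hv hvu hdvd hcop
    have hne := mul_ne_of_isCoprime hu hdvd hcop
    have := hne 0 1 (by norm_num) (by norm_num)
    have := hne 1 3 (by norm_num) (by norm_num)
    have := hne 2 3 (by norm_num) (by norm_num)
    simp only [Set.mem_insert_iff, Set.mem_singleton_iff, exists_eq_or_imp, exists_eq_left, abs_lt]
    omega

lemma act_eq_of_level_ten {m : ℤ} {f : ℍ → ℂ}
    {ε : ℂ} (hε : ε ^ 2 = 1) (hT' : act m !![1, 1; 0, 1] f = f)
    (hH' : act m !![0, -1; 10, 0] f = ε • f)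
    (h2 : act m !![1, 0; 0, 2] f + act m !![1, 1; 0, 2] f = f)
    (a b c d : ℤ) (hdet : a * d - b * c = 1) (hc : 10 ∣ c) : act m !![a, b; c, d] f = f := by
  have hH : IsSemiInvariant m f !![0, -1; 10, 0] ε := ⟨by simp, hH'⟩
  have hT := isSemiInvariant_unipotent hT'
  have hJ : IsSemiInvariant m f !![5, -3; 10, -5] (-ε) :=
    isSemiInvariant_half (by norm_num) (act_fricke_translation_half_steinberg h2 (by norm_num) hH') (k := 8)
      (by norm_num) (by decide)
  refine act_eq_of_cover hT' (N := 10) (R := {(10, 1), (10, 3), (10, 7), (10, 9), (20, 9), (20, 11)}) ?_ ?_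
    a b c d hdet hc
  · simp only [Set.mem_insert_iff, Set.mem_singleton_iff, forall_eq_or_imp, forall_eq]
    refine ⟨⟨by norm_num, ?_⟩, ⟨by norm_num, ?_⟩, ⟨by norm_num, ?_⟩, ⟨by norm_num, ?_⟩, ⟨by norm_num, ?_⟩, ⟨by norm_num, ?_⟩⟩
    · exact ⟨1, 0, by norm_num, ((hH.mul (hT (-1))).mul hH).act_eq (k := -10)
        (by norm_num) (by decide) (by linear_combination hε)⟩
    · exact ⟨-3, -1, by norm_num, (((((hH.mul hJ).mul (hT 1)).mul hH).mul hJ).mul (hT 1)).act_eq (k := 50)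
        (by norm_num) (by decide) (by linear_combination (ε ^ 2 + 1) * hε)⟩
    · exact ⟨3, 2, by norm_num, ((((((hH.mul (hT (-1))).mul hJ).mul hH).mul (hT (-1))).mul hJ).mul (hT 1)).act_eq (k := -50)
        (by norm_num) (by decide) (by linear_combination (ε ^ 2 + 1) * hε)⟩
    · exact ⟨-1, -1, by norm_num, (((hH.mul (hT 1)).mul hH).mul (hT 1)).act_eq (k := 10)
        (by norm_num) (by decide) (by linear_combination hε)⟩
    · exact ⟨9, 4, by norm_num, (((hJ.mul (hT 1)).mul hJ).mul (hT 1)).act_eq (k := 5)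
        (by norm_num) (by decide) (by linear_combination hε)⟩
    · exact ⟨11, 6, by norm_num, (((hJ.mul (hT (-1))).mul hJ).mul (hT 1)).act_eq (k := -5)
        (by norm_num) (by decide) (by linear_combination hε)⟩
  · intro u v hu hv hvu hdvd hcop
    have hne := mul_ne_of_isCoprime hu hdvd hcop
    have := hne 0 1 (by norm_num) (by norm_num)
    have := hne 1 5 (by norm_num) (by norm_num)
    have := hne 2 5 (by norm_num) (by norm_num)
    have := hne 1 2 (by norm_num) (by norm_num)
    have := hne 3 5 (by norm_num) (by norm_num)
    have := hne 4 5 (by norm_num) (by norm_num)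
    simp only [Set.mem_insert_iff, Set.mem_singleton_iff, exists_eq_or_imp, exists_eq_left, abs_lt]
    omega

-- Since `11 + 1 = 3 · 4`, the relations with denominators 3 and 4 are dual to each other.
open scoped Manifold in
lemma act_eq_of_level_eleven {m : ℤ} (hm : 0 < m) {f : ℍ → ℂ} (hf : MDiff f)
    {ε : ℂ} (hε : ε ^ 2 = 1) (hT' : act m !![1, 1; 0, 1] f = f)
    (hH' : act m !![0, -1; 11, 0] f = ε • f)
    {l : ℂ} (h2 : act m !![1, 0; 0, 2] f + act m !![1, 1; 0, 2] f + act m !![2, 0; 0, 1] f = l • f)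
    {l₃ : ℂ} (h3 : act m !![1, 0; 0, 3] f + act m !![1, 1; 0, 3] f + act m !![1, 2; 0, 3] f +
      act m !![3, 0; 0, 1] f = l₃ • f)
    (a b c d : ℤ) (hdet : a * d - b * c = 1) (hc : 11 ∣ c) : act m !![a, b; c, d] f = f := by
  have hH : IsSemiInvariant m f !![0, -1; 11, 0] ε := ⟨by simp, hH'⟩
  have hT := isSemiInvariant_unipotent hT'
  have hI : IsSemiInvariant m f !![11, -6; 22, -11] ε :=
    isSemiInvariant_half (by norm_num) (act_fricke_translation_half h2 (by norm_num) hH') (k := 8)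
      (by norm_num)
      (by decide)
  have rq := twist_relation (q := 3) (t := 4) (by norm_num) (by norm_num : (0 : ℤ) < 11) (by norm_num) hε
    (act_fricke_translation_third h3 hT' (by norm_num) hH')
  have rr := twist_relation (q := 4) (t := 3) (by norm_num) (by norm_num : (0 : ℤ) < 11) (by norm_num) hε
    (act_fricke_translation_quarter h2 hT' (by norm_num) hH')
  obtain ⟨hX', hY'⟩ := eq_of_dual_relations hm hf hε (q := 3) (r := 4) (N := 11) (by norm_num) (by norm_num)
    (by norm_num) (by norm_num) hH' rq rr
  have hX : IsSemiInvariant m f !![11, -4; 33, -11] ε := ⟨by decide, hX'⟩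
  have hY : IsSemiInvariant m f !![-11, -4; 33, 11] ε := ⟨by decide, hY'⟩
  refine act_eq_of_cover hT' (R := {r | r.1 = 11 ∧ 1 ≤ r.2 ∧ r.2 < 11}) ?_ (cover_of_prime_level (by norm_num))
    a b c d hdet hc
  rintro ⟨_, j⟩ ⟨rfl, h1, h2⟩
  refine ⟨dvd_rfl, ?_⟩
  simp only at h1 h2 ⊢
  interval_cases j
  · exact ⟨1, 0, by norm_num, ((hH.mul (hT (-1))).mul hH).act_eq (k := -11)
        (by norm_num) (by decide) (by linear_combination hε)⟩
  · exact ⟨6, 1, by norm_num, (hI.mul hH).act_eq (k := -11)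
        (by norm_num) (by decide) (by linear_combination hε)⟩
  · exact ⟨4, 1, by norm_num, ((hI.mul (hT 1)).mul hY).act_eq (k := 11)
        (by norm_num) (by decide) (by linear_combination hε)⟩
  · exact ⟨3, 1, by norm_num, (hH.mul hY).act_eq (k := -11)
        (by norm_num) (by decide) (by linear_combination hε)⟩
  · exact ⟨-2, -1, by norm_num, ((hH.mul hI).mul (hT 1)).act_eq (k := 11)
        (by norm_num) (by decide) (by linear_combination hε)⟩
  · exact ⟨2, 1, by norm_num, (((hH.mul (hT (-1))).mul hI).mul (hT 1)).act_eq (k := -11)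
        (by norm_num) (by decide) (by linear_combination hε)⟩
  · exact ⟨-3, -2, by norm_num, ((hH.mul hX).mul (hT 1)).act_eq (k := 11)
        (by norm_num) (by decide) (by linear_combination hε)⟩
  · exact ⟨7, 5, by norm_num, ((hI.mul hX).mul (hT 1)).act_eq (k := -11)
        (by norm_num) (by decide) (by linear_combination hε)⟩
  · exact ⟨5, 4, by norm_num, (((hI.mul (hT 1)).mul hH).mul (hT 1)).act_eq (k := 11)
        (by norm_num) (by decide) (by linear_combination hε)⟩
  · exact ⟨-1, -1, by norm_num, (((hH.mul (hT 1)).mul hH).mul (hT 1)).act_eq (k := 11)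
        (by norm_num) (by decide) (by linear_combination hε)⟩

lemma act_eq_of_level_twelve {m : ℤ} {f : ℍ → ℂ}
    {ε : ℂ} (hε : ε ^ 2 = 1) (hT' : act m !![1, 1; 0, 1] f = f)
    (hH' : act m !![0, -1; 12, 0] f = ε • f)
    (h2 : act m !![1, 0; 0, 2] f + act m !![1, 1; 0, 2] f = 0)
    (a b c d : ℤ) (hdet : a * d - b * c = 1) (hc : 12 ∣ c) : act m !![a, b; c, d] f = f := by
  have hH : IsSemiInvariant m f !![0, -1; 12, 0] ε := ⟨by simp, hH'⟩
  have hT := isSemiInvariant_unipotent hT'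
  have hS := isSemiInvariant_translation_half hT' h2
  refine act_eq_of_cover hT' (N := 12) (R := {(12, 1), (12, 5), (12, 7), (12, 11), (24, 5), (24, 7), (24, 17), (24, 19)}) ?_ ?_
    a b c d hdet hc
  · simp only [Set.mem_insert_iff, Set.mem_singleton_iff, forall_eq_or_imp, forall_eq]
    refine ⟨⟨by norm_num, ?_⟩, ⟨by norm_num, ?_⟩, ⟨by norm_num, ?_⟩, ⟨by norm_num, ?_⟩, ⟨by norm_num, ?_⟩, ⟨by norm_num, ?_⟩, ⟨by norm_num, ?_⟩, ⟨by norm_num, ?_⟩⟩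
    · exact ⟨1, 0, by norm_num, ((hH.mul (hT (-1))).mul hH).act_eq (k := -12)
        (by norm_num) (by decide) (by linear_combination hε)⟩
    · exact ⟨5, 2, by norm_num, ((((hS.1.mul hH).mul (hT 1)).mul hH).mul hS.1).act_eq (k := 48)
        (by norm_num) (by decide) (by linear_combination hε)⟩
    · exact ⟨7, 4, by norm_num, ((((hS.1.mul hH).mul (hT (-1))).mul hH).mul hS.1).act_eq (k := -48)
        (by norm_num) (by decide) (by linear_combination hε)⟩
    · exact ⟨-1, -1, by norm_num, (((hH.mul (hT 1)).mul hH).mul (hT 1)).act_eq (k := 12)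
        (by norm_num) (by decide) (by linear_combination hε)⟩
    · exact ⟨5, 1, by norm_num, ((((((hH.mul hS.2).mul hH).mul (hT (-1))).mul hH).mul hS.2).mul hH).act_eq (k := -576)
        (by norm_num) (by decide) (by linear_combination (ε ^ 2 + 1) * hε)⟩
    · exact ⟨7, 2, by norm_num, ((((((((hS.1.mul hH).mul hS.1).mul hH).mul (hT 1)).mul hH).mul hS.1).mul hH).mul hS.1).act_eq (k := 2304)
        (by norm_num) (by decide) (by linear_combination (ε ^ 2 + 1) * hε)⟩
    · exact ⟨17, 12, by norm_num, ((((((((hS.1.mul hH).mul hS.2).mul hH).mul (hT (-1))).mul hH).mul hS.2).mul hH).mul hS.1).act_eq (k := -2304)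
        (by norm_num) (by decide) (by linear_combination (ε ^ 2 + 1) * hε)⟩
    · exact ⟨-5, -4, by norm_num, (((((((hH.mul hS.1).mul hH).mul (hT 1)).mul hH).mul hS.1).mul hH).mul (hT 1)).act_eq (k := 576)
        (by norm_num) (by decide) (by linear_combination (ε ^ 2 + 1) * hε)⟩
  · intro u v hu hv hvu hdvd hcop
    have hne := mul_ne_of_isCoprime hu hdvd hcop
    have := hne 0 1 (by norm_num) (by norm_num)
    have := hne 1 6 (by norm_num) (by norm_num)
    have := hne 1 4 (by norm_num) (by norm_num)
    have := hne 1 3 (by norm_num) (by norm_num)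
    have := hne 1 2 (by norm_num) (by norm_num)
    have := hne 2 3 (by norm_num) (by norm_num)
    have := hne 3 4 (by norm_num) (by norm_num)
    have := hne 5 6 (by norm_num) (by norm_num)
    simp only [Set.mem_insert_iff, Set.mem_singleton_iff, exists_eq_or_imp, exists_eq_left, abs_lt]
    omega

-- Here `14 + 1 = 3 · 5`, and the Hecke relations at 2 and 3 give nothing with denominator 5. The
-- involutions with centres `± 1/3` are linked through `J`, whose centre is `1/2`.
open scoped Manifold in
lemma act_eq_of_level_fourteen {m : ℤ} (hm : 0 < m) {f : ℍ → ℂ} (hf : MDiff f)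
    {ε : ℂ} (hε : ε ^ 2 = 1) (hT' : act m !![1, 1; 0, 1] f = f)
    (hH' : act m !![0, -1; 14, 0] f = ε • f)
    (h2 : act m !![1, 0; 0, 2] f + act m !![1, 1; 0, 2] f = f)
    {l₃ : ℂ} (h3 : act m !![1, 0; 0, 3] f + act m !![1, 1; 0, 3] f + act m !![1, 2; 0, 3] f +
      act m !![3, 0; 0, 1] f = l₃ • f)
    (a b c d : ℤ) (hdet : a * d - b * c = 1) (hc : 14 ∣ c) : act m !![a, b; c, d] f = f := by
  have hH : IsSemiInvariant m f !![0, -1; 14, 0] ε := ⟨by simp, hH'⟩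
  have hT := isSemiInvariant_unipotent hT'
  have hJ : IsSemiInvariant m f !![7, -4; 14, -7] (-ε) :=
    isSemiInvariant_half (by norm_num) (act_fricke_translation_half_steinberg h2 (by norm_num) hH') (k := 8)
      (by norm_num) (by decide)
  have r3 := twist_relation (q := 3) (t := 5) (by norm_num) (by norm_num : (0 : ℤ) < 14) (by norm_num) hε
    (act_fricke_translation_third h3 hT' (by norm_num) hH')
  have hS₁ : IsSemiInvariant m f !![7, 3; 14, 7] (-ε) :=
    (show IsSemiInvariant m f _ _ from (hJ.mul (hT 1))).of_eq_smul_one (by decide) (by ring)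
  have hS₂ : IsSemiInvariant m f !![-7, 3; 14, -7] (-ε) :=
    (show IsSemiInvariant m f _ _ from ((hT (-1)).mul hJ)).of_eq_smul_one (by decide) (by ring)
  obtain ⟨hX', hY'⟩ := eq_of_link hm hf (χ := ε) (s := (-ε)) (by linear_combination hε) (by linear_combination hε) hS₁ hS₂
    (X := !![14, -5; 42, -14]) (Y := !![-14, -5; 42, 14]) (by decide) (by decide) (k := -14) (by norm_num) (by decide)
    (l := -7) (by norm_num) (by decide) (q := 3) (by norm_num) r3 (by decide) (by decide)
  have hX : IsSemiInvariant m f !![14, -5; 42, -14] ε := ⟨by decide, hX'⟩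
  have hY : IsSemiInvariant m f !![-14, -5; 42, 14] ε := ⟨by decide, hY'⟩
  refine act_eq_of_cover hT' (N := 14) (R := {(14, 1), (14, 3), (14, 5), (14, 9), (14, 11), (14, 13), (28, 13), (28, 15)}) ?_ ?_
    a b c d hdet hc
  · simp only [Set.mem_insert_iff, Set.mem_singleton_iff, forall_eq_or_imp, forall_eq]
    refine ⟨⟨by norm_num, ?_⟩, ⟨by norm_num, ?_⟩, ⟨by norm_num, ?_⟩, ⟨by norm_num, ?_⟩, ⟨by norm_num, ?_⟩, ⟨by norm_num, ?_⟩, ⟨by norm_num, ?_⟩, ⟨by norm_num, ?_⟩⟩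
    · exact ⟨1, 0, by norm_num, ((hH.mul (hT (-1))).mul hH).act_eq (k := -14)
        (by norm_num) (by decide) (by linear_combination hε)⟩
    · exact ⟨5, 1, by norm_num, (hX.mul hH).act_eq (k := -14)
        (by norm_num) (by decide) (by linear_combination hε)⟩
    · exact ⟨3, 1, by norm_num, (hH.mul hY).act_eq (k := -14)
        (by norm_num) (by decide) (by linear_combination hε)⟩
    · exact ⟨-3, -2, by norm_num, ((hH.mul hX).mul (hT 1)).act_eq (k := 14)
        (by norm_num) (by decide) (by linear_combination hε)⟩
    · exact ⟨-5, -4, by norm_num, ((hY.mul hH).mul (hT 1)).act_eq (k := 14)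
        (by norm_num) (by decide) (by linear_combination hε)⟩
    · exact ⟨-1, -1, by norm_num, (((hH.mul (hT 1)).mul hH).mul (hT 1)).act_eq (k := 14)
        (by norm_num) (by decide) (by linear_combination hε)⟩
    · exact ⟨13, 6, by norm_num, (((hJ.mul (hT 1)).mul hJ).mul (hT 1)).act_eq (k := 7)
        (by norm_num) (by decide) (by linear_combination hε)⟩
    · exact ⟨15, 8, by norm_num, (((hJ.mul (hT (-1))).mul hJ).mul (hT 1)).act_eq (k := -7)
        (by norm_num) (by decide) (by linear_combination hε)⟩
  · intro u v hu hv hvu hdvd hcop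
    have hne := mul_ne_of_isCoprime hu hdvd hcop
    have := hne 0 1 (by norm_num) (by norm_num)
    have := hne 1 7 (by norm_num) (by norm_num)
    have := hne 2 7 (by norm_num) (by norm_num)
    have := hne 3 7 (by norm_num) (by norm_num)
    have := hne 1 2 (by norm_num) (by norm_num)
    have := hne 4 7 (by norm_num) (by norm_num)
    have := hne 5 7 (by norm_num) (by norm_num)
    have := hne 6 7 (by norm_num) (by norm_num)
    simp only [Set.mem_insert_iff, Set.mem_singleton_iff, exists_eq_or_imp, exists_eq_left, abs_lt]
    omega

-- The involutions of determinant 5 with centres `± 1/3` are linked through `H` on one side and a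
-- translate of `I` on the other.
open scoped Manifold in
lemma act_eq_of_level_fifteen {m : ℤ} (hm : 0 < m) {f : ℍ → ℂ} (hf : MDiff f)
    {ε : ℂ} (hε : ε ^ 2 = 1) (hT' : act m !![1, 1; 0, 1] f = f)
    (hH' : act m !![0, -1; 15, 0] f = ε • f)
    {l : ℂ} (h2 : act m !![1, 0; 0, 2] f + act m !![1, 1; 0, 2] f + act m !![2, 0; 0, 1] f = l • f)
    (h3 : act m !![1, 0; 0, 3] f + act m !![1, 1; 0, 3] f + act m !![1, 2; 0, 3] f = f)
    (a b c d : ℤ) (hdet : a * d - b * c = 1) (hc : 15 ∣ c) : act m !![a, b; c, d] f = f := by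
  have hH : IsSemiInvariant m f !![0, -1; 15, 0] ε := ⟨by simp, hH'⟩
  have hT := isSemiInvariant_unipotent hT'
  have hI : IsSemiInvariant m f !![15, -8; 30, -15] ε :=
    isSemiInvariant_half (by norm_num) (act_fricke_translation_half h2 (by norm_num) hH') (k := 8)
      (by norm_num)
      (by decide)
  have r3 := act_fricke_translation_third_fifteen h3 hT' hε hH'
  have hS₁ : IsSemiInvariant m f !![0, -1; 15, 0] ε :=
    (show IsSemiInvariant m f _ _ from hH).of_eq_smul_one (by decide) (by ring)
  have hS₂ : IsSemiInvariant m f !![-15, 7; 30, -15] ε :=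
    (show IsSemiInvariant m f _ _ from ((hT (-1)).mul hI)).of_eq_smul_one (by decide) (by ring)
  obtain ⟨hX', hY'⟩ := eq_of_link hm hf (χ := (-ε)) (s := ε) (by linear_combination hε) (by linear_combination hε) hS₁ hS₂
    (X := !![5, -2; 15, -5]) (Y := !![-5, -2; 15, 5]) (by decide) (by decide) (k := -5) (by norm_num) (by decide)
    (l := 15) (by norm_num) (by decide) (q := 3) (by norm_num) r3 (by decide) (by decide)
  have hX : IsSemiInvariant m f !![5, -2; 15, -5] (-ε) := ⟨by decide, hX'⟩
  have hY : IsSemiInvariant m f !![-5, -2; 15, 5] (-ε) := ⟨by decide, hY'⟩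
  refine act_eq_of_cover hT' (N := 15) (R := {(15, 1), (15, 2), (15, 4), (15, 7), (15, 8), (15, 11), (15, 13), (15, 14), (30, 11), (30, 19)}) ?_ ?_
    a b c d hdet hc
  · simp only [Set.mem_insert_iff, Set.mem_singleton_iff, forall_eq_or_imp, forall_eq]
    refine ⟨⟨by norm_num, ?_⟩, ⟨by norm_num, ?_⟩, ⟨by norm_num, ?_⟩, ⟨by norm_num, ?_⟩, ⟨by norm_num, ?_⟩, ⟨by norm_num, ?_⟩, ⟨by norm_num, ?_⟩, ⟨by norm_num, ?_⟩, ⟨by norm_num, ?_⟩, ⟨by norm_num, ?_⟩⟩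
    · exact ⟨1, 0, by norm_num, ((hH.mul (hT (-1))).mul hH).act_eq (k := -15)
        (by norm_num) (by decide) (by linear_combination hε)⟩
    · exact ⟨8, 1, by norm_num, (hI.mul hH).act_eq (k := -15)
        (by norm_num) (by decide) (by linear_combination hε)⟩
    · exact ⟨4, 1, by norm_num, ((hX.mul (hT 1)).mul hY).act_eq (k := 5)
        (by norm_num) (by decide) (by linear_combination hε)⟩
    · exact ⟨-2, -1, by norm_num, ((hH.mul hI).mul (hT 1)).act_eq (k := 15)
        (by norm_num) (by decide) (by linear_combination hε)⟩
    · exact ⟨2, 1, by norm_num, (((hH.mul (hT (-1))).mul hI).mul (hT 1)).act_eq (k := -15)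
        (by norm_num) (by decide) (by linear_combination hε)⟩
    · exact ⟨-4, -3, by norm_num, (((hY.mul (hT (-1))).mul hX).mul (hT 1)).act_eq (k := -5)
        (by norm_num) (by decide) (by linear_combination hε)⟩
    · exact ⟨7, 6, by norm_num, (((hI.mul (hT 1)).mul hH).mul (hT 1)).act_eq (k := 15)
        (by norm_num) (by decide) (by linear_combination hε)⟩
    · exact ⟨-1, -1, by norm_num, (((hH.mul (hT 1)).mul hH).mul (hT 1)).act_eq (k := 15)
        (by norm_num) (by decide) (by linear_combination hε)⟩
    · exact ⟨11, 4, by norm_num, (hX.mul hY).act_eq (k := -5)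
        (by norm_num) (by decide) (by linear_combination hε)⟩
    · exact ⟨-11, -7, by norm_num, ((hY.mul hX).mul (hT 1)).act_eq (k := 5)
        (by norm_num) (by decide) (by linear_combination hε)⟩
  · intro u v hu hv hvu hdvd hcop
    have hne := mul_ne_of_isCoprime hu hdvd hcop
    have := hne 0 1 (by norm_num) (by norm_num)
    have := hne 1 5 (by norm_num) (by norm_num)
    have := hne 1 3 (by norm_num) (by norm_num)
    have := hne 2 5 (by norm_num) (by norm_num)
    have := hne 3 5 (by norm_num) (by norm_num)
    have := hne 2 3 (by norm_num) (by norm_num)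
    have := hne 4 5 (by norm_num) (by norm_num)
    simp only [Set.mem_insert_iff, Set.mem_singleton_iff, exists_eq_or_imp, exists_eq_left, abs_lt]
    omega

lemma act_eq_of_level_sixteen {m : ℤ} {f : ℍ → ℂ}
    {ε : ℂ} (hε : ε ^ 2 = 1) (hT' : act m !![1, 1; 0, 1] f = f)
    (hH' : act m !![0, -1; 16, 0] f = ε • f)
    (h2 : act m !![1, 0; 0, 2] f + act m !![1, 1; 0, 2] f = 0)
    (a b c d : ℤ) (hdet : a * d - b * c = 1) (hc : 16 ∣ c) : act m !![a, b; c, d] f = f := by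
  have hH : IsSemiInvariant m f !![0, -1; 16, 0] ε := ⟨by simp, hH'⟩
  have hT := isSemiInvariant_unipotent hT'
  have hS := isSemiInvariant_translation_half hT' h2
  refine act_eq_of_cover hT' (N := 16) (R := {(16, 1), (16, 3), (16, 5), (16, 7), (16, 9), (16, 11), (16, 13), (16, 15)}) ?_ ?_
    a b c d hdet hc
  · simp only [Set.mem_insert_iff, Set.mem_singleton_iff, forall_eq_or_imp, forall_eq]
    refine ⟨⟨by norm_num, ?_⟩, ⟨by norm_num, ?_⟩, ⟨by norm_num, ?_⟩, ⟨by norm_num, ?_⟩, ⟨by norm_num, ?_⟩, ⟨by norm_num, ?_⟩, ⟨by norm_num, ?_⟩, ⟨by norm_num, ?_⟩⟩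
    · exact ⟨1, 0, by norm_num, ((hH.mul (hT (-1))).mul hH).act_eq (k := -16)
        (by norm_num) (by decide) (by linear_combination hε)⟩
    · exact ⟨11, 2, by norm_num, (((((((hS.1.mul hH).mul hS.2).mul hH).mul hS.2).mul hH).mul hS.2).mul hH).act_eq (k := -4096)
        (by norm_num) (by decide) (by linear_combination (ε ^ 2 + 1) * hε)⟩
    · exact ⟨-3, -1, by norm_num, (((((((hH.mul hS.1).mul hH).mul hS.1).mul hH).mul hS.1).mul hH).mul hS.1).act_eq (k := 4096)
        (by norm_num) (by decide) (by linear_combination (ε ^ 2 + 1) * hε)⟩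
    · exact ⟨7, 3, by norm_num, ((((hS.1.mul hH).mul (hT 1)).mul hH).mul hS.1).act_eq (k := 64)
        (by norm_num) (by decide) (by linear_combination hε)⟩
    · exact ⟨9, 5, by norm_num, ((((hS.1.mul hH).mul (hT (-1))).mul hH).mul hS.1).act_eq (k := -64)
        (by norm_num) (by decide) (by linear_combination hε)⟩
    · exact ⟨3, 2, by norm_num, (((((((hH.mul hS.2).mul hH).mul hS.2).mul hH).mul hS.2).mul hH).mul hS.1).act_eq (k := -4096)
        (by norm_num) (by decide) (by linear_combination (ε ^ 2 + 1) * hε)⟩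
    · exact ⟨5, 4, by norm_num, ((((((((hS.1.mul hH).mul hS.1).mul hH).mul hS.1).mul hH).mul hS.1).mul hH).mul (hT 1)).act_eq (k := 4096)
        (by norm_num) (by decide) (by linear_combination (ε ^ 2 + 1) * hε)⟩
    · exact ⟨-1, -1, by norm_num, (((hH.mul (hT 1)).mul hH).mul (hT 1)).act_eq (k := 16)
        (by norm_num) (by decide) (by linear_combination hε)⟩
  · intro u v hu hv hvu hdvd hcop
    have hne := mul_ne_of_isCoprime hu hdvd hcop
    have := hne 0 1 (by norm_num) (by norm_num)
    have := hne 1 8 (by norm_num) (by norm_num)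
    have := hne 1 4 (by norm_num) (by norm_num)
    have := hne 3 8 (by norm_num) (by norm_num)
    have := hne 1 2 (by norm_num) (by norm_num)
    have := hne 5 8 (by norm_num) (by norm_num)
    have := hne 3 4 (by norm_num) (by norm_num)
    have := hne 7 8 (by norm_num) (by norm_num)
    simp only [Set.mem_insert_iff, Set.mem_singleton_iff, exists_eq_or_imp, exists_eq_left, abs_lt]
    omega

-- Since `17 + 1 = 3 · 6`, the relations with denominators 3 and 6 are dual to each other.
open scoped Manifold in
lemma act_eq_of_level_seventeen {m : ℤ} (hm : 0 < m) {f : ℍ → ℂ} (hf : MDiff f)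
    {ε : ℂ} (hε : ε ^ 2 = 1) (hT' : act m !![1, 1; 0, 1] f = f)
    (hH' : act m !![0, -1; 17, 0] f = ε • f)
    {l : ℂ} (h2 : act m !![1, 0; 0, 2] f + act m !![1, 1; 0, 2] f + act m !![2, 0; 0, 1] f = l • f)
    {l₃ : ℂ} (h3 : act m !![1, 0; 0, 3] f + act m !![1, 1; 0, 3] f + act m !![1, 2; 0, 3] f +
      act m !![3, 0; 0, 1] f = l₃ • f)
    (a b c d : ℤ) (hdet : a * d - b * c = 1) (hc : 17 ∣ c) : act m !![a, b; c, d] f = f := by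
  have hH : IsSemiInvariant m f !![0, -1; 17, 0] ε := ⟨by simp, hH'⟩
  have hT := isSemiInvariant_unipotent hT'
  have hI : IsSemiInvariant m f !![17, -9; 34, -17] ε :=
    isSemiInvariant_half (by norm_num) (act_fricke_translation_half h2 (by norm_num) hH') (k := 8)
      (by norm_num)
      (by decide)
  have rq := twist_relation (q := 3) (t := 6) (by norm_num) (by norm_num : (0 : ℤ) < 17) (by norm_num) hε
    (act_fricke_translation_third h3 hT' (by norm_num) hH')
  have rr := twist_relation (q := 6) (t := 3) (by norm_num) (by norm_num : (0 : ℤ) < 17) (by norm_num) hε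
    (act_fricke_translation_sixth h3 h2 hT' (by norm_num) hH')
  obtain ⟨hX', hY'⟩ := eq_of_dual_relations hm hf hε (q := 3) (r := 6) (N := 17) (by norm_num) (by norm_num)
    (by norm_num) (by norm_num) hH' rq rr
  have hX : IsSemiInvariant m f !![17, -6; 51, -17] ε := ⟨by decide, hX'⟩
  have hY : IsSemiInvariant m f !![-17, -6; 51, 17] ε := ⟨by decide, hY'⟩
  refine act_eq_of_cover hT' (R := {r | r.1 = 17 ∧ 1 ≤ r.2 ∧ r.2 < 17}) ?_ (cover_of_prime_level (by norm_num))
    a b c d hdet hc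
  rintro ⟨_, j⟩ ⟨rfl, h1, h2⟩
  refine ⟨dvd_rfl, ?_⟩
  simp only at h1 h2 ⊢
  interval_cases j
  · exact ⟨1, 0, by norm_num, ((hH.mul (hT (-1))).mul hH).act_eq (k := -17)
        (by norm_num) (by decide) (by linear_combination hε)⟩
  · exact ⟨9, 1, by norm_num, (hI.mul hH).act_eq (k := -17)
        (by norm_num) (by decide) (by linear_combination hε)⟩
  · exact ⟨6, 1, by norm_num, (hX.mul hH).act_eq (k := -17)
        (by norm_num) (by decide) (by linear_combination hε)⟩
  · exact ⟨-4, -1, by norm_num, ((((hY.mul (hT (-1))).mul hI).mul hX).mul hH).act_eq (k := -289)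
        (by norm_num) (by decide) (by linear_combination (ε ^ 2 + 1) * hε)⟩
  · exact ⟨7, 2, by norm_num, ((hI.mul (hT 1)).mul hY).act_eq (k := 17)
        (by norm_num) (by decide) (by linear_combination hε)⟩
  · exact ⟨3, 1, by norm_num, (hH.mul hY).act_eq (k := -17)
        (by norm_num) (by decide) (by linear_combination hε)⟩
  · exact ⟨5, 2, by norm_num, ((hX.mul hI).mul (hT 1)).act_eq (k := 17)
        (by norm_num) (by decide) (by linear_combination hε)⟩
  · exact ⟨-2, -1, by norm_num, ((hH.mul hI).mul (hT 1)).act_eq (k := 17)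
        (by norm_num) (by decide) (by linear_combination hε)⟩
  · exact ⟨2, 1, by norm_num, (((hH.mul (hT (-1))).mul hI).mul (hT 1)).act_eq (k := -17)
        (by norm_num) (by decide) (by linear_combination hε)⟩
  · exact ⟨-5, -3, by norm_num, (((hY.mul (hT (-1))).mul hI).mul (hT 1)).act_eq (k := -17)
        (by norm_num) (by decide) (by linear_combination hε)⟩
  · exact ⟨-3, -2, by norm_num, ((hH.mul hX).mul (hT 1)).act_eq (k := 17)
        (by norm_num) (by decide) (by linear_combination hε)⟩
  · exact ⟨10, 7, by norm_num, ((hI.mul hX).mul (hT 1)).act_eq (k := -17)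
        (by norm_num) (by decide) (by linear_combination hε)⟩
  · exact ⟨4, 3, by norm_num, (((((hX.mul hI).mul (hT 1)).mul hY).mul hH).mul (hT 1)).act_eq (k := 289)
        (by norm_num) (by decide) (by linear_combination (ε ^ 2 + 1) * hε)⟩
  · exact ⟨-6, -5, by norm_num, ((hY.mul hH).mul (hT 1)).act_eq (k := 17)
        (by norm_num) (by decide) (by linear_combination hε)⟩
  · exact ⟨8, 7, by norm_num, (((hI.mul (hT 1)).mul hH).mul (hT 1)).act_eq (k := 17)
        (by norm_num) (by decide) (by linear_combination hε)⟩
  · exact ⟨-1, -1, by norm_num, (((hH.mul (hT 1)).mul hH).mul (hT 1)).act_eq (k := 17)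
        (by norm_num) (by decide) (by linear_combination hε)⟩

-- Since `23 + 1 = 4 · 6`, duality settles the centres `± 1/4`. The resulting letters `C`, `D` form
-- the word `D H C`, which together with a translate of `I` links the centres `± 1/3`; the dual
-- denominator 8 is not needed.
open scoped Manifold in
lemma act_eq_of_level_twentythree {m : ℤ} (hm : 0 < m) {f : ℍ → ℂ} (hf : MDiff f)
    {ε : ℂ} (hε : ε ^ 2 = 1) (hT' : act m !![1, 1; 0, 1] f = f)
    (hH' : act m !![0, -1; 23, 0] f = ε • f)
    {l : ℂ} (h2 : act m !![1, 0; 0, 2] f + act m !![1, 1; 0, 2] f + act m !![2, 0; 0, 1] f = l • f)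
    {l₃ : ℂ} (h3 : act m !![1, 0; 0, 3] f + act m !![1, 1; 0, 3] f + act m !![1, 2; 0, 3] f +
      act m !![3, 0; 0, 1] f = l₃ • f)
    (a b c d : ℤ) (hdet : a * d - b * c = 1) (hc : 23 ∣ c) : act m !![a, b; c, d] f = f := by
  have hH : IsSemiInvariant m f !![0, -1; 23, 0] ε := ⟨by simp, hH'⟩
  have hT := isSemiInvariant_unipotent hT'
  have hI : IsSemiInvariant m f !![23, -12; 46, -23] ε :=
    isSemiInvariant_half (by norm_num) (act_fricke_translation_half h2 (by norm_num) hH') (k := 8)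
      (by norm_num)
      (by decide)
  have rq := twist_relation (q := 4) (t := 6) (by norm_num) (by norm_num : (0 : ℤ) < 23) (by norm_num) hε
    (act_fricke_translation_quarter h2 hT' (by norm_num) hH')
  have rr := twist_relation (q := 6) (t := 4) (by norm_num) (by norm_num : (0 : ℤ) < 23) (by norm_num) hε
    (act_fricke_translation_sixth h3 h2 hT' (by norm_num) hH')
  obtain ⟨hC', hD'⟩ := eq_of_dual_relations hm hf hε (q := 4) (r := 6) (N := 23) (by norm_num) (by norm_num)
    (by norm_num) (by norm_num) hH' rq rr
  have hC : IsSemiInvariant m f !![23, -6; 92, -23] ε := ⟨by decide, hC'⟩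
  have hD : IsSemiInvariant m f !![-23, -6; 92, 23] ε := ⟨by decide, hD'⟩
  have r3 := twist_relation (q := 3) (t := 8) (by norm_num) (by norm_num : (0 : ℤ) < 23) (by norm_num) hε
    (act_fricke_translation_third h3 hT' (by norm_num) hH')
  have hS₁ : IsSemiInvariant m f !![23, 11; 46, 23] ε :=
    (show IsSemiInvariant m f _ _ from (hI.mul (hT 1))).of_eq_smul_one (by decide) (by ring)
  have hS₂ : IsSemiInvariant m f !![-1058, 299; 3703, -1058] ε :=
    (show IsSemiInvariant m f _ _ from ((hD.mul hH).mul hC)).of_eq_smul_one (by decide)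
      (by linear_combination ε * hε)
  obtain ⟨hX', hY'⟩ := eq_of_link hm hf (χ := ε) (s := ε) (by linear_combination hε) (by linear_combination hε) hS₁ hS₂
    (X := !![23, -8; 69, -23]) (Y := !![-23, -8; 69, 23]) (by decide) (by decide) (k := -23) (by norm_num) (by decide)
    (l := 529) (by norm_num) (by decide) (q := 3) (by norm_num) r3 (by decide) (by decide)
  have hX : IsSemiInvariant m f !![23, -8; 69, -23] ε := ⟨by decide, hX'⟩
  have hY : IsSemiInvariant m f !![-23, -8; 69, 23] ε := ⟨by decide, hY'⟩
  refine act_eq_of_cover hT' (R := {r | r.1 = 23 ∧ 1 ≤ r.2 ∧ r.2 < 23}) ?_ (cover_of_prime_level (by norm_num))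
    a b c d hdet hc
  rintro ⟨_, j⟩ ⟨rfl, h1, h2⟩
  refine ⟨dvd_rfl, ?_⟩
  simp only at h1 h2 ⊢
  interval_cases j
  · exact ⟨1, 0, by norm_num, ((hH.mul (hT (-1))).mul hH).act_eq (k := -23)
        (by norm_num) (by decide) (by linear_combination hε)⟩
  · exact ⟨12, 1, by norm_num, (hI.mul hH).act_eq (k := -23)
        (by norm_num) (by decide) (by linear_combination hε)⟩
  · exact ⟨8, 1, by norm_num, (hX.mul hH).act_eq (k := -23)
        (by norm_num) (by decide) (by linear_combination hε)⟩
  · exact ⟨6, 1, by norm_num, (hC.mul hH).act_eq (k := -23)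
        (by norm_num) (by decide) (by linear_combination hε)⟩
  · exact ⟨-9, -2, by norm_num, (hY.mul hD).act_eq (k := 23)
        (by norm_num) (by decide) (by linear_combination hε)⟩
  · exact ⟨4, 1, by norm_num, (hH.mul hD).act_eq (k := -23)
        (by norm_num) (by decide) (by linear_combination hε)⟩
  · exact ⟨10, 3, by norm_num, ((hI.mul (hT 1)).mul hY).act_eq (k := 23)
        (by norm_num) (by decide) (by linear_combination hε)⟩
  · exact ⟨3, 1, by norm_num, (hH.mul hY).act_eq (k := -23)
        (by norm_num) (by decide) (by linear_combination hε)⟩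
  · exact ⟨-5, -2, by norm_num, (hD.mul hY).act_eq (k := -23)
        (by norm_num) (by decide) (by linear_combination hε)⟩
  · exact ⟨7, 3, by norm_num, ((hX.mul hI).mul (hT 1)).act_eq (k := 23)
        (by norm_num) (by decide) (by linear_combination hε)⟩
  · exact ⟨-2, -1, by norm_num, ((hH.mul hI).mul (hT 1)).act_eq (k := 23)
        (by norm_num) (by decide) (by linear_combination hε)⟩
  · exact ⟨2, 1, by norm_num, (((hH.mul (hT (-1))).mul hI).mul (hT 1)).act_eq (k := -23)
        (by norm_num) (by decide) (by linear_combination hε)⟩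
  · exact ⟨-7, -4, by norm_num, (((hY.mul (hT (-1))).mul hI).mul (hT 1)).act_eq (k := -23)
        (by norm_num) (by decide) (by linear_combination hε)⟩
  · exact ⟨5, 3, by norm_num, ((hC.mul hX).mul (hT 1)).act_eq (k := 23)
        (by norm_num) (by decide) (by linear_combination hε)⟩
  · exact ⟨-3, -2, by norm_num, ((hH.mul hX).mul (hT 1)).act_eq (k := 23)
        (by norm_num) (by decide) (by linear_combination hε)⟩
  · exact ⟨13, 9, by norm_num, ((hI.mul hX).mul (hT 1)).act_eq (k := -23)
        (by norm_num) (by decide) (by linear_combination hε)⟩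
  · exact ⟨-4, -3, by norm_num, ((hH.mul hC).mul (hT 1)).act_eq (k := 23)
        (by norm_num) (by decide) (by linear_combination hε)⟩
  · exact ⟨9, 7, by norm_num, ((hX.mul hC).mul (hT 1)).act_eq (k := -23)
        (by norm_num) (by decide) (by linear_combination hε)⟩
  · exact ⟨-6, -5, by norm_num, ((hD.mul hH).mul (hT 1)).act_eq (k := 23)
        (by norm_num) (by decide) (by linear_combination hε)⟩
  · exact ⟨-8, -7, by norm_num, ((hY.mul hH).mul (hT 1)).act_eq (k := 23)
        (by norm_num) (by decide) (by linear_combination hε)⟩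
  · exact ⟨11, 10, by norm_num, (((hI.mul (hT 1)).mul hH).mul (hT 1)).act_eq (k := 23)
        (by norm_num) (by decide) (by linear_combination hε)⟩
  · exact ⟨-1, -1, by norm_num, (((hH.mul (hT 1)).mul hH).mul (hT 1)).act_eq (k := 23)
        (by norm_num) (by decide) (by linear_combination hε)⟩

/-! ### Coefficients of an Euler product -/

/-- The coefficients of the power series `1 / (1 - A X + G X ^ 2)`. -/
def quadraticCoeff (A G : ℂ) : ℕ → ℂ
  | 0 => 1
  | 1 => A
  | e + 2 => A * quadraticCoeff A G (e + 1) - G * quadraticCoeff A G e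

lemma norm_quadraticCoeff_le (A G : ℂ) (e : ℕ) :
    ‖quadraticCoeff A G e‖ ≤ (1 + ‖A‖ + ‖G‖) ^ e := by
  have hB : 1 ≤ 1 + ‖A‖ + ‖G‖ := by linarith [norm_nonneg A, norm_nonneg G]
  induction e using Nat.twoStepInduction with
  | zero => simp [quadraticCoeff]
  | one => simp [quadraticCoeff]; linarith [norm_nonneg G]
  | more e h0 h1 =>
    rw [quadraticCoeff]
    set B := 1 + ‖A‖ + ‖G‖
    have hBe : B ^ e ≤ B ^ (e + 1) := pow_le_pow_right₀ hB (Nat.le_succ e)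
    calc _ ≤ ‖A‖ * B ^ (e + 1) + ‖G‖ * B ^ (e + 1) := by
          refine (norm_sub_le _ _).trans ?_
          rw [norm_mul, norm_mul]
          gcongr
          exact h0.trans hBe
      _ ≤ B * B ^ (e + 1) := by
          rw [← add_mul]
          gcongr
          simp only [B]
          linarith
      _ = B ^ (e + 2) := by ring

lemma tsum_quadraticCoeff {A G X : ℂ} (hX : (1 + ‖A‖ + ‖G‖) * ‖X‖ < 1) :
    ∑' e, quadraticCoeff A G e * X ^ e = (1 - A * X + G * X ^ 2)⁻¹ := by
  have hs : Summable fun e => quadraticCoeff A G e * X ^ e := by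
    refine Summable.of_norm_bounded (summable_geometric_of_lt_one (by positivity) hX) fun e => ?_
    rw [norm_mul, norm_pow, mul_pow]
    gcongr
    exact norm_quadraticCoeff_le A G e
  have hs1 := (summable_nat_add_iff 1).2 hs
  refine eq_inv_of_mul_eq_one_left ?_
  have h1 := hs.tsum_eq_zero_add
  have h2 := hs1.tsum_eq_zero_add
  have h3 : ∑' e, quadraticCoeff A G (e + 1 + 1) * X ^ (e + 1 + 1) =
      A * X * ∑' e, quadraticCoeff A G (e + 1) * X ^ (e + 1) -
        G * X ^ 2 * ∑' e, quadraticCoeff A G e * X ^ e := by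
    rw [← tsum_mul_left, ← tsum_mul_left, ← (hs1.mul_left _).tsum_sub (hs.mul_left _)]
    refine tsum_congr fun e => ?_
    rw [quadraticCoeff]
    ring
  rw [h3] at h2
  simp only [quadraticCoeff, pow_zero, zero_add, mul_one, pow_one] at h1 h2
  linear_combination (1 - A * X) * h1 + h2

/-- The multiplicative function with Euler factors `1 / (1 - A p X + G p X ^ 2)`, `X = p ^ (-s)`. -/
noncomputable def eulerCoeff (A G : ℕ → ℂ) (n : ℕ) : ℂ :=
  if n = 0 then 0 else n.factorization.prod fun p e => quadraticCoeff (A p) (G p) e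

section eulerCoeff

variable (A G : ℕ → ℂ)

lemma eulerCoeff_one : eulerCoeff A G 1 = 1 := by simp [eulerCoeff]

lemma eulerCoeff_mul {m n : ℕ} (h : m.Coprime n) :
    eulerCoeff A G (m * n) = eulerCoeff A G m * eulerCoeff A G n := by
  rcases eq_or_ne m 0 with rfl | hm
  · simp [eulerCoeff]
  rcases eq_or_ne n 0 with rfl | hn
  · simp [eulerCoeff]
  rw [eulerCoeff, eulerCoeff, eulerCoeff, if_neg hm, if_neg hn, if_neg (mul_ne_zero hm hn),
    Nat.factorization_mul_of_coprime h, Finsupp.prod_add_index_of_disjoint]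
  exact h.disjoint_primeFactors

lemma eulerCoeff_prime_pow {p : ℕ} (hp : p.Prime) (e : ℕ) :
    eulerCoeff A G (p ^ e) = quadraticCoeff (A p) (G p) e := by
  rw [eulerCoeff, if_neg (pow_ne_zero _ hp.ne_zero), hp.factorization_pow,
    Finsupp.prod_single_index rfl]

/-- The recursion defining `quadraticCoeff`, carried to all multiples of `p` by multiplicativity.
This is the form that produces the Hecke relations. -/
lemma eulerCoeff_prime_mul {p n : ℕ} (hp : p.Prime) (hn : n ≠ 0) :
    eulerCoeff A G (p * n) =
      A p * eulerCoeff A G n - if p ∣ n then G p * eulerCoeff A G (n / p) else 0 := by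
  obtain ⟨e, u, hu, rfl⟩ := Nat.exists_eq_pow_mul_and_not_dvd hn p hp.ne_one
  have hc (i : ℕ) : (p ^ i).Coprime u := ((hp.coprime_iff_not_dvd).2 hu).pow_left i
  rw [← mul_assoc, ← pow_succ', eulerCoeff_mul A G (hc _), eulerCoeff_mul A G (hc _),
    eulerCoeff_prime_pow A G hp, eulerCoeff_prime_pow A G hp]
  cases e with
  | zero => simp [hu, quadraticCoeff]
  | succ e =>
    have h1 : p ^ (e + 1) * u = p * (p ^ e * u) := by ring
    rw [h1, if_pos (dvd_mul_right _ _), Nat.mul_div_cancel_left _ hp.pos,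
      eulerCoeff_mul A G (hc _), eulerCoeff_prime_pow A G hp, quadraticCoeff]
    ring

lemma norm_eulerCoeff_le {K : ℕ} (hK : ∀ p : ℕ, p.Prime → 1 + ‖A p‖ + ‖G p‖ ≤ (p : ℝ) ^ K) (n : ℕ) :
    ‖eulerCoeff A G n‖ ≤ (n : ℝ) ^ K := by
  rcases eq_or_ne n 0 with rfl | hn
  · rw [eulerCoeff, if_pos rfl, norm_zero]; positivity
  rw [eulerCoeff, if_neg hn]
  nth_rw 2 [← Nat.prod_factorization_pow_eq_self hn]
  rw [Finsupp.prod, Finsupp.prod, norm_prod, Nat.cast_prod, ← Finset.prod_pow]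
  refine Finset.prod_le_prod (fun _ _ => norm_nonneg _) fun p hp => ?_
  have hp' := Nat.prime_of_mem_primeFactors hp
  refine (norm_quadraticCoeff_le _ _ _).trans ?_
  rw [Nat.cast_pow, ← pow_mul, mul_comm, pow_mul]
  gcongr
  exact hK p hp'

lemma hasProd_eulerCoeff {K : ℕ} (hK : ∀ p : ℕ, p.Prime → 1 + ‖A p‖ + ‖G p‖ ≤ (p : ℝ) ^ K) {s : ℂ}
    (hs : K + 1 < s.re) :
    LSeriesSummable (eulerCoeff A G) s ∧
    HasProd (fun p : Nat.Primes => (1 - A p * (p : ℂ) ^ (-s) + G p * ((p : ℂ) ^ (-s)) ^ 2)⁻¹)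
      (LSeries (eulerCoeff A G) s) := by
  have hsum : LSeriesSummable (eulerCoeff A G) s := by
    refine LSeriesSummable_of_le_const_mul_rpow (x := K + 1) hs ⟨1, fun n _ => ?_⟩
    rw [one_mul, add_sub_cancel_right, Real.rpow_natCast]
    exact norm_eulerCoeff_le A G hK n
  refine ⟨hsum, ?_⟩
  have hterm (n : ℕ) : LSeries.term (eulerCoeff A G) s n = eulerCoeff A G n * (n : ℂ) ^ (-s) := by
    rcases eq_or_ne n 0 with rfl | hn
    · simp [eulerCoeff]
    · rw [LSeries.term_of_ne_zero hn, Complex.cpow_neg, div_eq_mul_inv]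
  have h := EulerProduct.eulerProduct_hasProd (f := LSeries.term (eulerCoeff A G) s)
    (by simp [eulerCoeff_one]) (fun {m n} hmn => by
      rw [hterm, hterm, hterm, eulerCoeff_mul A G hmn, Nat.cast_mul,
        Complex.natCast_mul_natCast_cpow]
      ring) hsum.norm (by simp)
  rw [LSeries]
  convert h using 2 with p
  have hp : 1 < (p : ℝ) := mod_cast p.2.one_lt
  have hX : (1 + ‖A p‖ + ‖G p‖) * ‖(p : ℂ) ^ (-s)‖ < 1 := by
    rw [Complex.norm_natCast_cpow_of_pos p.2.pos, Complex.neg_re, Real.rpow_neg (by positivity),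
      ← div_eq_mul_inv, div_lt_one (by positivity)]
    refine (hK p p.2).trans_lt ?_
    rw [← Real.rpow_natCast]
    exact Real.rpow_lt_rpow_of_exponent_lt hp (by linarith)
  rw [← tsum_quadraticCoeff hX]
  refine tsum_congr fun e => ?_
  rw [hterm, eulerCoeff_prime_pow A G p.2, Nat.cast_pow, ← Complex.natCast_cpow_natCast_mul,
    mul_comm (e : ℂ), Complex.cpow_mul_nat]

-- The two cases are the Euler factors `1 / ((1 - X)(1 - G X))` and `1 / (1 - A X)`, both with
-- non-negative expansions.
open scoped ComplexOrder in
lemma eulerCoeff_nonneg (hA : ∀ p : ℕ, p.Prime → A p = 1 + G p ∨ G p = 0 ∧ 0 ≤ A p)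
    (hG : ∀ p : ℕ, p.Prime → 0 ≤ G p) (n : ℕ) : 0 ≤ eulerCoeff A G n := by
  rw [eulerCoeff]
  split_ifs
  · exact le_rfl
  refine Finset.prod_nonneg fun p hp => ?_
  have hp' := Nat.prime_of_mem_primeFactors hp
  generalize n.factorization p = e
  rcases hA p hp' with h | ⟨h, hA0⟩
  · have key (e : ℕ) : 0 ≤ quadraticCoeff (A p) (G p) e ∧
        quadraticCoeff (A p) (G p) (e + 1) = 1 + G p * quadraticCoeff (A p) (G p) e := by
      induction e with
      | zero => simp [quadraticCoeff, h]
      | succ e ih =>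
        refine ⟨ih.2 ▸ add_nonneg zero_le_one (mul_nonneg (hG p hp') ih.1), ?_⟩
        rw [quadraticCoeff]
        linear_combination ih.2 + quadraticCoeff (A p) (G p) (e + 1) * h
    exact (key e).1
  · induction e using Nat.twoStepInduction with
    | zero => simp [quadraticCoeff]
    | one => simpa [quadraticCoeff] using hA0
    | more e _ h1 => simpa [quadraticCoeff, h] using mul_nonneg hA0 h1

end eulerCoeff

/-- The coefficient of `-p ^ (-s)` in the inverse Euler factor at `p`. -/
noncomputable def eulerLinear (a : ℕ → ℂ) (N : ℕ) (k : ℤ) (p : ℕ) : ℂ :=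
  if p ^ 2 ∣ N then 0 else if p ∣ N then (p : ℂ) ^ ((k : ℂ) / 2 - 1) else a p

/-- The coefficient of `p ^ (-2 s)` in the inverse Euler factor at `p`. -/
noncomputable def eulerQuadratic (N : ℕ) (k : ℤ) (p : ℕ) : ℂ :=
  if p ∣ N then 0 else (p : ℂ) ^ (k - 1)

lemma eulerFactor_eq (a : ℕ → ℂ) (N : ℕ) (k : ℤ) {p : ℕ} (hp : p.Prime) (s : ℂ) :
    eulerFactor a N k p s = (1 - eulerLinear a N k p * (p : ℂ) ^ (-s) +
      eulerQuadratic N k p * ((p : ℂ) ^ (-s)) ^ 2)⁻¹ := by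
  have hp0 : (p : ℂ) ≠ 0 := mod_cast hp.ne_zero
  rw [eulerFactor, eulerLinear, eulerQuadratic]
  by_cases h2 : p ^ 2 ∣ N
  · have h1 : p ∣ N := (dvd_pow_self p two_ne_zero).trans h2
    simp [h2, h1]
  by_cases h1 : p ∣ N
  · simp only [h2, h1, if_true, if_false, zero_mul, add_zero]
    rw [sub_eq_add_neg ((k : ℂ) / 2 - 1), Complex.cpow_add _ _ hp0]
  · simp only [h2, h1, if_false]
    rw [show (k : ℂ) - 1 - 2 * s = ((k - 1 : ℤ) : ℂ) + (-s) * (2 : ℕ) by push_cast; ring,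
      Complex.cpow_add _ _ hp0, Complex.cpow_mul_nat, Complex.cpow_intCast]

lemma IsEBV.exists_norm_le {a : ℕ → ℂ} {F Λ : ℂ → ℂ} (h : IsEBV a F Λ) :
    ∃ (C : ℝ) (K : ℕ), 0 ≤ C ∧ ∀ n ≠ 0, ‖a n‖ ≤ C * (n : ℝ) ^ K := by
  obtain ⟨σ, hσ⟩ := h.hasSum
  obtain ⟨K, hK⟩ := exists_nat_gt σ
  obtain ⟨C, hC⟩ := (hσ (K : ℂ) (by simpa using hK)).LSeriesSummable.le_const_mul_rpow
  refine ⟨C, K, (norm_nonneg _).trans (by simpa using hC 1 one_ne_zero), fun n hn => ?_⟩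
  simpa using hC n hn

lemma exists_pow_bound {a : ℕ → ℂ} {N : ℕ} {k : ℤ} {C : ℝ} {K : ℕ} (hC : 0 ≤ C)
    (ha : ∀ n ≠ 0, ‖a n‖ ≤ C * (n : ℝ) ^ K) :
    ∃ K' : ℕ, ∀ p : ℕ, p.Prime →
      1 + ‖eulerLinear a N k p‖ + ‖eulerQuadratic N k p‖ ≤ (p : ℝ) ^ K' := by
  -- With `M = p^(K + |k|)` the three terms are at most `M`, `(1 + C) M` and `M`; the constant `3 +
  -- C` is absorbed by `p^t ≥ 2^t`.
  obtain ⟨t, ht⟩ := pow_unbounded_of_one_lt (3 + C) (one_lt_two (α := ℝ))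
  refine ⟨t + (K + k.natAbs), fun p hp => ?_⟩
  have hp1 : 1 ≤ (p : ℝ) := mod_cast hp.one_lt.le
  have hk := Int.le_natAbs (a := k)
  have hk' : (k : ℝ) ≤ (k.natAbs : ℝ) := by
    rw [← Int.cast_natCast]
    exact_mod_cast (Int.le_natAbs (a := k))
  have hk0 : (0 : ℝ) ≤ (k.natAbs : ℝ) := Nat.cast_nonneg _
  set M := (p : ℝ) ^ (K + k.natAbs)
  have hM1 : 1 ≤ M := one_le_pow₀ hp1
  have h1 : ‖eulerLinear a N k p‖ ≤ (1 + C) * M := by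
    rw [eulerLinear]
    split_ifs
    · rw [norm_zero]; positivity
    · rw [Complex.norm_natCast_cpow_of_pos hp.pos]
      have : (p : ℝ) ^ ((k : ℂ) / 2 - 1).re ≤ M := by
        rw [show M = _ from (Real.rpow_natCast _ _).symm]
        refine Real.rpow_le_rpow_of_exponent_le hp1 ?_
        have : ((k : ℂ) / 2 - 1).re = (k : ℝ) / 2 - 1 := by simp
        rw [this]
        push_cast
        linarith [(Nat.cast_nonneg K : (0 : ℝ) ≤ K)]
      nlinarith
    · refine (ha p hp.ne_zero).trans ?_
      have : (p : ℝ) ^ K ≤ M := pow_le_pow_right₀ hp1 (by omega)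
      nlinarith
  have h2 : ‖eulerQuadratic N k p‖ ≤ M := by
    rw [eulerQuadratic]
    split_ifs
    · rw [norm_zero]; positivity
    · rw [norm_zpow, Complex.norm_natCast, show M = _ from (zpow_natCast _ _).symm]
      exact zpow_le_zpow_right₀ hp1 (by omega)
  have h3 : 3 + C ≤ (p : ℝ) ^ t :=
    ht.le.trans (pow_le_pow_left₀ zero_le_two (mod_cast hp.two_le) t)
  calc _ ≤ (3 + C) * M := by linarith
    _ ≤ _ := by rw [pow_add]; gcongr

/-- The coefficients of a Dirichlet series with an Euler product are determined by it. -/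
theorem IsEBV.eq_eulerCoeff {a : ℕ → ℂ} {F Λ : ℂ → ℂ} {N : ℕ} {k : ℤ} (h : IsEBV a F Λ)
    (hEP : HasEulerProduct a F N k) {n : ℕ} (hn : n ≠ 0) :
    a n = eulerCoeff (eulerLinear a N k) (eulerQuadratic N k) n := by
  obtain ⟨C, K, hC, ha⟩ := h.exists_norm_le
  obtain ⟨K', hK'⟩ := exists_pow_bound (N := N) (k := k) hC ha
  obtain ⟨σ, hσ⟩ := h.hasSum
  obtain ⟨σ', hσ'⟩ := hEP
  refine LSeries.eq_of_LSeries_eventually_eq ?_ ?_ ?_ hn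
  · exact ((hσ (σ + 1 : ℝ) (by simp)).LSeriesSummable.abscissaOfAbsConv_le).trans_lt
      (EReal.coe_lt_top _)
  · exact ((hasProd_eulerCoeff _ _ hK' (s := (K' + 2 : ℝ)) (by simp)).1.abscissaOfAbsConv_le).trans_lt
      (EReal.coe_lt_top _)
  · filter_upwards [Filter.eventually_gt_atTop σ, Filter.eventually_gt_atTop σ',
      Filter.eventually_gt_atTop (K' + 1 : ℝ)] with x h1 h2 h3
    rw [(hσ x (by simpa using h1)).LSeries_eq]
    refine (hσ' x (by simpa using h2)).unique ?_
    convert (hasProd_eulerCoeff _ _ hK' (s := x) (by simpa using h3)).2 using 2 with p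
    exact eulerFactor_eq a N k p.2 x

/-! ### The `q`-series and its Hecke relations -/

/-- The function on the upper half-plane with Fourier coefficients `a`. -/
noncomputable def qSeries (a : ℕ → ℂ) (z : ℍ) : ℂ :=
  ∑' n : ℕ, a n * cexp (2 * Real.pi * Complex.I * n * z)

lemma norm_exp_two_pi_mul (n : ℕ) (z : ℂ) :
    ‖cexp (2 * Real.pi * Complex.I * n * z)‖ = Real.exp (-(2 * Real.pi * z.im)) ^ n := by
  rw [Complex.norm_exp, ← Real.exp_nat_mul]
  congr 1
  simp
  ring

lemma hasSum_choose_mul_exp {K : ℕ} {y : ℝ} (hy : 0 < y) :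
    HasSum (fun n : ℕ => ((n + K).choose K : ℝ) * Real.exp (-y) ^ n) (1 / (1 - Real.exp (-y)) ^ (K + 1)) := by
  refine hasSum_choose_mul_geometric_of_norm_lt_one K ?_
  rw [Real.norm_of_nonneg (Real.exp_nonneg _)]
  simpa using hy

lemma HasSum.congr_arg_fun {f g : ℕ → ℂ} {x : ℂ} (hf : HasSum f x) (h : ∀ n, g n = f n) : HasSum g x :=
  (funext h : g = f) ▸ hf

section qSeries

variable {a : ℕ → ℂ} {C : ℝ} {K : ℕ}

lemma norm_qSeries_term_le (hC : 0 ≤ C) (ha : ∀ n, ‖a n‖ ≤ C * (n : ℝ) ^ K) {y : ℝ} {z : ℂ} (hz : y ≤ z.im) (n : ℕ) :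
    ‖a n * cexp (2 * Real.pi * Complex.I * n * z)‖ ≤
      C * K.factorial * (((n + K).choose K : ℝ) * Real.exp (-(2 * Real.pi * y)) ^ n) := by
  have h1 : (n : ℝ) ^ K ≤ K.factorial * ((n + K).choose K : ℝ) := by
    have := (Nat.pow_le_pow_left n.le_succ K).trans (Nat.pow_succ_le_ascFactorial (n + 1) K)
    rw [Nat.ascFactorial_eq_factorial_mul_choose] at this
    exact_mod_cast this
  rw [norm_mul, norm_exp_two_pi_mul]
  calc _ ≤ C * (K.factorial * ((n + K).choose K : ℝ)) * Real.exp (-(2 * Real.pi * y)) ^ n := by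
        gcongr
        exact (ha n).trans (by gcongr)
    _ = _ := by ring

lemma hasSum_qSeries (hC : 0 ≤ C) (ha : ∀ n, ‖a n‖ ≤ C * (n : ℝ) ^ K) (z : ℍ) :
    HasSum (fun n : ℕ => a n * cexp (2 * Real.pi * Complex.I * n * z)) (qSeries a z) :=
  (Summable.of_norm_bounded (((hasSum_choose_mul_exp (K := K)
    (by have := z.im_pos; positivity : 0 < 2 * Real.pi * z.im)).summable).mul_left (C * K.factorial))
    (norm_qSeries_term_le hC ha le_rfl)).hasSum

open scoped Manifold in
lemma mdifferentiable_qSeries (hC : 0 ≤ C) (ha : ∀ n, ‖a n‖ ≤ C * (n : ℝ) ^ K) :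
    MDiff (qSeries a) := by
  rw [UpperHalfPlane.mdifferentiable_iff]
  have key : DifferentiableOn ℂ (fun z : ℂ => ∑' n : ℕ, a n * cexp (2 * Real.pi * Complex.I * n * z))
      {z | 0 < z.im} := by
    intro z hz
    have hz2 : 0 < z.im / 2 := half_pos hz
    have hopen : IsOpen {w : ℂ | z.im / 2 < w.im} := isOpen_lt continuous_const Complex.continuous_im
    have h := differentiableOn_tsum_of_summable_norm
      (F := fun (n : ℕ) (z : ℂ) => a n * cexp (2 * Real.pi * Complex.I * n * z))
      (((hasSum_choose_mul_exp (K := K) (by positivity : 0 < 2 * Real.pi * (z.im / 2))).summable).mul_left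
        (C * K.factorial)) (fun n => by fun_prop) hopen
      (fun n w hw => norm_qSeries_term_le hC ha (le_of_lt hw) n)
    exact (h.differentiableAt (hopen.mem_nhds (show z.im / 2 < z.im from half_lt_self hz))).differentiableWithinAt
  refine key.congr fun z hz => ?_
  simp only [Function.comp_apply, qSeries, ofComplex_apply_of_im_pos hz]

/-- The coefficients are dominated by binomial coefficients, whose series sums to `(1 -
e^(-2πy))^(-(K+1))`; and `1 - e^(-2πy) ≥ y / (1 + y)`. -/
lemma norm_qSeries_le (hC : 0 ≤ C) (ha : ∀ n, ‖a n‖ ≤ C * (n : ℝ) ^ K) (z : ℍ) :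
    ‖qSeries a z‖ ≤ C * K.factorial * (1 + 1 / z.im) ^ (K + 1) := by
  have hz := z.im_pos
  have hy : 0 < 2 * Real.pi * z.im := by positivity
  refine (tsum_of_norm_bounded ((hasSum_choose_mul_exp (K := K) hy).mul_left (C * K.factorial))
    (norm_qSeries_term_le hC ha le_rfl)).trans ?_
  have h1 : Real.exp (-(2 * Real.pi * z.im)) < 1 := by simpa using hy
  have h2 : 1 / (1 - Real.exp (-(2 * Real.pi * z.im))) ≤ 1 + 1 / z.im := by
    have h3 := Real.add_one_le_exp (2 * Real.pi * z.im)
    have h4 := Real.two_le_pi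
    have h5 : 1 + z.im ≤ Real.exp (2 * Real.pi * z.im) := by nlinarith
    have h6 : Real.exp (-(2 * Real.pi * z.im)) ≤ 1 / (1 + z.im) := by
      rw [Real.exp_neg, one_div]
      exact inv_anti₀ (by positivity) h5
    rw [div_le_iff₀ (by linarith)]
    have h7 : 1 / (1 + z.im) = 1 - z.im / (1 + z.im) := by field_simp; ring
    have h8 : (1 + 1 / z.im) * (z.im / (1 + z.im)) = 1 := by field_simp; ring
    have h9 : 0 < 1 + 1 / z.im := by positivity
    nlinarith
  rw [← _root_.one_div_pow]
  gcongr

lemma qSeries_of_coe_eq_add_one {z w : ℍ} (h : (w : ℂ) = z + 1) : qSeries a w = qSeries a z := by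
  refine tsum_congr fun n => ?_
  rw [h, show 2 * Real.pi * Complex.I * n * ((z : ℂ) + 1) =
    2 * Real.pi * Complex.I * n * z + n * (2 * Real.pi * Complex.I) by ring, Complex.exp_add,
    Complex.exp_nat_mul_two_pi_mul_I, mul_one]

lemma act_qSeries_translation (m : ℤ) : act m !![1, 1; 0, 1] (qSeries a) = qSeries a := by
  ext z
  rw [act_apply_of_eq m (by simp) (w := (1 : ℝ) +ᵥ z) _ (by simp [add_comm]),
    qSeries_of_coe_eq_add_one (z := z) (by simp [add_comm])]
  simp

lemma sum_range_exp_div {p : ℕ} (hp : p.Prime) (n : ℕ) :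
    ∑ j ∈ Finset.range p, cexp (2 * Real.pi * Complex.I * n * (j / p)) = if p ∣ n then (p : ℂ) else 0 := by
  have hp0 : (p : ℂ) ≠ 0 := mod_cast hp.ne_zero
  have hpow (j : ℕ) : cexp (2 * Real.pi * Complex.I * n * (j / p)) =
      cexp (2 * Real.pi * Complex.I * (n / p)) ^ j := by
    rw [← Complex.exp_nat_mul]
    congr 1
    ring
  simp only [hpow]
  split_ifs with h
  · obtain ⟨r, rfl⟩ := h
    have : cexp (2 * Real.pi * Complex.I * ((p * r : ℕ) / p)) = 1 := by
      rw [Nat.cast_mul, mul_div_cancel_left₀ _ hp0, mul_comm, Complex.exp_nat_mul_two_pi_mul_I]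
    simp only [this, one_pow, Finset.sum_const, Finset.card_range, nsmul_eq_mul, mul_one]
  · have h1 : cexp (2 * Real.pi * Complex.I * (n / p)) ≠ 1 := by
      intro he
      obtain ⟨r, hr⟩ := Complex.exp_eq_one_iff.1 he
      apply h
      have h2 : (n : ℂ) / p = r := by
        have := Complex.two_pi_I_ne_zero
        apply mul_left_cancel₀ this
        linear_combination hr
      rw [div_eq_iff hp0] at h2
      have h3 : (n : ℤ) = r * p := by exact_mod_cast h2
      exact Int.natCast_dvd_natCast.1 ⟨r, by rw [h3, mul_comm]⟩
    have h2 : cexp (2 * Real.pi * Complex.I * (n / p)) ^ p = 1 := by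
      rw [← Complex.exp_nat_mul, show (p : ℂ) * (2 * Real.pi * Complex.I * (n / p)) =
        n * (2 * Real.pi * Complex.I) by field_simp, Complex.exp_nat_mul_two_pi_mul_I]
    rw [geom_sum_eq h1, h2]
    simp

/-- The Hecke operator at `p` on a `q`-series whose coefficients satisfy a linear recursion. -/
theorem sum_act_hecke_qSeries (hC : 0 ≤ C) (ha : ∀ n, ‖a n‖ ≤ C * (n : ℝ) ^ K) (m : ℤ) {p : ℕ} (hp : p.Prime)
    {A G : ℂ} (hrec : ∀ n, a (p * n) = A * a n - if p ∣ n then G * a (n / p) else 0) :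
    ∑ j ∈ Finset.range p, act m !![1, (j : ℤ); 0, (p : ℤ)] (qSeries a) +
      ((p : ℂ) ^ (1 - 2 * m) * G) • act m !![(p : ℤ), 0; 0, 1] (qSeries a) =
      ((p : ℂ) ^ (1 - m) * A) • qSeries a := by
  have hp0 : (p : ℂ) ≠ 0 := mod_cast hp.ne_zero
  have hpR : 0 < (p : ℝ) := mod_cast hp.pos
  have hpi : Function.Injective fun n : ℕ => p * n := fun _ _ h => Nat.eq_of_mul_eq_mul_left hp.pos h
  ext z
  have hz := z.im_pos
  obtain ⟨w, hw⟩ : ∃ w : ℕ → ℍ, ∀ j, (w j : ℂ) = (z + j) / p :=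
    ⟨fun j => ⟨(z + j) / p, by
      rw [← ofReal_natCast p, Complex.div_ofReal_im]; simp; positivity⟩, fun j => rfl⟩
  obtain ⟨v, hv⟩ : ∃ v : ℍ, (v : ℂ) = p * z := ⟨⟨p * z, by simp; positivity⟩, rfl⟩
  have e1 (j : ℕ) : act m !![1, (j : ℤ); 0, (p : ℤ)] (qSeries a) z =
      (p : ℂ) ^ (-m) * qSeries a (w j) := by
    rw [act_apply_of_eq m (by simp [hp.pos]) (w := w j) _ (by simp [hw, hp0])]
    congr 1
    simp only [det_fin_two_of, mul_zero, sub_zero, one_mul, Int.cast_natCast, of_apply, cons_val',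
      cons_val_zero, cons_val_one, Int.cast_zero, zero_mul, zero_add, cons_val_fin_one]
    rw [← zpow_add₀ hp0]
    congr 1
    ring
  have e2 : act m !![(p : ℤ), 0; 0, 1] (qSeries a) z = (p : ℂ) ^ m * qSeries a v := by
    rw [act_apply_of_eq m (by simp [hp.pos]) (w := v) _ (by simp [hv])]
    simp
  have hs := hasSum_qSeries hC ha
  -- the sum of the translates picks out the coefficients at multiples of `p`
  have h1 : HasSum (fun n : ℕ => a (p * n) * (p * cexp (2 * Real.pi * Complex.I * n * z)))
      (∑ j ∈ Finset.range p, qSeries a (w j)) := by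
    have := hasSum_sum (s := Finset.range p) fun j _ => hs (w j)
    have hcoef (n : ℕ) : ∑ j ∈ Finset.range p, a n * cexp (2 * Real.pi * Complex.I * n * w j) =
        a n * cexp (2 * Real.pi * Complex.I * n * (z / p)) * if p ∣ n then (p : ℂ) else 0 := by
      rw [← sum_range_exp_div hp, Finset.mul_sum]
      refine Finset.sum_congr rfl fun j _ => ?_
      rw [hw, add_div, mul_add (2 * Real.pi * Complex.I * n), Complex.exp_add]
      ring
    simp only [hcoef] at this
    rw [← hpi.hasSum_iff] at this
    · convert this using 2 with n
      simp only [Function.comp_apply, dvd_mul_right, if_true, Nat.cast_mul]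
      rw [show 2 * Real.pi * Complex.I * ((p : ℂ) * n) * (z / p) = 2 * Real.pi * Complex.I * n * z by
        field_simp]
      ring
    · intro n hn
      rw [if_neg, mul_zero]
      rintro ⟨r, rfl⟩
      exact hn ⟨r, rfl⟩
  have h2 : HasSum (fun n : ℕ => (if p ∣ n then G * a (n / p) else 0) *
      cexp (2 * Real.pi * Complex.I * n * z)) (G * qSeries a v) := by
    rw [← hpi.hasSum_iff]
    · refine ((hs v).mul_left G).congr_arg_fun fun n => ?_
      simp only [Function.comp_apply, dvd_mul_right, if_true, Nat.cast_mul,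
        Nat.mul_div_cancel_left _ hp.pos, hv]
      rw [mul_assoc, show 2 * Real.pi * Complex.I * ((p : ℂ) * n) * z =
        2 * Real.pi * Complex.I * n * (p * z) by ring]
    · intro n hn
      rw [if_neg, zero_mul]
      rintro ⟨r, rfl⟩
      exact hn ⟨r, rfl⟩
  have h3 : ∑ j ∈ Finset.range p, qSeries a (w j) = p * (A * qSeries a z - G * qSeries a v) := by
    refine h1.unique ?_
    refine (((((hs z).mul_left A).sub h2).mul_left (p : ℂ)).congr_arg_fun <| fun n => ?_)
    rw [hrec]
    ring
  simp only [Pi.add_apply, Finset.sum_apply, Pi.smul_apply, smul_eq_mul, e1, e2]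
  rw [← Finset.mul_sum, h3]
  have hz1 : (p : ℂ) ^ (1 - m) = p * (p : ℂ) ^ (-m) := by
    rw [sub_eq_add_neg, zpow_add₀ hp0, zpow_one]
  have hz2 : (p : ℂ) ^ (1 - 2 * m) * (p : ℂ) ^ m = p * (p : ℂ) ^ (-m) := by
    rw [← zpow_add₀ hp0, ← hz1]; congr 1; ring
  rw [hz1]
  linear_combination G * qSeries a v * hz2

end qSeries

/-! ### Mellin transforms and Liouville's theorem -/

section Mellin

open MeasureTheory Asymptotics Filter Set
open scoped Topology

/-- The bound does not involve `s`. It therefore serves a whole half-plane: to the left of `σ` for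
functions living on `(1, ∞)`, to the right for functions living on `(0, 1]`. -/
lemma norm_mellin_le_of_rpow_le {w : ℝ → ℂ} {σ : ℝ} {s : ℂ} (hw : MellinConvergent w σ)
    (h : ∀ t, 0 < t → w t ≠ 0 → t ^ s.re ≤ t ^ σ) :
    ‖mellin w s‖ ≤ ∫ t in Ioi (0 : ℝ), ‖(t : ℂ) ^ ((σ : ℂ) - 1) • w t‖ := by
  refine norm_integral_le_of_norm_le hw.norm ?_
  refine (ae_restrict_iff' measurableSet_Ioi).2 (ae_of_all _ fun t ht => ?_)
  have ht : 0 < t := ht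
  rw [norm_smul, norm_smul, Complex.norm_cpow_eq_rpow_re_of_pos ht,
    Complex.norm_cpow_eq_rpow_re_of_pos ht]
  by_cases hwt : w t = 0
  · simp [hwt]
  gcongr ?_ * _
  simp only [sub_re, one_re, ofReal_re, Real.rpow_sub ht]
  exact div_le_div_of_nonneg_right (h t ht hwt) (by positivity)

lemma locallyIntegrableOn_indicator {g : ℝ → ℂ} {U S : Set ℝ} (hg : LocallyIntegrableOn g U)
    (hS : MeasurableSet S) : LocallyIntegrableOn (S.indicator g) U := fun x hx => by
  obtain ⟨t, ht, h⟩ := hg x hx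
  exact ⟨t, ht, h.indicator hS⟩

lemma isBigO_indicator_of_compl_mem {g : ℝ → ℂ} {v : ℝ → ℝ} {S : Set ℝ} {l : Filter ℝ} (h : Sᶜ ∈ l) :
    S.indicator g =O[l] v :=
  (EventuallyEq.trans_isBigO (by
    filter_upwards [h] with x hx using indicator_of_notMem hx g) (isBigO_zero v l))

lemma isBigO_indicator {g : ℝ → ℂ} {v : ℝ → ℝ} (S : Set ℝ) {l : Filter ℝ} (h : g =O[l] v) :
    S.indicator g =O[l] v :=
  (isBigO_of_le _ fun x => norm_indicator_le_norm_self g x).trans h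

/-- If the Mellin transforms of `g` and `h`, defined in disjoint half-planes, continue to the same
entire function, bounded in vertical strips, then `g` and `h` agree. -/
theorem eq_of_mellin_eq {g h : ℝ → ℂ} (hg : ContinuousOn g (Ioi 0)) (hh : ContinuousOn h (Ioi 0))
    {a b : ℝ} (hg_top : ∀ r : ℝ, g =O[atTop] (· ^ (-r))) (hg_bot : g =O[𝓝[>] 0] (· ^ (-b)))
    (hh_top : h =O[atTop] (· ^ (-a))) (hh_bot : ∀ r : ℝ, h =O[𝓝[>] 0] (· ^ (-r))) {M : ℂ → ℂ}
    (hM : Differentiable ℂ M) (hMb : ∀ α β : ℝ, ∃ C : ℝ, ∀ s : ℂ, α ≤ s.re → s.re ≤ β → ‖M s‖ ≤ C)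
    {c d : ℝ} (hgM : ∀ s : ℂ, c < s.re → mellin g s = M s)
    (hhM : ∀ s : ℂ, s.re < d → mellin h s = M s) {x : ℝ} (hx : 1 < x) : g x = h x := by
  have hgl := hg.locallyIntegrableOn measurableSet_Ioi (μ := volume)
  have hhl := hh.locallyIntegrableOn measurableSet_Ioi (μ := volume)
  have hI : MeasurableSet (Ioi (1 : ℝ)) := measurableSet_Ioi
  have hI' : MeasurableSet (Iic (1 : ℝ)) := measurableSet_Iic
  have m1 : (Iic (1 : ℝ))ᶜ ∈ (atTop : Filter ℝ) := by rw [compl_Iic]; exact Ioi_mem_atTop 1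
  have m0 : (Ioi (1 : ℝ))ᶜ ∈ 𝓝[>] (0 : ℝ) := by
    rw [compl_Ioi]; exact mem_nhdsWithin_of_mem_nhds (Iic_mem_nhds one_pos)
  set R := |a| + |b| + |c| + |d| + 1 with hR
  have ha := abs_le.1 (le_refl |a|)
  have hb := abs_le.1 (le_refl |b|)
  have hc := abs_le.1 (le_refl |c|)
  have hd := abs_le.1 (le_refl |d|)
  have := abs_nonneg a
  have := abs_nonneg b
  have := abs_nonneg c
  have := abs_nonneg d
  -- convergence of the four partial transforms
  have cg1 (s : ℂ) : MellinConvergent ((Ioi 1).indicator g) s :=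
    mellinConvergent_of_isBigO_rpow (locallyIntegrableOn_indicator hgl hI)
      (isBigO_indicator _ (hg_top (s.re + 1))) (lt_add_one _)
      (isBigO_indicator_of_compl_mem m0 (v := (· ^ (-(s.re - 1))))) (sub_one_lt _)
  have ch0 (s : ℂ) : MellinConvergent ((Iic 1).indicator h) s :=
    mellinConvergent_of_isBigO_rpow (locallyIntegrableOn_indicator hhl hI')
      (isBigO_indicator_of_compl_mem m1 (v := (· ^ (-(s.re + 1))))) (lt_add_one _)
      (isBigO_indicator _ (hh_bot (s.re - 1))) (sub_one_lt _)
  have cg0 (s : ℂ) (hs : b < s.re) : MellinConvergent ((Iic 1).indicator g) s :=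
    mellinConvergent_of_isBigO_rpow (locallyIntegrableOn_indicator hgl hI')
      (isBigO_indicator_of_compl_mem m1 (v := (· ^ (-(s.re + 1))))) (lt_add_one _)
      (isBigO_indicator _ hg_bot) hs
  have ch1 (s : ℂ) (hs : s.re < a) : MellinConvergent ((Ioi 1).indicator h) s :=
    mellinConvergent_of_isBigO_rpow (locallyIntegrableOn_indicator hhl hI)
      (isBigO_indicator _ hh_top) hs
      (isBigO_indicator_of_compl_mem m0 (v := (· ^ (-(s.re - 1))))) (sub_one_lt _)
  have split (u : ℝ → ℂ) : (fun t => (Ioi 1).indicator u t + (Iic 1).indicator u t) = u := by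
    rw [← compl_Ioi]; exact indicator_self_add_compl _ u
  -- Far to the right `M` is the full transform of `g`, far to the left that of `h`. So on either
  -- side `E` is a difference of two partial transforms and bounded; in between `M` is bounded by
  -- hypothesis. Being entire, `E` is constant.
  set E : ℂ → ℂ := fun s => mellin ((Ioi 1).indicator g) s + mellin ((Iic 1).indicator h) s - M s
    with hE
  have hEd : Differentiable ℂ E := by
    intro s
    refine (DifferentiableAt.add ?_ ?_).sub (hM s)
    · exact mellin_differentiableAt_of_isBigO_rpow (locallyIntegrableOn_indicator hgl hI)
        (isBigO_indicator _ (hg_top (s.re + 1))) (lt_add_one _)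
        (isBigO_indicator_of_compl_mem m0 (v := (· ^ (-(s.re - 1))))) (sub_one_lt _)
    · exact mellin_differentiableAt_of_isBigO_rpow (locallyIntegrableOn_indicator hhl hI')
        (isBigO_indicator_of_compl_mem m1 (v := (· ^ (-(s.re + 1))))) (lt_add_one _)
        (isBigO_indicator _ (hh_bot (s.re - 1))) (sub_one_lt _)
  have hEr (s : ℂ) (hs : R ≤ s.re) :
      E s = mellin ((Iic 1).indicator h) s - mellin ((Iic 1).indicator g) s := by
    have h1 := (hasMellin_add (cg1 s) (cg0 s (by linarith))).2
    rw [split, hgM s (by linarith)] at h1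
    simp only [hE, h1]
    ring
  have hEl (s : ℂ) (hs : s.re ≤ -R) :
      E s = mellin ((Ioi 1).indicator g) s - mellin ((Ioi 1).indicator h) s := by
    have h1 := (hasMellin_add (ch1 s (by linarith)) (ch0 s)).2
    rw [split, hhM s (by linarith)] at h1
    simp only [hE, h1]
    ring
  have bd1 {u : ℝ → ℂ} {σ : ℝ} (hu : MellinConvergent ((Ioi 1).indicator u) σ) (s : ℂ) (hs : s.re ≤ σ) :=
    norm_mellin_le_of_rpow_le hu (s := s) fun t ht htu =>
      Real.rpow_le_rpow_of_exponent_le (le_of_lt (mem_of_indicator_ne_zero htu)) hs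
  have bd0 {u : ℝ → ℂ} {σ : ℝ} (hu : MellinConvergent ((Iic 1).indicator u) σ) (s : ℂ) (hs : σ ≤ s.re) :=
    norm_mellin_le_of_rpow_le hu (s := s) fun t ht htu =>
      Real.rpow_le_rpow_of_exponent_ge ht (show t ∈ Iic (1 : ℝ) from mem_of_indicator_ne_zero htu) hs
  have hEb : Bornology.IsBounded (range E) := by
    obtain ⟨C, hC⟩ := hMb (-R) R
    obtain ⟨C₁, hC₁⟩ : ∃ C₁, ∀ s : ℂ, R ≤ s.re → ‖E s‖ ≤ C₁ := ⟨_, fun s hs => by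
      rw [hEr s hs]
      exact norm_sub_le_of_le (bd0 (ch0 R) s hs)
        (bd0 (cg0 R (by rw [ofReal_re]; linarith)) s hs)⟩
    obtain ⟨C₂, hC₂⟩ : ∃ C₂, ∀ s : ℂ, s.re ≤ -R → ‖E s‖ ≤ C₂ := ⟨_, fun s hs => by
      rw [hEl s hs]
      exact norm_sub_le_of_le (bd1 (cg1 (-R : ℝ)) s hs)
        (bd1 (ch1 (-R : ℝ) (by rw [ofReal_re]; linarith)) s hs)⟩
    obtain ⟨C₃, hC₃⟩ : ∃ C₃, ∀ s : ℂ, -R ≤ s.re → s.re ≤ R → ‖E s‖ ≤ C₃ := ⟨_, fun s hs hs' =>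
      norm_sub_le_of_le (norm_add_le_of_le (bd1 (cg1 R) s hs') (bd0 (ch0 (-R : ℝ)) s hs)) (hC s hs hs')⟩
    refine isBounded_iff_forall_norm_le.2 ⟨max (max C₁ C₂) C₃, ?_⟩
    rintro _ ⟨s, rfl⟩
    rcases le_total R s.re with hs | hs
    · exact (hC₁ s hs).trans ((le_max_left _ _).trans (le_max_left _ _))
    rcases le_total s.re (-R) with hs' | hs'
    · exact (hC₂ s hs').trans ((le_max_right _ _).trans (le_max_left _ _))
    · exact (hC₃ s hs' hs).trans (le_max_right _ _)
  obtain ⟨e, he⟩ := hEd.exists_const_forall_eq_of_bounded hEb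
  -- Far to the left the transform of `w` is a constant, which is not integrable on vertical lines
  -- unless it is 0. Differentiation in `s` removes it and multiplies `w` by `log t`, which is
  -- nonzero for `t > 1`; then inversion applies.
  set w : ℝ → ℂ := (Ioi 1).indicator (fun t => g t - h t) with hw
  have hw' : w = fun t => (Ioi 1).indicator g t - (Ioi 1).indicator h t := indicator_sub _ _ _
  have hwl : LocallyIntegrableOn w (Ioi 0) := by
    rw [hw']
    exact (locallyIntegrableOn_indicator hgl hI).sub (locallyIntegrableOn_indicator hhl hI)
  have hw_top : w =O[atTop] (· ^ (-a)) := by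
    rw [hw']
    exact (isBigO_indicator _ (hg_top a)).sub (isBigO_indicator _ hh_top)
  have key (s : ℂ) (hs : s.re < -R) :
      MellinConvergent (fun t => Real.log t • w t) s ∧ mellin (fun t => Real.log t • w t) s = 0 := by
    obtain ⟨h1, h2⟩ := mellin_hasDerivAt_of_isBigO_rpow hwl hw_top (by linarith : s.re < a)
      (isBigO_indicator_of_compl_mem m0 (v := (· ^ (-(s.re - 1))))) (sub_one_lt _)
    refine ⟨h1, h2.unique ((hasDerivAt_const s e).congr_of_eventuallyEq ?_)⟩
    filter_upwards [(isOpen_lt Complex.continuous_re continuous_const).mem_nhds hs] with z hz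
    have hz : z.re < -R := hz
    rw [← he z, hEl z hz.le, hw']
    exact (hasMellin_sub (cg1 z) (ch1 z (by linarith))).2
  have hinv := mellinInv_mellin_eq (-R - 1) (fun t => Real.log t • w t) (zero_lt_one.trans hx)
    (key _ (by simp)).1 ?_ ?_
  · have hz : mellinInv (-R - 1) (mellin fun t => Real.log t • w t) x = 0 := by
      rw [mellinInv]
      simp only [(key _ (by simp : (((-R - 1 : ℝ) : ℂ) + (_ : ℝ) * Complex.I).re < -R)).2, smul_zero,
        integral_zero]
    rw [hz, eq_comm, smul_eq_zero_iff_right (Real.log_pos hx).ne', hw,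
      indicator_of_mem (by exact hx), sub_eq_zero] at hinv
    exact hinv
  · rw [VerticalIntegrable]
    simp only [(key _ (by simp : (((-R - 1 : ℝ) : ℂ) + (_ : ℝ) * Complex.I).re < -R)).2]
    exact integrable_zero _ _ _
  · have hx0 : x ≠ 0 := by linarith
    refine (Real.continuousAt_log hx0).smul ?_
    have : (fun t => g t - h t) =ᶠ[𝓝 x] w := by
      filter_upwards [Ioi_mem_nhds hx] with t ht
      rw [hw, indicator_of_mem ht]
    refine ContinuousAt.congr ?_ this
    have hm : Ioi (0 : ℝ) ∈ 𝓝 x := Ioi_mem_nhds (by linarith)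
    exact (hg.continuousAt hm).sub (hh.continuousAt hm)

end Mellin

lemma norm_qSeries_le_exp {a : ℕ → ℂ} {C : ℝ} {K : ℕ} (hC : 0 ≤ C)
    (ha : ∀ n, ‖a n‖ ≤ C * (n : ℝ) ^ K) (ha0 : a 0 = 0) :
    ∃ D : ℝ, ∀ z : ℍ, 1 ≤ z.im → ‖qSeries a z‖ ≤ D * Real.exp (-(2 * Real.pi * z.im)) := by
  have hs := ((hasSum_choose_mul_exp (K := K) (by positivity : 0 < 2 * Real.pi)).mul_left
    (C * K.factorial)).mul_left (Real.exp (2 * Real.pi))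
  obtain ⟨D, hs⟩ : ∃ D, HasSum _ D := ⟨_, hs⟩
  refine ⟨D, fun z hz => ?_⟩
  refine tsum_of_norm_bounded (hs.mul_right (Real.exp (-(2 * Real.pi * z.im)))) fun n => ?_
  rcases eq_or_ne n 0 with rfl | hn
  · rw [ha0, zero_mul, norm_zero]
    positivity
  have h1 := norm_qSeries_term_le hC ha (y := 1) (z := Complex.I) (by simp) n
  rw [mul_one] at h1
  rw [norm_mul, norm_exp_two_pi_mul] at h1 ⊢
  rw [coe_im]
  have h2 : Real.exp (-(2 * Real.pi * z.im)) ^ n ≤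
      Real.exp (-(2 * Real.pi * Complex.I.im)) ^ n *
        (Real.exp (2 * Real.pi) * Real.exp (-(2 * Real.pi * z.im))) := by
    rw [← Real.exp_nat_mul, ← Real.exp_nat_mul, ← Real.exp_add, ← Real.exp_add, Real.exp_le_exp,
      Complex.I_im]
    have hn1 : (1 : ℝ) ≤ n := mod_cast Nat.one_le_iff_ne_zero.2 hn
    have hpi := Real.pi_pos
    have : 0 ≤ (n - 1 : ℝ) * (2 * Real.pi * (z.im - 1)) :=
      mul_nonneg (by linarith) (mul_nonneg (by positivity) (by linarith))
    linarith
  calc _ ≤ ‖a n‖ * (Real.exp (-(2 * Real.pi * Complex.I.im)) ^ n *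
        (Real.exp (2 * Real.pi) * Real.exp (-(2 * Real.pi * z.im)))) := by gcongr
    _ = (‖a n‖ * Real.exp (-(2 * Real.pi * Complex.I.im)) ^ n) *
        (Real.exp (2 * Real.pi) * Real.exp (-(2 * Real.pi * z.im))) := by ring
    _ ≤ _ := mul_le_mul_of_nonneg_right h1 (by positivity)
    _ = _ := by ring

open scoped Manifold in
lemma eq_of_eqOn_imaginary_axis {f g : ℍ → ℂ} (hf : MDiff f) (hg : MDiff g)
    (h : ∀ (y : ℝ) (z : ℍ), 1 < y → (z : ℂ) = y * Complex.I → f z = g z) : f = g := by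
  have hU : IsOpen {z : ℂ | 0 < z.im} := isOpen_upperHalfPlaneSet
  have key := (UpperHalfPlane.mdifferentiable_iff.1 hf).analyticOnNhd hU
    |>.eqOn_of_preconnected_of_frequently_eq
      ((UpperHalfPlane.mdifferentiable_iff.1 hg).analyticOnNhd hU)
      (convex_halfSpace_im_gt 0).isPreconnected (z₀ := 2 * Complex.I) (by simp) ?_
  · ext z
    simpa [ofComplex_apply] using key z.im_pos
  · have ht : Filter.Tendsto (fun y : ℝ => (y : ℂ) * Complex.I) (nhdsWithin 2 {2}ᶜ)
        (nhdsWithin (2 * Complex.I) {2 * Complex.I}ᶜ) := by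
      refine tendsto_nhdsWithin_iff.2 ⟨?_, ?_⟩
      · have : Continuous fun y : ℝ => (y : ℂ) * Complex.I := by fun_prop
        exact (this.tendsto' 2 _ (by simp)).mono_left nhdsWithin_le_nhds
      · filter_upwards [self_mem_nhdsWithin] with y hy heq
        apply hy
        have := congrArg Complex.im (show (y : ℂ) * Complex.I = 2 * Complex.I from heq)
        simpa using this
    refine ht.frequently (Filter.Eventually.frequently ?_)
    have : Set.Ioi (1 : ℝ) ∈ nhdsWithin 2 {2}ᶜ := mem_nhdsWithin_of_mem_nhds (Ioi_mem_nhds one_lt_two)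
    filter_upwards [this] with y hy
    have hy : 1 < y := hy
    have him : 0 < ((y : ℂ) * Complex.I).im := by simp; linarith
    simp only [Function.comp_apply, ofComplex_apply_of_im_pos him]
    exact h y _ hy rfl

/-! ### From the functional equation to the Fricke involution -/

section Fricke

open Asymptotics Filter Set
open scoped Topology

variable {a : ℕ → ℂ} {C : ℝ} {K : ℕ} {F Λ : ℂ → ℂ}

/-- The restriction of a `q`-series to the imaginary axis. -/
noncomputable def axisSeries (a : ℕ → ℂ) (y : ℝ) : ℂ := qSeries a (ofComplex (y * Complex.I))

lemma exists_axisSeries_eq (a : ℕ → ℂ) {y : ℝ} (hy : 0 < y) :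
    ∃ z : ℍ, (z : ℂ) = y * Complex.I ∧ z.im = y ∧ axisSeries a y = qSeries a z := by
  have him : 0 < ((y : ℂ) * Complex.I).im := by simpa using hy
  refine ⟨⟨y * Complex.I, him⟩, rfl, ?_, ?_⟩
  · simp [UpperHalfPlane.im]
  · rw [axisSeries, ofComplex_apply_of_im_pos him]

lemma continuousOn_axisSeries (hC : 0 ≤ C) (ha : ∀ n, ‖a n‖ ≤ C * (n : ℝ) ^ K) :
    ContinuousOn (axisSeries a) (Ioi 0) := by
  have h := (UpperHalfPlane.mdifferentiable_iff.1 (mdifferentiable_qSeries hC ha)).continuousOn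
  exact h.comp (f := fun y : ℝ => (y : ℂ) * Complex.I) (by fun_prop) fun y hy => by
    simpa using hy

lemma axisSeries_isBigO_atTop (hC : 0 ≤ C) (ha : ∀ n, ‖a n‖ ≤ C * (n : ℝ) ^ K) (ha0 : a 0 = 0) (r : ℝ) :
    axisSeries a =O[atTop] (· ^ (-r)) := by
  obtain ⟨D, hD⟩ := norm_qSeries_le_exp hC ha ha0
  refine IsBigO.trans ?_ (isLittleO_exp_neg_mul_rpow_atTop (by positivity : 0 < 2 * Real.pi) _).isBigO
  refine IsBigO.of_bound D ?_
  filter_upwards [eventually_ge_atTop 1] with y hy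
  obtain ⟨z, -, hz, hz'⟩ := exists_axisSeries_eq a (zero_lt_one.trans_le hy)
  rw [hz', Real.norm_of_nonneg (Real.exp_nonneg _)]
  simpa [hz] using hD z (hz ▸ hy)

lemma axisSeries_isBigO_zero (hC : 0 ≤ C) (ha : ∀ n, ‖a n‖ ≤ C * (n : ℝ) ^ K) :
    axisSeries a =O[𝓝[>] 0] (· ^ (-((K + 1 : ℕ) : ℝ))) := by
  refine IsBigO.of_bound (C * K.factorial * 2 ^ (K + 1)) ?_
  filter_upwards [self_mem_nhdsWithin, mem_nhdsWithin_of_mem_nhds (Iic_mem_nhds one_pos)] with y hy hy1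
  have hy : 0 < y := hy
  have hy1 : y ≤ 1 := hy1
  obtain ⟨z, -, hz, hz'⟩ := exists_axisSeries_eq a hy
  rw [hz', Real.norm_of_nonneg (by positivity), Real.rpow_neg hy.le, Real.rpow_natCast]
  refine (norm_qSeries_le hC ha z).trans ?_
  rw [hz, mul_assoc (C * K.factorial), ← inv_pow, ← mul_pow]
  gcongr
  have : 1 ≤ y⁻¹ := (one_le_inv₀ hy).2 hy1
  rw [one_div]
  linarith

lemma mellin_axisSeries (hC : 0 ≤ C) (ha : ∀ n, ‖a n‖ ≤ C * (n : ℝ) ^ K) (ha0 : a 0 = 0) {s : ℂ}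
    (hs : 0 < s.re) {L : ℂ} (hsum : LSeriesHasSum a s L) :
    mellin (axisSeries a) s = (2 * Real.pi : ℝ) ^ (-s) * (Gamma s * L) := by
  have hterm (n : ℕ) : a n / ((2 * Real.pi * n : ℝ) : ℂ) ^ s =
      (2 * Real.pi : ℝ) ^ (-s) * LSeries.term a s n := by
    rcases eq_or_ne n 0 with rfl | hn
    · simp [ha0]
    · rw [LSeries.term_of_ne_zero hn, ofReal_mul, Complex.mul_cpow_ofReal_nonneg (by positivity)
        (by positivity), Complex.cpow_neg, ofReal_natCast]
      field_simp
  refine (hasSum_mellin (a := a) (p := fun n => 2 * Real.pi * n) (F := axisSeries a) ?_ hs ?_ ?_).unique ?_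
  · intro n
    rcases eq_or_ne n 0 with rfl | hn
    · exact .inl ha0
    · right; positivity
  · intro t ht
    obtain ⟨z, hz, -, hz'⟩ := exists_axisSeries_eq a ht
    rw [hz']
    refine (hasSum_qSeries hC ha z).congr_arg_fun fun n => ?_
    rw [hz, ofReal_exp]
    congr 2
    push_cast
    linear_combination (-(2 * Real.pi * n * t) : ℂ) * Complex.I_mul_I
  · have := (hsum.LSeriesSummable.norm).mul_left ((2 * Real.pi) ^ (-s.re))
    refine this.congr fun n => ?_
    have h1 := congrArg norm (hterm n)
    have h2 : ‖((2 * Real.pi : ℝ) : ℂ) ^ (-s)‖ = (2 * Real.pi) ^ (-s.re) :=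
      Complex.norm_cpow_eq_rpow_re_of_pos (by positivity) _
    rw [norm_mul, norm_div, h2] at h1
    rw [← h1]
    rcases eq_or_ne n 0 with rfl | hn
    · simp [ha0]
    · rw [Complex.norm_cpow_eq_rpow_re_of_pos (by positivity)]
  · refine (((hsum.mul_left (Gamma s)).mul_left (((2 * Real.pi : ℝ) : ℂ) ^ (-s)))).congr_arg_fun fun n => ?_
    rw [mul_div_assoc, hterm]
    ring

lemma isBigO_cpow_mul_comp_inv {g : ℝ → ℂ} {N : ℝ} (hN : 0 < N) (κ : ℂ) (q : ℝ) {l l' : Filter ℝ} {r : ℝ}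
    (hg : g =O[l'] (· ^ (-r))) (hl : Tendsto (fun y => (N * y)⁻¹) l l') (hpos : ∀ᶠ y in l, 0 < y) :
    (fun y : ℝ => κ • ((y : ℂ) ^ (-q : ℂ) • g (N * y)⁻¹)) =O[l] (· ^ (-(q - r))) := by
  obtain ⟨D, hD⟩ := (hg.comp_tendsto hl).bound
  refine IsBigO.of_bound (‖κ‖ * (D * N ^ r)) ?_
  filter_upwards [hD, hpos] with y hy hy0
  simp only [Function.comp_apply] at hy
  have h1 : ‖((N * y)⁻¹) ^ (-r)‖ = N ^ r * y ^ r := by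
    rw [Real.norm_of_nonneg (by positivity), Real.inv_rpow (by positivity), Real.rpow_neg (by positivity),
      inv_inv, Real.mul_rpow hN.le hy0.le]
  rw [h1] at hy
  have h2 : ‖(y : ℂ) ^ (-q : ℂ)‖ = y ^ (-q) := by
    rw [Complex.norm_cpow_eq_rpow_re_of_pos hy0]; simp
  rw [norm_smul, norm_smul, h2, Real.norm_of_nonneg (by positivity), neg_sub, sub_eq_add_neg r,
    Real.rpow_add hy0]
  calc _ ≤ ‖κ‖ * (y ^ (-q) * (D * (N ^ r * y ^ r))) := by gcongr
    _ = _ := by ring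

lemma mellin_cpow_mul_comp_inv (g : ℝ → ℂ) {N : ℝ} (hN : 0 < N) (κ r s : ℂ) :
    mellin (fun y : ℝ => κ • ((y : ℂ) ^ (-r) • g (N * y)⁻¹)) s =
      κ * ((N : ℂ) ^ (r - s) * mellin g (r - s)) := by
  rw [mellin_const_smul, mellin_cpow_smul, mellin_comp_mul_left (fun t => g t⁻¹) _ hN, mellin_comp_inv,
    smul_eq_mul, smul_eq_mul, neg_add, neg_neg, neg_add_eq_sub]

lemma ofReal_cpow_eq_exp {x : ℝ} (hx : 0 < x) (s : ℂ) : (x : ℂ) ^ s = cexp (Real.log x * s) := by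
  rw [Complex.cpow_def_of_ne_zero (mod_cast hx.ne'), Complex.ofReal_log hx.le]

/-- Hecke's converse theorem: the functional equation gives the behaviour under the Fricke
involution. -/
theorem act_fricke_qSeries (hC : 0 ≤ C) (ha : ∀ n, ‖a n‖ ≤ C * (n : ℝ) ^ K) (ha0 : a 0 = 0)
    (hE : IsEBV a F Λ) {N : ℕ} (hN : 0 < N) {m : ℤ} {ε : ℂ} (hε : ε ^ 2 = 1)
    (hFE : HasFunctionalEquation Λ N (2 * m) ε) :
    act m !![0, -1; (N : ℤ), 0] (qSeries a) = ε • qSeries a := by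
  have hNR : 0 < (N : ℝ) := mod_cast hN
  have hNC : (N : ℂ) ≠ 0 := mod_cast hN.ne'
  -- As `N^m (N i y)^(-2m) = (-1)^m N^(-m) y^(-2m)`, the function `h` below is `ε` times `f | H` on
  -- the imaginary axis; the goal becomes `g = h`.
  set κ : ℂ := ε * (-1) ^ m * (N : ℂ) ^ (-m) with hκ
  set g := axisSeries a with hg
  set h : ℝ → ℂ := fun y => κ • ((y : ℂ) ^ (-((2 * m : ℝ) : ℂ)) • g (N * y)⁻¹) with hh
  set M : ℂ → ℂ := fun s => (2 * Real.pi : ℝ) ^ (-s) * Λ s with hM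
  obtain ⟨σ, hσ⟩ := hE.hasSum
  have hpi2 : (0 : ℝ) < 2 * Real.pi := by positivity
  have hgM (s : ℂ) (hs : max σ 0 < s.re) : mellin g s = M s := by
    have hs0 : 0 < s.re := (le_max_right _ _).trans_lt hs
    rw [hg, mellin_axisSeries hC ha ha0 hs0 (hσ s ((le_max_left _ _).trans_lt hs))]
    simp only [hM]
    rw [hE.completed_eq s]
    rintro n rfl
    simp at hs0
    linarith [(Nat.cast_nonneg n : (0 : ℝ) ≤ n)]
  -- The substitution `y ↦ 1 / (N y)` reflects `s` to `2 m - s`, and the functional equation leads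
  -- back to the same `M`.
  have hhM (s : ℂ) (hs : s.re < 2 * m - max σ 0) : mellin h s = M s := by
    have hre : max σ 0 < (((2 * m : ℝ) : ℂ) - s).re := by
      rw [sub_re, ofReal_re]; linarith
    rw [hh, mellin_cpow_mul_comp_inv g hNR, hgM _ hre, hM]
    have hfe := hFE s
    have hsq : 0 < √(N : ℝ) := Real.sqrt_pos.2 hNR
    rw [show (((2 * m : ℤ) : ℂ) / 2) = ((m : ℤ) : ℂ) by push_cast; ring, Complex.cpow_intCast,
      ofReal_cpow_eq_exp (by positivity), ofReal_cpow_eq_exp (by positivity),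
      Real.log_div hsq.ne' hpi2.ne'] at hfe
    have hNm : (N : ℂ) ^ (-m) = cexp (Real.log N * (-m)) := by
      rw [← ofReal_cpow_eq_exp hNR, ofReal_natCast, ← Complex.cpow_intCast]
      push_cast
      rfl
    rw [hκ, hNm]
    simp only [ofReal_cpow_eq_exp hNR, ofReal_cpow_eq_exp hpi2]
    have hlog : Real.log N = 2 * Real.log √(N : ℝ) := by
      rw [Real.log_sqrt hNR.le]; ring
    rw [hlog]
    push_cast at hfe ⊢
    generalize (Real.log √(N : ℝ) : ℂ) = x at *
    generalize (Real.log (2 * Real.pi) : ℂ) = y at *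
    have e1 : cexp (y * -s) = cexp (-(x * s)) * cexp ((x - y) * s) := by
      rw [← Complex.exp_add]; ring_nf
    have e2 : cexp (2 * x * -m) * (cexp (2 * x * (2 * m - s)) * cexp (y * -(2 * m - s))) =
        cexp (-(x * s)) * cexp ((x - y) * (2 * m - s)) := by
      rw [← Complex.exp_add, ← Complex.exp_add, ← Complex.exp_add]; ring_nf
    rw [e1, mul_assoc (cexp (-(x * s))), hfe]
    linear_combination ε * (-1) ^ m * Λ (2 * m - s) * e2
  have hmain (y : ℝ) (hy : 1 < y) : g y = h y := by
    refine eq_of_mellin_eq (continuousOn_axisSeries hC ha) ?_ (axisSeries_isBigO_atTop hC ha ha0)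
      (axisSeries_isBigO_zero hC ha) (isBigO_cpow_mul_comp_inv hNR κ _ (axisSeries_isBigO_zero hC ha) ?_
        (eventually_gt_atTop 0)) (fun r => ?_) ?_ ?_ hgM hhM hy
    · refine continuousOn_const.fun_smul (ContinuousOn.fun_smul ?_ ?_)
      · exact fun y hy => (Complex.continuousAt_ofReal_cpow_const _ _ (.inr (ne_of_gt hy))).continuousWithinAt
      · refine (continuousOn_axisSeries hC ha).comp ?_ fun y hy => ?_
        · exact fun y hy => ((continuousAt_const.mul continuousAt_id).inv₀
            (mul_pos hNR hy).ne').continuousWithinAt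
        · have hy : 0 < y := hy
          exact inv_pos.2 (mul_pos hNR hy)
    · refine tendsto_inv_atTop_nhdsGT_zero.comp (tendsto_id.const_mul_atTop hNR)
    · have := isBigO_cpow_mul_comp_inv hNR κ (2 * m) (l := 𝓝[>] 0)
        (axisSeries_isBigO_atTop hC ha ha0 (2 * m - r)) ?_ self_mem_nhdsWithin
      · simpa using this
      · refine tendsto_inv_nhdsGT_zero.comp (tendsto_nhdsWithin_iff.2 ⟨?_, ?_⟩)
        · exact ((continuous_const.mul continuous_id).tendsto' 0 0 (by simp)).mono_left nhdsWithin_le_nhds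
        · filter_upwards [self_mem_nhdsWithin] with y hy using mul_pos hNR hy
    · exact (Differentiable.const_cpow (by fun_prop) (.inl (mod_cast hpi2.ne'))).mul hE.entire_completed
    · intro α β
      obtain ⟨D, hD⟩ := hE.bounded_strips α β
      refine ⟨((2 * Real.pi) ^ (-α)) * D, fun s h1 h2 => ?_⟩
      rw [hM, norm_mul, Complex.norm_cpow_eq_rpow_re_of_pos hpi2]
      have hD0 := (norm_nonneg _).trans (hD s h1 h2)
      gcongr
      · linarith [Real.two_le_pi]
      · rw [neg_re]; linarith
      · exact hD s h1 h2
  refine eq_of_eqOn_imaginary_axis (mdifferentiable_act (mdifferentiable_qSeries hC ha) _ _)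
    ((mdifferentiable_qSeries hC ha).const_smul ε) fun y z hy hz => ?_
  have hy0 : 0 < y := by linarith
  have hyC : (y : ℂ) ≠ 0 := mod_cast hy0.ne'
  obtain ⟨z', hz1, -, hz2⟩ := exists_axisSeries_eq a hy0
  obtain rfl : z' = z := UpperHalfPlane.ext (hz1.trans hz.symm)
  obtain ⟨w, hw1, -, hw2⟩ := exists_axisSeries_eq a (inv_pos.2 (mul_pos hNR hy0))
  have h1 := hmain y hy
  rw [hg, hz2, hh] at h1
  simp only [hg, hw2] at h1
  rw [act_apply_of_eq m (by simpa using hN) (w := w)]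
  · rw [Pi.smul_apply, h1]
    have e1 : (y : ℂ) ^ (-((2 * m : ℝ) : ℂ)) = (y : ℂ) ^ (-(2 * m)) := by
      rw [← Complex.cpow_intCast]; push_cast; rfl
    have e2 : ((N : ℂ) * (y * Complex.I)) ^ (-(2 * m)) =
        (N : ℂ) ^ (-m) * (N : ℂ) ^ (-m) * (y : ℂ) ^ (-(2 * m)) * (-1) ^ m := by
      rw [mul_zpow, mul_zpow, ← zpow_add₀ hNC, ← two_mul, mul_neg, zpow_neg Complex.I, _root_.zpow_mul Complex.I,
        ← _root_.inv_zpow, show (Complex.I ^ (2 : ℤ))⁻¹ = -1 by norm_num [zpow_ofNat]]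
      ring
    have e3 : (N : ℂ) ^ m * (N : ℂ) ^ (-m) = 1 := by rw [← zpow_add₀ hNC]; simp
    simp only [e1, det_fin_two_of, of_apply, cons_val', cons_val_zero, cons_val_one, cons_val_fin_one, smul_eq_mul,
      hz, hκ]
    push_cast
    simp only [add_zero, zero_sub, neg_mul, one_mul, neg_neg, e2]
    linear_combination ((N : ℂ) ^ (-m) * (y : ℂ) ^ (-(2 * m)) * (-1) ^ m * qSeries a w) * (e3 - hε)
  · rw [hw1, hz]
    simp
    field_simp
    simp

end Fricke

/-! ### Limits at the cusps -/

section Cusps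

open Filter Asymptotics
open scoped Topology Manifold

/-- A periodic holomorphic function of polynomial growth has a limit at infinity. -/
theorem exists_tendsto_atImInfty_of_polynomial_growth {g : ℍ → ℂ} (hg : MDiff g) {h : ℝ} (hh : 0 < h)
    (hper : ∀ z w : ℍ, (w : ℂ) = z + h → g w = g z) {D : ℝ} {n : ℕ}
    (hb : ∀ z : ℍ, |z.re| ≤ h → 1 ≤ z.im → ‖g z‖ ≤ D * z.im ^ n) :
    ∃ L, Tendsto g atImInfty (𝓝 L) := by
  set G : ℂ → ℂ := g ∘ ofComplex with hG
  have hGper : Function.Periodic G h := by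
    intro z
    by_cases hz : 0 < z.im
    · have hz' : 0 < (z + h).im := by simpa using hz
      simp only [hG, Function.comp_apply, ofComplex_apply_of_im_pos hz, ofComplex_apply_of_im_pos hz']
      exact hper _ _ rfl
    · have hz' : (z + h).im ≤ 0 := by simpa using hz
      simp only [hG, Function.comp_apply, ofComplex_apply_of_im_nonpos (not_lt.1 hz),
        ofComplex_apply_of_im_nonpos hz']
  have hGd : ∀ᶠ z in comap Complex.im atTop, DifferentiableAt ℂ G z := by
    filter_upwards [preimage_mem_comap (Ioi_mem_atTop 0)] with z hz
    exact (UpperHalfPlane.mdifferentiable_iff.1 hg).differentiableAt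
      (isOpen_upperHalfPlaneSet.mem_nhds hz)
  have hlim : Tendsto (fun y : ℝ => D * (y ^ n * Real.exp (-(2 * Real.pi / h) * y))) atTop (𝓝 0) := by
    have h1 := (isLittleO_pow_exp_pos_mul_atTop n (by positivity : 0 < 2 * Real.pi / h)).tendsto_div_nhds_zero
    rw [← mul_zero D]
    refine (h1.congr fun y => ?_).const_mul D
    rw [neg_mul, Real.exp_neg, div_eq_mul_inv]
  -- In the coordinate `q = e^(2πiz/h)`, the decay of `|q| = e^(-2πy/h)` beats `y^n`, so the
  -- function is `o(1/q)` and its singularity at `q = 0` is removable.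
  have ho : (fun q => Function.Periodic.cuspFunction h G q - Function.Periodic.cuspFunction h G 0)
      =o[𝓝[≠] 0] fun q => (q - 0)⁻¹ := by
    simp only [sub_zero]
    refine IsLittleO.sub ?_ ?_
    · rw [isLittleO_iff_tendsto' (by
        filter_upwards [self_mem_nhdsWithin] with q hq h0
        exact absurd (inv_eq_zero.1 h0) hq)]
      have ht := hlim.comp (tendsto_comap_iff.1 (Function.Periodic.invQParam_tendsto hh))
      refine squeeze_zero_norm' ?_ ht
      filter_upwards [self_mem_nhdsWithin,
        (Function.Periodic.invQParam_tendsto hh).eventually (preimage_mem_comap (Ici_mem_atTop 1))]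
        with q hq hq1
      have hq1 : 1 ≤ (Function.Periodic.invQParam h q).im := hq1
      have hqn : ‖q‖ = Real.exp (-(2 * Real.pi / h) * (Function.Periodic.invQParam h q).im) := by
        conv_lhs => rw [← Function.Periodic.qParam_right_inv hh.ne' hq, Function.Periodic.norm_qParam]
        congr 1
        ring
      have hre : |(Function.Periodic.invQParam h q).re| ≤ h := by
        have : (Function.Periodic.invQParam h q).re = h / (2 * Real.pi) * q.arg := by
          rw [Function.Periodic.invQParam, ← Complex.log_im, show (h : ℂ) / (2 * Real.pi * Complex.I) * log q =
            ((h / (2 * Real.pi) : ℝ) : ℂ) * (-(Complex.I * log q)) by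
              push_cast; field_simp; rw [Complex.I_sq]; ring, re_ofReal_mul]
          simp
        rw [this, abs_mul, abs_of_pos (by positivity), div_mul_eq_mul_div, div_le_iff₀ (by positivity)]
        gcongr
        linarith [Complex.abs_arg_le_pi q, Real.pi_pos]
      rw [Function.Periodic.cuspFunction_eq_of_nonzero _ _ hq, div_inv_eq_mul, norm_mul, hqn]
      simp only [Function.comp_apply, hG,
        ofComplex_apply_of_im_pos (zero_lt_one.trans_le hq1)]
      rw [← mul_assoc D]
      exact mul_le_mul_of_nonneg_right (hb ⟨_, _⟩ hre hq1) (Real.exp_nonneg _)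
    · refine isLittleO_const_left.2 (Or.inr ?_)
      exact (tendsto_norm_inv_nhdsNE_zero_atTop)
  have h1 := Complex.tendsto_limUnder_of_differentiable_on_punctured_nhds_of_isLittleO
    (Function.Periodic.eventually_differentiableAt_cuspFunction_nhds_ne_zero hh hGper hGd) ho
  refine ⟨_, (h1.comp ((Function.Periodic.qParam_tendsto hh).comp tendsto_coe_atImInfty)).congr fun z => ?_⟩
  rw [Function.comp_apply, Function.comp_apply, Function.Periodic.eq_cuspFunction hh.ne' hGper, hG,
    Function.comp_apply, ofComplex_apply]

lemma tendsto_act_upper {g : ℍ → ℂ} {L : ℂ} (hg : Tendsto g atImInfty (𝓝 L)) (m : ℤ) {a b d : ℤ}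
    (h : 0 < a * d) :
    Tendsto (act m !![a, b; 0, d] g) atImInfty
      (𝓝 (((a * d : ℤ) : ℂ) ^ m * (d : ℂ) ^ (-(2 * m)) * L)) := by
  have hdet : 0 < (!![a, b; 0, d] : Matrix (Fin 2) (Fin 2) ℤ).det := by simpa using h
  have h1 : Tendsto (fun z : ℍ => intGL _ hdet • z) atImInfty atImInfty :=
    tendsto_smul_atImInfty (by simp [intGL_apply])
  refine ((hg.comp h1).const_mul (((a * d : ℤ) : ℂ) ^ m * (d : ℂ) ^ (-(2 * m)))).congr fun z => ?_
  rw [act_apply m hdet]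
  simp

variable {m : ℤ} {f : ℍ → ℂ} {N : ℤ}

/-- The limit at a cusp depends only on the class of the cusp. -/
lemma tendsto_act_of_dvd
    (hinv : ∀ a b c d : ℤ, a * d - b * c = 1 → N ∣ c → act m !![a, b; c, d] f = f)
    {a b c d a' b' c' d' : ℤ} (h : a * d - b * c = 1) (h' : a' * d' - b' * c' = 1) (n : ℤ)
    (hdvd : N ∣ c' * d - (d' + n * c') * c) {L : ℂ}
    (hL : Tendsto (act m !![a, b; c, d] f) atImInfty (𝓝 L)) :
    Tendsto (act m !![a', b'; c', d'] f) atImInfty (𝓝 L) := by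
  have hdet : 0 < (!![a, b; c, d] : Matrix (Fin 2) (Fin 2) ℤ).det := by simp [h]
  -- `δ = γ' T^n γ⁻¹`, which `hdvd` places in `Γ₀(N)`.
  set δ : Matrix (Fin 2) (Fin 2) ℤ := !![a' * d - (b' + n * a') * c, -a' * b + (b' + n * a') * a;
    c' * d - (d' + n * c') * c, -c' * b + (d' + n * c') * a]
  have hδ : (a' * d - (b' + n * a') * c) * (-c' * b + (d' + n * c') * a) -
      (-a' * b + (b' + n * a') * a) * (c' * d - (d' + n * c') * c) = 1 := by
    linear_combination (a' * d' - b' * c') * h + h'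
  have hδdet : 0 < δ.det := by
    rw [det_fin_two_of, hδ]; exact one_pos
  have h1 : act m (δ * !![a, b; c, d] * !![1, -n; 0, 1]) f =
      act m !![1, -n; 0, 1] (act m !![a, b; c, d] f) := by
    have : act m δ f = f := hinv _ _ _ _ hδ hdvd
    rw [← act_act m (by rw [det_mul]; positivity) (by simp), ← act_act m hδdet hdet, this]
  have h2 : δ * !![a, b; c, d] * !![1, -n; 0, 1] = !![a', b'; c', d'] := by
    ext i j
    fin_cases i <;> fin_cases j <;> simp [δ, Matrix.mul_apply, Fin.sum_univ_two]
    · linear_combination a' * h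
    · linear_combination b' * h
    · linear_combination c' * h
    · linear_combination d' * h
  rw [← h2, h1]
  simpa using tendsto_act_upper hL m (a := 1) (b := -n) (d := 1) (by norm_num)

lemma exists_tendsto_act (hf : MDiff f) (hN : 0 < N)
    (hinv : ∀ a b c d : ℤ, a * d - b * c = 1 → N ∣ c → act m !![a, b; c, d] f = f) (hm : 0 < m)
    {D : ℝ} {n : ℕ} (hD : 0 ≤ D) (hb : ∀ z : ℍ, ‖f z‖ ≤ D * (1 + 1 / z.im) ^ n) {a b c d : ℤ}
    (h : a * d - b * c = 1) : ∃ L, Tendsto (act m !![a, b; c, d] f) atImInfty (𝓝 L) := by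
  have hdet1 : (!![a, b; c, d] : Matrix (Fin 2) (Fin 2) ℤ).det = 1 := by simp [h]
  have hdet : 0 < (!![a, b; c, d] : Matrix (Fin 2) (Fin 2) ℤ).det := by rw [hdet1]; exact one_pos
  have hNR : (0 : ℝ) < N := mod_cast hN
  have hper : act m !![1, N; 0, 1] (act m !![a, b; c, d] f) = act m !![a, b; c, d] f := by
    -- `δ = γ T^N γ⁻¹` lies in `Γ₀(N)`, so `f | γ` has period `N`.
    set δ : Matrix (Fin 2) (Fin 2) ℤ := !![1 - N * a * c, N * a ^ 2; - N * c ^ 2, 1 + N * a * c]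
    have hδ : (1 - N * a * c) * (1 + N * a * c) - N * a ^ 2 * (- N * c ^ 2) = 1 := by ring
    have hδf : act m δ f = f := hinv _ _ _ _ hδ ⟨-c ^ 2, by ring⟩
    rw [act_act m hdet (by simp)]
    conv_rhs => rw [← hδf, act_act m (by rw [det_fin_two_of, hδ]; exact one_pos) hdet]
    congr 2
    ext i j
    fin_cases i <;> fin_cases j <;> simp [δ, Matrix.mul_apply, Fin.sum_univ_two]
    · ring
    · linear_combination (-N * a) * h
    · ring
    · linear_combination (-N * c) * h
  -- For `|x| ≤ N` and `y ≥ 1` one has `1 ≤ |c z + d| ≤ R y`. So `γ z` has imaginary part at least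
  -- `1 / (R² y)`, and `f | γ` grows at most like `y^n`.
  set R : ℝ := |(c : ℝ)| * (N + 1) + |(d : ℝ)| with hR
  refine exists_tendsto_atImInfty_of_polynomial_growth (mdifferentiable_act hf m _) hNR
    (D := D * (1 + R ^ 2) ^ n) (n := n) ?_ ?_
  · intro z w hw
    conv_rhs => rw [← hper, act_apply_of_eq m (by simp) (w := w) _ (by simp [hw])]
    simp
  · intro z hx hy
    have hy0 : 0 < z.im := z.im_pos
    have hsq : ‖(c : ℂ) * z + d‖ ^ 2 = (c * z.re + d) ^ 2 + (c * z.im) ^ 2 := by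
      rw [Complex.sq_norm, Complex.normSq_apply]
      simp
      ring
    have hnorm1 : 1 ≤ ‖(c : ℂ) * z + d‖ := by
      rw [← one_le_sq_iff₀ (norm_nonneg _), hsq]
      rcases eq_or_ne c 0 with rfl | hc
      · have hd : d ^ 2 = 1 := by
          have : IsUnit d := IsUnit.of_mul_eq_one a (by linear_combination h)
          rcases Int.isUnit_iff.1 this with rfl | rfl <;> norm_num
        have : (d : ℝ) ^ 2 = 1 := mod_cast hd
        simp [this]
      · have hc2 : (1 : ℝ) ≤ (c : ℝ) ^ 2 := by
          have : 0 < c ^ 2 := by positivity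
          exact_mod_cast this
        have : 1 ≤ (c * z.im) ^ 2 := by
          rw [mul_pow]
          exact one_le_mul_of_one_le_of_one_le hc2 (one_le_pow₀ hy)
        linarith [sq_nonneg (c * z.re + d)]
    have hnorm2 : ‖(c : ℂ) * z + d‖ ≤ R * z.im := by
      have hz : ‖(z : ℂ)‖ ≤ (N + 1) * z.im := by
        refine (Complex.norm_le_abs_re_add_abs_im _).trans ?_
        rw [coe_re, coe_im, abs_of_pos hy0]
        nlinarith
      calc _ ≤ |(c : ℝ)| * ((N + 1) * z.im) + |(d : ℝ)| := by
            refine norm_add_le_of_le ?_ (by rw [Complex.norm_intCast])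
            rw [norm_mul, Complex.norm_intCast]
            gcongr
        _ ≤ R * z.im := by
            rw [hR]
            nlinarith [abs_nonneg (d : ℝ)]
    have him : (intGL _ hdet • z).im = z.im / ‖(c : ℂ) * z + d‖ ^ 2 := by
      rw [UpperHalfPlane.im_smul_eq_div_normSq, det_intGL, hdet1, denom_intGL, Complex.sq_norm]
      simp
    rw [act_apply m hdet, hdet1, norm_mul, norm_mul]
    have e1 : ‖((1 : ℤ) : ℂ) ^ m‖ = 1 := by simp
    have e2 : ‖(((!![a, b; c, d] : Matrix (Fin 2) (Fin 2) ℤ) 1 0 : ℂ) * z +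
        (!![a, b; c, d] : Matrix (Fin 2) (Fin 2) ℤ) 1 1) ^ (-(2 * m))‖ ≤ 1 := by
      rw [norm_zpow]
      exact zpow_le_one_of_nonpos₀ hnorm1 (by omega)
    rw [e1, one_mul]
    calc _ ≤ 1 * ‖f (intGL _ hdet • z)‖ := by gcongr
      _ ≤ D * ((1 + R ^ 2) * z.im) ^ n := by
        rw [one_mul]
        refine (hb _).trans ?_
        have him0 := (intGL _ hdet • z).im_pos
        gcongr
        rw [him, one_div_div]
        have : ‖(c : ℂ) * z + d‖ ^ 2 / z.im ≤ R ^ 2 * z.im := by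
          rw [div_le_iff₀ hy0]
          calc _ ≤ (R * z.im) ^ 2 := by gcongr
            _ = _ := by ring
        linarith
      _ = _ := by rw [mul_pow]; ring

end Cusps

/-! ### Hecke operators acting on the constant terms -/

section HeckeCusps

open Filter
open scoped Topology

/-- Multiplying on the left by `Γ₀(N)` one can make a matrix congruent to the identity modulo a prime
not dividing `N`, without changing its bottom row modulo `N`. -/
lemma exists_congr_one {N a b c d : ℤ} {p : ℕ} (hp : p.Prime) (hpN : IsCoprime (p : ℤ) N)
    (h : a * d - b * c = 1) :
    ∃ a' b' c' d' : ℤ, a' * d' - b' * c' = 1 ∧ N ∣ c' - c ∧ N ∣ d' - d ∧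
      (p : ℤ) ∣ a' - 1 ∧ (p : ℤ) ∣ b' ∧ (p : ℤ) ∣ c' ∧ (p : ℤ) ∣ d' - 1 := by
  have hpZ : Prime (p : ℤ) := Nat.prime_iff_prime_int.1 hp
  -- If `p ∣ c` then `p ∤ a`, and adding `N` times the first row to the second makes `c` prime to
  -- `p`.
  wlog hc : ¬ (p : ℤ) ∣ c generalizing c d
  · have hc : (p : ℤ) ∣ c := not_not.1 hc
    have ha : ¬ (p : ℤ) ∣ a := fun ha =>
      hpZ.not_dvd_one (h ▸ dvd_sub (ha.mul_right d) (hc.mul_left b))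
    obtain ⟨a', b', c', d', h1, h2, h3, h4⟩ := this (c := c + N * a) (d := d + N * b)
      (by linear_combination h) (fun hca => by
        have h5 : (p : ℤ) ∣ N * a := (dvd_add_right hc).1 hca
        exact ha (hpN.dvd_of_dvd_mul_left h5))
    refine ⟨a', b', c', d', h1, ?_, ?_, h4⟩
    · have := dvd_add h2 (dvd_mul_right N a)
      ring_nf at this ⊢
      exact this
    · have := dvd_add h3 (dvd_mul_right N b)
      ring_nf at this ⊢
      exact this
  obtain ⟨w, v, hv⟩ := (hpZ.coprime_iff_not_dvd).2 hc
  obtain ⟨u', u, hu⟩ := hpN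
  -- Modulo `p`, `v` inverts `c` and `u` inverts `N`. Three row operations follow: the first makes
  -- the corner congruent to 1, the second, with a multiple of `N`, clears `c`, and the third clears
  -- `b`.
  obtain ⟨a₂, ha₂⟩ : ∃ a₂, a₂ = a + (1 - a) * v * c := ⟨_, rfl⟩
  obtain ⟨b₂, hb₂⟩ : ∃ b₂, b₂ = b + (1 - a) * v * d := ⟨_, rfl⟩
  obtain ⟨c₃, hc₃⟩ : ∃ c₃, c₃ = c - u * c * N * a₂ := ⟨_, rfl⟩
  obtain ⟨d₃, hd₃⟩ : ∃ d₃, d₃ = d - u * c * N * b₂ := ⟨_, rfl⟩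
  have hdet : a₂ * d₃ - b₂ * c₃ = 1 := by rw [hc₃, hd₃, ha₂, hb₂]; linear_combination h
  have h1 : (p : ℤ) ∣ a₂ - 1 := ⟨(a - 1) * w, by rw [ha₂]; linear_combination (1 - a) * hv⟩
  have h2 : (p : ℤ) ∣ c₃ := by
    have : c₃ = p * (c * u') - (u * c * N) * (a₂ - 1) := by rw [hc₃]; linear_combination -c * hu
    rw [this]
    exact dvd_sub (dvd_mul_right _ _) (h1.mul_left _)
  have h3 : (p : ℤ) ∣ d₃ - 1 := by
    have : d₃ - 1 = b₂ * c₃ - d₃ * (a₂ - 1) := by linear_combination hdet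
    rw [this]
    exact dvd_sub (h2.mul_left _) (h1.mul_left _)
  refine ⟨a₂ - b₂ * c₃, b₂ - b₂ * d₃, c₃, d₃, by linear_combination hdet, ⟨-(u * c * a₂), by rw [hc₃]; ring⟩,
    ⟨-(u * c * b₂), by rw [hd₃]; ring⟩, ?_, ?_, h2, h3⟩
  · rw [show a₂ - b₂ * c₃ - 1 = (a₂ - 1) - b₂ * c₃ by ring]
    exact dvd_sub h1 (h2.mul_left _)
  · rw [show b₂ - b₂ * d₃ = -b₂ * (d₃ - 1) by ring]
    exact h3.mul_left _

variable {m : ℤ} {f : ℍ → ℂ} {N : ℤ} {p : ℕ} {l : ℂ}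

/-- Because `γ ≡ 1` modulo `p`, each Hecke representative moves past it: `[1, j; 0, p] γ = γ_j [1,
j; 0, p]` with `γ_j` integral of determinant 1, and similarly for `[p, 0; 0, 1]`. The condition `ht`
puts all the new cusps in the class of `(σ c : d)`, where the limit is `L'`. The `p` upper
triangular terms contribute `p^(-m)` each and the last one `p^m`. -/
lemma hecke_relation_at_cusp_of_congr_one
    (hinv : ∀ a b c d : ℤ, a * d - b * c = 1 → N ∣ c → act m !![a, b; c, d] f = f)
    (hp : p.Prime) (hpN : IsCoprime (p : ℤ) N)
    (hT : ∑ j ∈ Finset.range p, act m !![1, (j : ℤ); 0, (p : ℤ)] f + act m !![(p : ℤ), 0; 0, 1] f = l • f)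
    {a b c d σ t : ℤ} (h : a * d - b * c = 1) (ha : (p : ℤ) ∣ a - 1) (hb : (p : ℤ) ∣ b) (hc : (p : ℤ) ∣ c)
    (hd : (p : ℤ) ∣ d - 1) (hσ : σ * σ = 1) (ht : N ∣ c * ((p - σ) * d + t * c)) {L L' : ℂ}
    (hL : Tendsto (act m !![a, b; c, d] f) atImInfty (𝓝 L))
    (hL' : Tendsto (act m !![a, σ * b; σ * c, d] f) atImInfty (𝓝 L')) :
    l * L = ((p : ℂ) ^ (1 - m) + (p : ℂ) ^ m) * L' := by
  have hp0 : (p : ℂ) ≠ 0 := mod_cast hp.ne_zero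
  have hpZ : 0 < (p : ℤ) := mod_cast hp.pos
  have hdet : 0 < (!![a, b; c, d] : Matrix (Fin 2) (Fin 2) ℤ).det := by simp [h]
  have hσdet : a * d - σ * b * (σ * c) = 1 := by linear_combination h - b * c * hσ
  obtain ⟨v, u, hu⟩ := hpN
  have hT' := congrArg (act m !![a, b; c, d]) hT
  rw [map_add, map_sum, map_smul] at hT'
  have lim1 (j : ℕ) : Tendsto (act m !![a, b; c, d] (act m !![1, (j : ℤ); 0, (p : ℤ)] f)) atImInfty
      (𝓝 ((p : ℂ) ^ (-m) * L')) := by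
    obtain ⟨w, hw⟩ : (p : ℤ) ∣ b + j * (d - a) - j ^ 2 * c := by
      rw [show b + j * (d - a) - j ^ 2 * c = b + j * ((d - 1) - (a - 1)) - j ^ 2 * c by ring]
      exact dvd_sub (dvd_add hb ((dvd_sub hd ha).mul_left _)) (hc.mul_left _)
    have hdet' : (a + j * c) * (d - j * c) - w * (p * c) = 1 := by linear_combination h + c * hw
    have hconj : !![1, (j : ℤ); 0, (p : ℤ)] * !![a, b; c, d] =
        !![a + j * c, w; p * c, d - j * c] * !![1, (j : ℤ); 0, (p : ℤ)] := by
      ext i k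
      fin_cases i <;> fin_cases k <;> simp [Matrix.mul_apply, Fin.sum_univ_two]
      · linear_combination hw
      · ring
    rw [act_act m (by simpa using hpZ) hdet, hconj, ← act_act m (by simp [hdet']) (by simpa using hpZ)]
    -- Here `v` inverts `p` modulo `N`; this translation makes the bottom rows `(p c, d - j c)` and
    -- `(σ c, d)` proportional modulo `N`.
    have hlim := tendsto_act_of_dvd hinv hσdet hdet' (v * (j - σ * t)) ?_ hL'
    · have := tendsto_act_upper hlim m (a := 1) (b := j) (d := p) (by simpa using hpZ)
      convert this using 2
      push_cast
      rw [one_mul, ← zpow_add₀ hp0]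
      congr 2
      ring
    · have : p * c * d - (d - j * c + v * (j - σ * t) * (p * c)) * (σ * c) =
          c * ((p - σ) * d + t * c) + N * (u * σ * c ^ 2 * (j - σ * t)) := by
        linear_combination (-σ * c ^ 2 * (j - σ * t)) * hu + t * c ^ 2 * hσ
      rw [this]
      exact dvd_add ht (dvd_mul_right _ _)
  have lim2 : Tendsto (act m !![a, b; c, d] (act m !![(p : ℤ), 0; 0, 1] f)) atImInfty
      (𝓝 ((p : ℂ) ^ m * L')) := by
    obtain ⟨c₀, rfl⟩ := hc
    have hdet' : a * d - p * b * c₀ = 1 := by linear_combination h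
    have hconj : !![(p : ℤ), 0; 0, 1] * !![a, b; p * c₀, d] =
        !![a, p * b; c₀, d] * !![(p : ℤ), 0; 0, 1] := by
      ext i k
      fin_cases i <;> fin_cases k <;> simp [Matrix.mul_apply, Fin.sum_univ_two, mul_comm]
    rw [act_act m (by simpa using hpZ) hdet, hconj, ← act_act m (by simp [hdet']) (by simpa using hpZ)]
    have hlim := tendsto_act_of_dvd hinv hσdet hdet' t ?_ hL'
    · have := tendsto_act_upper hlim m (a := p) (b := 0) (d := 1) (by simpa using hpZ)
      simpa using this
    · have hNp : IsCoprime N (p : ℤ) := ⟨u, v, by linear_combination hu⟩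
      have h1 : N ∣ c₀ * ((p - σ) * d + t * (p * c₀)) := by
        refine hNp.dvd_of_dvd_mul_left (y := (p : ℤ)) ?_
        rwa [← mul_assoc]
      have h2 := h1.mul_left (-σ)
      rwa [show c₀ * d - (d + t * c₀) * (σ * (p * c₀)) = -σ * (c₀ * ((p - σ) * d + t * (p * c₀))) by
        linear_combination -c₀ * d * hσ]
  have lim3 := (tendsto_finsetSum (Finset.range p) fun j _ => lim1 j).add lim2
  have e : (fun z => ∑ j ∈ Finset.range p, act m !![a, b; c, d] (act m !![1, (j : ℤ); 0, (p : ℤ)] f) z +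
      act m !![a, b; c, d] (act m !![(p : ℤ), 0; 0, 1] f) z) = l • act m !![a, b; c, d] f := by
    rw [← hT']
    ext z
    simp
  rw [e] at lim3
  have := tendsto_nhds_unique (hL.const_smul l) lim3
  rw [smul_eq_mul] at this
  rw [this, Finset.sum_const, Finset.card_range, nsmul_eq_mul, sub_eq_add_neg, zpow_add₀ hp0, zpow_one]
  ring

/-- The action of the Hecke operator at `p` on the constant terms at the cusps. -/
theorem hecke_relation_at_cusp
    (hinv : ∀ a b c d : ℤ, a * d - b * c = 1 → N ∣ c → act m !![a, b; c, d] f = f)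
    (hp : p.Prime) (hpN : IsCoprime (p : ℤ) N)
    (hT : ∑ j ∈ Finset.range p, act m !![1, (j : ℤ); 0, (p : ℤ)] f + act m !![(p : ℤ), 0; 0, 1] f = l • f)
    {a b c d σ t : ℤ} (h : a * d - b * c = 1) (hσ : σ * σ = 1) (ht : N ∣ c * ((p - σ) * d + t * c))
    {L L' : ℂ} (hL : Tendsto (act m !![a, b; c, d] f) atImInfty (𝓝 L))
    (hL' : Tendsto (act m !![a, σ * b; σ * c, d] f) atImInfty (𝓝 L')) :
    l * L = ((p : ℂ) ^ (1 - m) + (p : ℂ) ^ m) * L' := by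
  obtain ⟨a', b', c', d', h', hc', hd', h1, h2, h3, h4⟩ := exists_congr_one hp hpN h
  have hσdet : a * d - σ * b * (σ * c) = 1 := by linear_combination h - b * c * hσ
  have hσdet' : a' * d' - σ * b' * (σ * c') = 1 := by linear_combination h' - b' * c' * hσ
  obtain ⟨x, hx⟩ := hc'
  obtain ⟨y, hy⟩ := hd'
  have hdvd : N ∣ c' * d - d' * c := ⟨x * d - y * c, by linear_combination d * hx - c * hy⟩
  refine hecke_relation_at_cusp_of_congr_one hinv hp hpN hT h' h1 h2 h3 h4 hσ ?_
    (tendsto_act_of_dvd hinv h h' 0 (by simpa using hdvd) hL)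
    (tendsto_act_of_dvd hinv hσdet hσdet' 0 (by
      rw [show σ * c' * d - (d' + 0 * (σ * c')) * (σ * c) = σ * (c' * d - d' * c) by ring]
      exact hdvd.mul_left σ) hL') (t := t)
  have e1 : c' ≡ c [ZMOD N] := (Int.modEq_iff_dvd.2 ⟨x, hx⟩).symm
  have e2 : d' ≡ d [ZMOD N] := (Int.modEq_iff_dvd.2 ⟨y, hy⟩).symm
  rw [← Int.modEq_zero_iff_dvd] at ht ⊢
  exact (e1.mul (((Int.ModEq.refl _).mul e2).add ((Int.ModEq.refl _).mul e1))).trans ht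

end HeckeCusps

/-! ### Excluding Eisenstein series -/

lemma IsEBV.apply_zero {a : ℕ → ℂ} {F Λ : ℂ → ℂ} (h : IsEBV a F Λ) : F 0 = 0 := by
  have h1 : Filter.Tendsto (fun s => (Gamma s)⁻¹ * Λ s) (nhdsWithin 0 {0}ᶜ) (nhds ((Gamma 0)⁻¹ * Λ 0)) :=
    ((differentiable_one_div_Gamma.continuous.mul h.entire_completed.continuous).tendsto 0).mono_left
      nhdsWithin_le_nhds
  have h2 : Filter.Tendsto F (nhdsWithin 0 {0}ᶜ) (nhds (F 0)) :=
    (h.entire.continuous.tendsto 0).mono_left nhdsWithin_le_nhds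
  have h3 : (fun s => (Gamma s)⁻¹ * Λ s) =ᶠ[nhdsWithin 0 {0}ᶜ] F := by
    filter_upwards [self_mem_nhdsWithin, mem_nhdsWithin_of_mem_nhds (Metric.ball_mem_nhds (0 : ℂ) one_pos)]
      with s hs0 hs1
    have hs (n : ℕ) : s ≠ -(n : ℂ) := by
      rintro rfl
      rw [mem_ball_zero_iff, norm_neg, Complex.norm_natCast] at hs1
      have : n = 0 := by
        have : n < 1 := by exact_mod_cast hs1
        omega
      exact hs0 (by simp [this])
    rw [h.completed_eq s hs, inv_mul_cancel_left₀ (Gamma_ne_zero hs)]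
  have := tendsto_nhds_unique (h1.congr' h3) h2
  -- `Gamma 0` has the default value 0, so its inverse is 0, which is also the true value of `1 / Γ`
  -- at the pole.
  rw [← this, Complex.Gamma_zero, _root_.inv_zero, zero_mul]

open scoped ComplexOrder in
/-- The Dirichlet series of an Eisenstein series does not satisfy EBV. -/
lemma IsEBV.false_of_eisenstein {a : ℕ → ℂ} {F Λ : ℂ → ℂ} {N : ℕ} {k : ℤ} (h : IsEBV a F Λ) (ha0 : a 0 = 0)
    (hEP : HasEulerProduct a F N k)
    (ha : ∀ p : ℕ, p.Prime → ¬ p ∣ N → a p = 1 + (p : ℂ) ^ (k - 1)) : False := by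
  have hae : a = eulerCoeff (eulerLinear a N k) (eulerQuadratic N k) := by
    ext n
    rcases eq_or_ne n 0 with rfl | hn
    · simp [ha0, eulerCoeff]
    · exact h.eq_eulerCoeff hEP hn
  have hpow (p : ℕ) (r : ℤ) : 0 ≤ (p : ℂ) ^ r := by
    have : (0 : ℝ) ≤ (p : ℝ) ^ r := by positivity
    rw [show (p : ℂ) ^ r = (((p : ℝ) ^ r : ℝ) : ℂ) by push_cast; rfl]
    exact Complex.zero_le_real.2 this
  have hnonneg : 0 ≤ a := fun n => by
    rw [hae]
    refine eulerCoeff_nonneg _ _ (fun p hp => ?_) (fun p hp => ?_) n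
    · by_cases hpN : p ∣ N
      · refine .inr ⟨by rw [eulerQuadratic, if_pos hpN], ?_⟩
        rw [eulerLinear, if_pos hpN]
        split_ifs
        · exact le_rfl
        · have h1 : (p : ℂ) ^ ((k : ℂ) / 2 - 1) = (((p : ℝ) ^ ((k : ℝ) / 2 - 1) : ℝ) : ℂ) := by
            rw [Complex.ofReal_cpow (by positivity)]
            push_cast
            rfl
          rw [h1]
          exact Complex.zero_le_real.2 (by positivity)
      · have hp2 : ¬ p ^ 2 ∣ N := fun h2 => hpN ((dvd_pow_self p two_ne_zero).trans h2)
        left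
        rw [eulerLinear, if_neg hp2, if_neg hpN, eulerQuadratic, if_neg hpN, ha p hp hpN]
    · rw [eulerQuadratic]
      split_ifs
      · exact le_rfl
      · exact hpow p _
  have h1 : 0 < a 1 := by rw [hae, eulerCoeff_one]; exact one_pos
  obtain ⟨σ, hσ⟩ := h.hasSum
  have hx : LSeries.abscissaOfAbsConv a ≤ σ :=
    LSeries.abscissaOfAbsConv_le_of_forall_lt_LSeriesSummable fun y hy =>
      (hσ y (by simpa using hy)).LSeriesSummable
  -- Landau: non-negative coefficients and an entire continuation make the series positive on the
  -- whole real line, in particular at 0.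
  have := LSeries.positive_of_differentiable_of_eqOn hnonneg h1 h.entire hx
    (fun s hs => (hσ s hs).LSeries_eq.symm) 0
  rw [ofReal_zero, h.apply_zero] at this
  exact lt_irrefl _ this

/-- At `s = k` the term at a prime `p ∤ N` has norm at least `1 / p`, and the sum of the reciprocals
of the primes diverges. -/
lemma not_lSeriesSummable_of_norm_eq {a : ℕ → ℂ} {N : ℕ} (hN : N ≠ 0) {k : ℤ}
    (ha : ∀ p : ℕ, p.Prime → ¬ p ∣ N → ‖a p‖ = 1 + (p : ℝ) ^ (k - 1)) : ¬ LSeriesSummable a k := by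
  intro h
  refine Nat.Primes.not_summable_one_div ?_
  have h1 : Summable fun p : Nat.Primes => ‖LSeries.term a k p‖ :=
    h.norm.comp_injective Subtype.val_injective
  have hfin : {p : Nat.Primes | (p : ℕ) ∣ N}.Finite := by
    refine Set.Finite.of_finite_image (f := Subtype.val) ?_ Subtype.val_injective.injOn
    refine N.divisors.finite_toSet.subset ?_
    rintro _ ⟨p, hp, rfl⟩
    simpa [hN] using hp
  refine Summable.of_norm_bounded_eventually h1 ?_
  filter_upwards [hfin.compl_mem_cofinite] with p hp
  have hp0 : 0 < (p : ℝ) := mod_cast p.2.pos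
  have e : ‖LSeries.term a k p‖ = (1 + (p : ℝ) ^ (k - 1)) / (p : ℝ) ^ k := by
    rw [LSeries.term_of_ne_zero p.2.ne_zero, norm_div, ha p p.2 hp, Complex.cpow_intCast, norm_zpow,
      Complex.norm_natCast]
  rw [e, Real.norm_of_nonneg (by positivity), zpow_sub_one₀ hp0.ne', le_div_iff₀ (by positivity), one_div,
    mul_comm]
  linarith

/-! ### Hecke relations attached to the Euler product -/

section Relations

variable {a : ℕ → ℂ} {F Λ : ℂ → ℂ} {N : ℕ} {m : ℤ} {C : ℝ} {K : ℕ} {p : ℕ}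

lemma sum_act_hecke_of_eulerProduct (hC : 0 ≤ C) (ha : ∀ n, ‖a n‖ ≤ C * (n : ℝ) ^ K) (ha0 : a 0 = 0)
    (h : IsEBV a F Λ) (hEP : HasEulerProduct a F N (2 * m)) (hp : p.Prime) :
    ∑ j ∈ Finset.range p, act m !![1, (j : ℤ); 0, (p : ℤ)] (qSeries a) +
      ((p : ℂ) ^ (1 - 2 * m) * eulerQuadratic N (2 * m) p) • act m !![(p : ℤ), 0; 0, 1] (qSeries a) =
      ((p : ℂ) ^ (1 - m) * eulerLinear a N (2 * m) p) • qSeries a := by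
  refine sum_act_hecke_qSeries hC ha m hp fun n => ?_
  rcases eq_or_ne n 0 with rfl | hn
  · simp [ha0]
  rw [h.eq_eulerCoeff hEP (mul_ne_zero hp.ne_zero hn), eulerCoeff_prime_mul _ _ hp hn, h.eq_eulerCoeff hEP hn]
  split_ifs with hpn
  · rw [h.eq_eulerCoeff hEP (Nat.div_pos (Nat.le_of_dvd (Nat.pos_of_ne_zero hn) hpn) hp.pos).ne']
  · rfl

lemma sum_act_hecke_of_not_dvd (hC : 0 ≤ C) (ha : ∀ n, ‖a n‖ ≤ C * (n : ℝ) ^ K) (ha0 : a 0 = 0)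
    (h : IsEBV a F Λ) (hEP : HasEulerProduct a F N (2 * m)) (hp : p.Prime) (hpN : ¬ p ∣ N) :
    ∑ j ∈ Finset.range p, act m !![1, (j : ℤ); 0, (p : ℤ)] (qSeries a) +
      act m !![(p : ℤ), 0; 0, 1] (qSeries a) = ((p : ℂ) ^ (1 - m) * a p) • qSeries a := by
  have hp0 : (p : ℂ) ≠ 0 := mod_cast hp.ne_zero
  have hp2 : ¬ p ^ 2 ∣ N := fun h2 => hpN ((dvd_pow_self p two_ne_zero).trans h2)
  have key := sum_act_hecke_of_eulerProduct hC ha ha0 h hEP hp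
  rw [eulerQuadratic, if_neg hpN, eulerLinear, if_neg hp2, if_neg hpN, ← zpow_add₀ hp0] at key
  simpa using key

/-- The prescribed local coefficient `p^(k/2 - 1) = p^(m - 1)` exactly cancels the normalising
factor `p^(1 - m)`. -/
lemma sum_act_hecke_of_dvd (hC : 0 ≤ C) (ha : ∀ n, ‖a n‖ ≤ C * (n : ℝ) ^ K) (ha0 : a 0 = 0)
    (h : IsEBV a F Λ) (hEP : HasEulerProduct a F N (2 * m)) (hp : p.Prime) (hpN : p ∣ N)
    (hp2 : ¬ p ^ 2 ∣ N) :
    ∑ j ∈ Finset.range p, act m !![1, (j : ℤ); 0, (p : ℤ)] (qSeries a) = qSeries a := by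
  have hp0 : (p : ℂ) ≠ 0 := mod_cast hp.ne_zero
  have key := sum_act_hecke_of_eulerProduct hC ha ha0 h hEP hp
  rw [eulerQuadratic, if_pos hpN, eulerLinear, if_neg hp2, if_pos hpN,
    show (((2 * m : ℤ) : ℂ) / 2 - 1) = ((m - 1 : ℤ) : ℂ) by push_cast; ring, Complex.cpow_intCast,
    ← zpow_add₀ hp0] at key
  simpa using key

lemma sum_act_hecke_of_sq_dvd (hC : 0 ≤ C) (ha : ∀ n, ‖a n‖ ≤ C * (n : ℝ) ^ K) (ha0 : a 0 = 0)
    (h : IsEBV a F Λ) (hEP : HasEulerProduct a F N (2 * m)) (hp : p.Prime) (hp2 : p ^ 2 ∣ N) :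
    ∑ j ∈ Finset.range p, act m !![1, (j : ℤ); 0, (p : ℤ)] (qSeries a) = 0 := by
  have key := sum_act_hecke_of_eulerProduct hC ha ha0 h hEP hp
  rw [eulerQuadratic, if_pos ((dvd_pow_self p two_ne_zero).trans hp2), eulerLinear, if_pos hp2] at key
  simpa using key

end Relations

/-! ### Vanishing of the constant terms -/

section Vanishing

open Filter
open scoped Topology

variable {a : ℕ → ℂ} {F Λ : ℂ → ℂ} {N : ℕ} {m : ℤ}

lemma eq_of_hecke_eq {p : ℕ} (hp : p.Prime) {x u L : ℂ} (hL : L ≠ 0)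
    (h : (p : ℂ) ^ (1 - m) * x * L = ((p : ℂ) ^ (1 - m) + (p : ℂ) ^ m) * (u * L)) :
    x = u * (1 + (p : ℂ) ^ (2 * m - 1)) := by
  have hp0 : (p : ℂ) ≠ 0 := mod_cast hp.ne_zero
  have h1 : (p : ℂ) ^ m = (p : ℂ) ^ (1 - m) * (p : ℂ) ^ (2 * m - 1) := by
    rw [← zpow_add₀ hp0]; congr 1; ring
  have h2 : (p : ℂ) ^ (1 - m) * L ≠ 0 := mul_ne_zero (zpow_ne_zero _ hp0) hL
  rw [h1] at h
  apply mul_left_cancel₀ h2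
  linear_combination h

/-- With `c² x ≡ w c` modulo `N` and `p - 1 = w r`, the choice `t = -x r d` satisfies the condition
of `hecke_relation_at_cusp` for `σ = 1`: each `T_p` preserves the class of the cusp. A nonzero limit
cancels and leaves `a_p = 1 + p^(k-1)`. -/
lemma limit_eq_zero_of_dvd (hE : IsEBV a F Λ) (ha0 : a 0 = 0) (hEP : HasEulerProduct a F N (2 * m))
    (hinv : ∀ a' b c d : ℤ, a' * d - b * c = 1 → (N : ℤ) ∣ c → act m !![a', b; c, d] (qSeries a) = qSeries a)
    (hT : ∀ p : ℕ, p.Prime → ¬ p ∣ N → ∑ j ∈ Finset.range p, act m !![1, (j : ℤ); 0, (p : ℤ)] (qSeries a) +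
      act m !![(p : ℤ), 0; 0, 1] (qSeries a) = ((p : ℂ) ^ (1 - m) * a p) • qSeries a)
    {α b c d : ℤ} (h : α * d - b * c = 1)
    (hc : ∀ p : ℕ, p.Prime → ¬ p ∣ N → ∃ x w : ℤ, (N : ℤ) ∣ c * c * x - w * c ∧ w ∣ p - 1) {L : ℂ}
    (hL : Tendsto (act m !![α, b; c, d] (qSeries a)) atImInfty (𝓝 L)) : L = 0 := by
  by_contra hL0
  refine hE.false_of_eisenstein ha0 hEP fun p hp hpN => ?_
  obtain ⟨x, w, hx, r, hr⟩ := hc p hp hpN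
  have hcop : IsCoprime (p : ℤ) (N : ℤ) := Nat.isCoprime_iff_coprime.2 ((Nat.Prime.coprime_iff_not_dvd hp).2 hpN)
  have := hecke_relation_at_cusp hinv hp hcop (hT p hp hpN) h (σ := 1) (by norm_num) (t := -(x * r * d)) ?_ hL
    (by simpa using hL)
  · simpa using eq_of_hecke_eq hp (u := 1) hL0 (by simpa using this)
  · rw [show c * ((p - 1) * d + -(x * r * d) * c) = (c * c * x - w * c) * (-(r * d)) by
      rw [hr]; ring]
    exact hx.mul_right _

/-- The operator `T_p` fixes the cusps with bottom rows `(± q, 1)` when `p ≡ 1` modulo `q` and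
exchanges them when `p ≡ -1`; the Fricke involution gives `L₂ = ε L₁`. A nonzero `L₁` forces `a_p`
to be `1 + p^(k-1)` or `ε` times that. For `ε = 1` this is the Eisenstein case; for `ε = -1` only
the absolute values are used, against `hgrowth`. -/
lemma limits_eq_zero_of_sq {q : ℤ} (hq : q = 3 ∨ q = 4) (hNq : (N : ℤ) = q ^ 2) {ε : ℂ} (hε : ε = 1 ∨ ε = -1)
    (hE : IsEBV a F Λ) (ha0 : a 0 = 0) (hEP : HasEulerProduct a F N (2 * m))
    (hinv : ∀ a' b c d : ℤ, a' * d - b * c = 1 → (N : ℤ) ∣ c → act m !![a', b; c, d] (qSeries a) = qSeries a)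
    (hH : act m !![0, -1; (N : ℤ), 0] (qSeries a) = ε • qSeries a)
    (hT : ∀ p : ℕ, p.Prime → ¬ p ∣ N → ∑ j ∈ Finset.range p, act m !![1, (j : ℤ); 0, (p : ℤ)] (qSeries a) +
      act m !![(p : ℤ), 0; 0, 1] (qSeries a) = ((p : ℂ) ^ (1 - m) * a p) • qSeries a)
    (hgrowth : ε = -1 → LSeriesSummable a ((2 * m : ℤ) : ℂ)) {L₁ L₂ : ℂ}
    (hL₁ : Tendsto (act m !![1, 0; q, 1] (qSeries a)) atImInfty (𝓝 L₁))
    (hL₂ : Tendsto (act m !![1, 0; -q, 1] (qSeries a)) atImInfty (𝓝 L₂)) : L₁ = 0 ∧ L₂ = 0 := by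
  have hq0 : 0 < q := by rcases hq with rfl | rfl <;> norm_num
  have hqC : (q : ℂ) ≠ 0 := mod_cast hq0.ne'
  have hrel : ε * L₁ = L₂ := by
    have h1 := congrArg (act m !![1, 0; q, 1]) hH
    have h2 : act m !![1, 0; q, 1] (act m !![0, -1; (N : ℤ), 0] (qSeries a)) =
        act m !![q, 1; 0, q] (act m !![1, 0; -q, 1] (qSeries a)) := by
      rw [act_act m (by simp [hNq]; positivity) (by simp), act_act m (by simp) (by simp; positivity),
        ← act_smul_matrix m (A := !![1, 0; -q, 1] * !![q, 1; 0, q]) (c := -1) (by norm_num)]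
      congr 2
      ext i j
      fin_cases i <;> fin_cases j <;> simp [Matrix.mul_apply, Fin.sum_univ_two, hNq]
      ring
    rw [h2, map_smul] at h1
    have h3 := tendsto_act_upper hL₂ m (a := q) (b := 1) (d := q) (by positivity)
    rw [h1] at h3
    rw [← smul_eq_mul, tendsto_nhds_unique (hL₁.const_smul ε) h3]
    push_cast
    rw [mul_zpow, ← zpow_add₀ hqC, ← zpow_add₀ hqC]
    simp [two_mul]
  have hL : L₁ = 0 := by
    by_contra hL0
    have key (p : ℕ) (hp : p.Prime) (hpN : ¬ p ∣ N) :
        a p = 1 * (1 + (p : ℂ) ^ (2 * m - 1)) ∨ a p = ε * (1 + (p : ℂ) ^ (2 * m - 1)) := by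
      have hcop : IsCoprime (p : ℤ) (N : ℤ) := Nat.isCoprime_iff_coprime.2 ((Nat.Prime.coprime_iff_not_dvd hp).2 hpN)
      have hcases : q ∣ p - 1 ∨ q ∣ p + 1 := by
        rcases hq with rfl | rfl
        · have : ¬ (3 ∣ p) := fun h3 => by
            obtain rfl := (Nat.prime_dvd_prime_iff_eq Nat.prime_three hp).1 h3
            omega
          omega
        · have : ¬ (2 ∣ p) := fun h2 => by
            obtain rfl := (Nat.prime_dvd_prime_iff_eq Nat.prime_two hp).1 h2
            omega
          omega
      rcases hcases with ⟨r, hr⟩ | ⟨r, hr⟩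
      · left
        refine eq_of_hecke_eq hp hL0 ?_
        have := hecke_relation_at_cusp hinv hp hcop (hT p hp hpN) (a := 1) (b := 0) (c := q) (d := 1) (by norm_num)
          (σ := 1) (by norm_num) (t := -r) ⟨0, by rw [hr]; ring⟩ hL₁ (by simpa using hL₁)
        simpa using this
      · right
        refine eq_of_hecke_eq hp hL0 ?_
        rw [hrel]
        exact hecke_relation_at_cusp hinv hp hcop (hT p hp hpN) (a := 1) (b := 0) (c := q) (d := 1) (by norm_num)
          (σ := -1) (by norm_num) (t := -r) ⟨0, by rw [sub_neg_eq_add, hr]; ring⟩ hL₁ (by simpa using hL₂)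
    rcases hε with rfl | rfl
    · exact hE.false_of_eisenstein ha0 hEP fun p hp hpN => by simpa using key p hp hpN
    · have hN0 : N ≠ 0 := by rcases hq with rfl | rfl <;> omega
      refine not_lSeriesSummable_of_norm_eq hN0 (fun p hp hpN => ?_) (hgrowth rfl)
      have hn : ‖1 + (p : ℂ) ^ (2 * m - 1)‖ = 1 + (p : ℝ) ^ (2 * m - 1) := by
        rw [show 1 + (p : ℂ) ^ (2 * m - 1) = ((1 + (p : ℝ) ^ (2 * m - 1) : ℝ) : ℂ) by push_cast; rfl,
          Complex.norm_real, Real.norm_of_nonneg (by positivity)]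
      rcases key p hp hpN with h | h <;> rw [h, norm_mul, hn] <;> simp
  exact ⟨hL, by rw [← hrel, hL, mul_zero]⟩

end Vanishing

/-! ### Assembling the cusp form -/

lemma exists_dvd_of_zmod {N : ℕ} [NeZero N] {c w : ℤ} (h : ∃ x : ZMod N, (c : ZMod N) * c * x = w * c) :
    ∃ x : ℤ, (N : ℤ) ∣ c * c * x - w * c := by
  obtain ⟨x, hx⟩ := h
  obtain ⟨x, rfl⟩ := ZMod.intCast_surjective x
  refine ⟨x, ?_⟩
  rw [← ZMod.intCast_zmod_eq_zero_iff_dvd]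
  push_cast
  rw [hx, sub_self]

/-- For squarefree `N` every `c` satisfies `c² x = c` in `ZMod N` for some `x`, so `w = 1`. For `N =
8, 12` one can solve `c² x = 2 c`, and `w = 2` divides `p - 1` because `p` is odd. -/
lemma exists_dvd_of_level {N : ℕ} (hN : (5 ≤ N ∧ N ≤ 12) ∨ (14 ≤ N ∧ N ≤ 17) ∨ N = 23) (h9 : N ≠ 9)
    (h16 : N ≠ 16) (c : ℤ) {p : ℕ} (hp : p.Prime) (hpN : ¬ p ∣ N) :
    ∃ x w : ℤ, (N : ℤ) ∣ c * c * x - w * c ∧ w ∣ p - 1 := by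
  have hN' : N = 5 ∨ N = 6 ∨ N = 7 ∨ N = 10 ∨ N = 11 ∨ N = 14 ∨ N = 15 ∨ N = 17 ∨ N = 23 ∨ N = 8 ∨ N = 12 := by omega
  have h1 (M : ℕ) [NeZero M] (h : ∀ c : ZMod M, ∃ x, c * c * x = c) :
      ∃ x w : ℤ, (M : ℤ) ∣ c * c * x - w * c ∧ w ∣ p - 1 := by
    obtain ⟨x, hx⟩ := exists_dvd_of_zmod (N := M) (c := c) (w := 1) (by simpa using h c)
    exact ⟨x, 1, hx, one_dvd _⟩
  have h2 (M : ℕ) [NeZero M] (h : ∀ c : ZMod M, ∃ x, c * c * x = 2 * c) (hpM : ¬ p ∣ M) (hM : 2 ∣ M) :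
      ∃ x w : ℤ, (M : ℤ) ∣ c * c * x - w * c ∧ w ∣ p - 1 := by
    obtain ⟨x, hx⟩ := exists_dvd_of_zmod (N := M) (c := c) (w := 2) (by simpa using h c)
    refine ⟨x, 2, hx, ?_⟩
    rcases hp.eq_two_or_odd with rfl | hp2
    · exact absurd hM hpM
    · omega
  rcases hN' with rfl | rfl | rfl | rfl | rfl | rfl | rfl | rfl | rfl | rfl | rfl
  · exact h1 5 (by decide)
  · exact h1 6 (by decide)
  · exact h1 7 (by decide)
  · exact h1 10 (by decide)
  · exact h1 11 (by decide)
  · exact h1 14 (by decide)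
  · exact h1 15 (by decide)
  · exact h1 17 (by decide)
  · exact h1 23 (by decide)
  · exact h2 8 (by decide) hpN (by norm_num)
  · exact h2 12 (by decide) hpN (by norm_num)

lemma act_eq_of_level {N : ℕ} (hN : (5 ≤ N ∧ N ≤ 12) ∨ (14 ≤ N ∧ N ≤ 17) ∨ N = 23) {m : ℤ} (hm : 0 < m)
    {ε : ℂ} (hε : ε ^ 2 = 1) {a : ℕ → ℂ} {F Λ : ℂ → ℂ} {C : ℝ} {K : ℕ} (hC : 0 ≤ C)
    (ha : ∀ n, ‖a n‖ ≤ C * (n : ℝ) ^ K) (ha0 : a 0 = 0) (hE : IsEBV a F Λ)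
    (hEP : HasEulerProduct a F N (2 * m)) (hH : act m !![0, -1; (N : ℤ), 0] (qSeries a) = ε • qSeries a)
    (α b c d : ℤ) (hdet : α * d - b * c = 1) (hc : (N : ℤ) ∣ c) :
    act m !![α, b; c, d] (qSeries a) = qSeries a := by
  have hf := mdifferentiable_qSeries hC ha
  have hT := act_qSeries_translation (a := a) m
  have g2 (h : ¬ 2 ∣ N) := by
    simpa [Finset.sum_range_succ] using sum_act_hecke_of_not_dvd hC ha ha0 hE hEP Nat.prime_two h
  have g3 (h : ¬ 3 ∣ N) := by
    simpa [Finset.sum_range_succ] using sum_act_hecke_of_not_dvd hC ha ha0 hE hEP Nat.prime_three h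
  have s2 (h : 2 ∣ N) (h' : ¬ 2 ^ 2 ∣ N) := by
    simpa [Finset.sum_range_succ] using sum_act_hecke_of_dvd hC ha ha0 hE hEP Nat.prime_two h h'
  have s3 (h : 3 ∣ N) (h' : ¬ 3 ^ 2 ∣ N) := by
    simpa [Finset.sum_range_succ] using sum_act_hecke_of_dvd hC ha ha0 hE hEP Nat.prime_three h h'
  have z2 (h : 2 ^ 2 ∣ N) := by
    simpa [Finset.sum_range_succ] using sum_act_hecke_of_sq_dvd hC ha ha0 hE hEP Nat.prime_two h
  have hN' : N = 5 ∨ N = 6 ∨ N = 7 ∨ N = 8 ∨ N = 9 ∨ N = 10 ∨ N = 11 ∨ N = 12 ∨ N = 14 ∨ N = 15 ∨ N = 16 ∨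
    N = 17 ∨ N = 23 := by omega
  rcases hN' with rfl | rfl | rfl | rfl | rfl | rfl | rfl | rfl | rfl | rfl | rfl | rfl | rfl
  · exact act_eq_of_level_five hε hT hH (g2 (by norm_num)) α b c d hdet hc
  · exact act_eq_of_level_six hε hT hH (s2 (by norm_num) (by norm_num)) α b c d hdet hc
  · exact act_eq_of_level_seven hε hT hH (g2 (by norm_num)) α b c d hdet hc
  · exact act_eq_of_level_eight hε hT hH (z2 (by norm_num)) α b c d hdet hc
  · exact act_eq_of_level_nine hε hT hH (g2 (by norm_num)) α b c d hdet hc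
  · exact act_eq_of_level_ten hε hT hH (s2 (by norm_num) (by norm_num)) α b c d hdet hc
  · exact act_eq_of_level_eleven hm hf hε hT hH (g2 (by norm_num)) (g3 (by norm_num)) α b c d hdet hc
  · exact act_eq_of_level_twelve hε hT hH (z2 (by norm_num)) α b c d hdet hc
  · exact act_eq_of_level_fourteen hm hf hε hT hH (s2 (by norm_num) (by norm_num)) (g3 (by norm_num)) α b c d hdet hc
  · exact act_eq_of_level_fifteen hm hf hε hT hH (g2 (by norm_num)) (s3 (by norm_num) (by norm_num)) α b c d hdet hc
  · exact act_eq_of_level_sixteen hε hT hH (z2 (by norm_num)) α b c d hdet hc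
  · exact act_eq_of_level_seventeen hm hf hε hT hH (g2 (by norm_num)) (g3 (by norm_num)) α b c d hdet hc
  · exact act_eq_of_level_twentythree hm hf hε hT hH (g2 (by norm_num)) (g3 (by norm_num)) α b c d hdet hc

open Filter in
open scoped Topology in
lemma tendsto_act_zero {N : ℕ} (hN : (5 ≤ N ∧ N ≤ 12) ∨ (14 ≤ N ∧ N ≤ 17) ∨ N = 23) {m : ℤ} (hm : 0 < m)
    {ε : ℂ} (hε : ε = 1 ∨ ε = -1) {a : ℕ → ℂ} {F Λ : ℂ → ℂ} {C : ℝ} {K : ℕ} (hC : 0 ≤ C)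
    (ha : ∀ n, ‖a n‖ ≤ C * (n : ℝ) ^ K) (ha0 : a 0 = 0) (hE : IsEBV a F Λ)
    (hEP : HasEulerProduct a F N (2 * m)) (hH : act m !![0, -1; (N : ℤ), 0] (qSeries a) = ε • qSeries a)
    (hinv : ∀ α b c d : ℤ, α * d - b * c = 1 → (N : ℤ) ∣ c → act m !![α, b; c, d] (qSeries a) = qSeries a)
    (hgrowth : (N = 9 ∨ N = 16) → ε = -1 → LSeriesSummable a ((2 * m : ℤ) : ℂ))
    {α b c d : ℤ} (hdet : α * d - b * c = 1) :
    Tendsto (act m !![α, b; c, d] (qSeries a)) atImInfty (𝓝 0) := by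
  have hT (p : ℕ) (hp : p.Prime) (hpN : ¬ p ∣ N) := sum_act_hecke_of_not_dvd hC ha ha0 hE hEP hp hpN
  have hN0 : 0 < (N : ℤ) := by omega
  have hex {α b c d : ℤ} (hdet : α * d - b * c = 1) :=
    exists_tendsto_act (mdifferentiable_qSeries hC ha) hN0 hinv hm (by positivity) (norm_qSeries_le hC ha) hdet
  obtain ⟨L, hL⟩ := hex hdet
  have hsq (q : ℤ) (hq : q = 3 ∨ q = 4) (hNq : (N : ℤ) = q ^ 2)
      (hcd : (N : ℤ) ∣ c - d * q ∨ (N : ℤ) ∣ c + d * q) : L = 0 := by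
    have hd1 : 1 * 1 - 0 * q = 1 := by ring
    have hd2 : 1 * 1 - 0 * (-q) = 1 := by ring
    obtain ⟨L₁, hL₁⟩ := hex hd1
    obtain ⟨L₂, hL₂⟩ := hex hd2
    obtain ⟨h1, h2⟩ := limits_eq_zero_of_sq hq hNq hε hE ha0 hEP hinv hH hT
      (hgrowth (by rcases hq with rfl | rfl <;> omega)) hL₁ hL₂
    rcases hcd with h | h
    · rw [← h1]
      exact tendsto_nhds_unique hL (tendsto_act_of_dvd hinv hd1 hdet 0 (by simpa using h) hL₁)
    · rw [← h2]
      exact tendsto_nhds_unique hL (tendsto_act_of_dvd hinv hd2 hdet 0 (by simpa using h) hL₂)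
  suffices L = 0 from this ▸ hL
  by_cases h9 : N = 9
  · subst h9
    -- Only `c ≡ 3, 6` escape the argument with `w = 1`. Then `d` is prime to 3, so `c ≡ ± 3 d` and
    -- the cusp is one of the exchanged pair. The case `N = 16` is analogous, with `w = 2` and `c ≡
    -- ± 4 d`.
    have hcases : (∃ x : ZMod 9, (c : ZMod 9) * c * x = c) ∨ (c : ZMod 9) = 3 ∨ (c : ZMod 9) = 6 := by
      generalize (c : ZMod 9) = c
      revert c
      decide
    rcases hcases with h | h
    · refine limit_eq_zero_of_dvd hE ha0 hEP hinv hT hdet (fun p _ _ => ?_) hL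
      obtain ⟨x, hx⟩ := exists_dvd_of_zmod (N := 9) (c := c) (w := 1) (by simpa using h)
      exact ⟨x, 1, hx, one_dvd _⟩
    · refine hsq 3 (.inl rfl) (by norm_num) ?_
      have h3 : ¬ (3 : ℤ) ∣ d ∨ ¬ (3 : ℤ) ∣ c := by
        by_contra! hcon
        have : (3 : ℤ) ∣ 1 := hdet ▸ dvd_sub (hcon.1.mul_left α) (hcon.2.mul_left b)
        omega
      have hc : (9 : ℤ) ∣ c - 3 ∨ (9 : ℤ) ∣ c - 6 := by
        refine h.imp (fun h => ?_) fun h => ?_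
        · exact (ZMod.intCast_zmod_eq_zero_iff_dvd _ 9).1 (by push_cast; rw [h]; decide)
        · exact (ZMod.intCast_zmod_eq_zero_iff_dvd _ 9).1 (by push_cast; rw [h]; decide)
      push_cast
      omega
  by_cases h16 : N = 16
  · subst h16
    have hcases : (∃ x : ZMod 16, (c : ZMod 16) * c * x = 2 * c) ∨ (c : ZMod 16) = 4 ∨ (c : ZMod 16) = 12 := by
      generalize (c : ZMod 16) = c
      revert c
      decide
    rcases hcases with h | h
    · refine limit_eq_zero_of_dvd hE ha0 hEP hinv hT hdet (fun p hp hpN => ?_) hL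
      obtain ⟨x, hx⟩ := exists_dvd_of_zmod (N := 16) (c := c) (w := 2) (by simpa using h)
      refine ⟨x, 2, hx, ?_⟩
      rcases hp.eq_two_or_odd with rfl | hp2
      · exact absurd (by norm_num) hpN
      · omega
    · refine hsq 4 (.inr rfl) (by norm_num) ?_
      have h3 : ¬ (2 : ℤ) ∣ d ∨ ¬ (2 : ℤ) ∣ c := by
        by_contra! hcon
        have : (2 : ℤ) ∣ 1 := hdet ▸ dvd_sub (hcon.1.mul_left α) (hcon.2.mul_left b)
        omega
      have hc : (16 : ℤ) ∣ c - 4 ∨ (16 : ℤ) ∣ c - 12 := by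
        refine h.imp (fun h => ?_) fun h => ?_
        · exact (ZMod.intCast_zmod_eq_zero_iff_dvd _ 16).1 (by push_cast; rw [h]; decide)
        · exact (ZMod.intCast_zmod_eq_zero_iff_dvd _ 16).1 (by push_cast; rw [h]; decide)
      push_cast
      omega
  exact limit_eq_zero_of_dvd hE ha0 hEP hinv hT hdet
    (fun p hp hpN => exists_dvd_of_level hN h9 h16 c hp hpN) hL

open scoped Manifold in
lemma exists_cuspForm {f : ℍ → ℂ} {N : ℕ} (hN : N ≠ 0) {m : ℤ} (hf : MDiff f)
    (hinv : ∀ α b c d : ℤ, α * d - b * c = 1 → (N : ℤ) ∣ c → act m !![α, b; c, d] f = f)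
    (hzero : ∀ α b c d : ℤ, α * d - b * c = 1 →
      Filter.Tendsto (act m !![α, b; c, d] f) atImInfty (nhds 0)) :
    ∃ g : CuspForm ((CongruenceSubgroup.Gamma0 N).map (Matrix.SpecialLinearGroup.mapGL ℝ)) (2 * m),
      ⇑g = f := by
  have : NeZero N := ⟨hN⟩
  have hact (γ : SpecialLinearGroup (Fin 2) ℤ) :
      f ∣[2 * m] γ = act m !![γ 0 0, γ 0 1; γ 1 0, γ 1 1] f := by
    rw [← act_SL]
    congr 1
  have hdet (γ : SpecialLinearGroup (Fin 2) ℤ) : γ 0 0 * γ 1 1 - γ 0 1 * γ 1 0 = 1 := by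
    rw [← det_fin_two]; exact γ.2
  refine ⟨⟨⟨f, ?_⟩, hf, ?_⟩, rfl⟩
  · rintro _ ⟨γ, hγ, rfl⟩
    change f ∣[2 * m] γ = f
    rw [hact]
    refine hinv _ _ _ _ (hdet γ) ?_
    rw [← ZMod.intCast_zmod_eq_zero_iff_dvd]
    exact CongruenceSubgroup.Gamma0_mem.1 hγ
  · intro c hc
    rw [Subgroup.IsArithmetic.isCusp_iff_isCusp_SL2Z] at hc
    rw [OnePoint.isZeroAt_iff_forall_SL2Z hc]
    intro γ _
    change IsZeroAtImInfty (f ∣[2 * m] γ)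
    rw [hact]
    exact hzero _ _ _ _ (hdet γ)

/-- Combining the equation at `s` with that at `k - s` produces the factor `(ε (-1)^(k/2))² = (-1)^k
= -1`. -/
lemma HasFunctionalEquation.eq_zero_of_odd {Λ : ℂ → ℂ} {N : ℕ} (hN : 0 < N) {k : ℤ} (hk : Odd k) {ε : ℂ}
    (hε : ε = 1 ∨ ε = -1) (h : HasFunctionalEquation Λ N k ε) (s : ℂ) : Λ s = 0 := by
  have hx : ((√(N : ℝ) / (2 * Real.pi) : ℝ) : ℂ) ≠ 0 := by
    have : 0 < √(N : ℝ) := Real.sqrt_pos.2 (mod_cast hN)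
    have : 0 < √(N : ℝ) / (2 * Real.pi) := by positivity
    exact_mod_cast this.ne'
  have h1 := h s
  have h2 := h (k - s)
  rw [sub_sub_cancel] at h2
  have hsq : ((-1 : ℂ) ^ ((k : ℂ) / 2)) ^ 2 = -1 := by
    rw [← Complex.cpow_mul_nat, Nat.cast_ofNat, div_mul_cancel₀ _ two_ne_zero, Complex.cpow_intCast,
      hk.neg_one_zpow]
  have hε2 : ε ^ 2 = 1 := by rcases hε with rfl | rfl <;> norm_num
  have h3 : ((√(N : ℝ) / (2 * Real.pi) : ℝ) : ℂ) ^ s * Λ s = 0 := by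
    rw [h2] at h1
    have : ((√(N : ℝ) / (2 * Real.pi) : ℝ) : ℂ) ^ s * Λ s = -(((√(N : ℝ) / (2 * Real.pi) : ℝ) : ℂ) ^ s * Λ s) := by
      conv_lhs => rw [h1]
      linear_combination (((√(N : ℝ) / (2 * Real.pi) : ℝ) : ℂ) ^ s * Λ s) *
        (((-1 : ℂ) ^ ((k : ℂ) / 2)) ^ 2 * hε2 + hsq)
    linear_combination this / 2
  exact (mul_eq_zero.1 h3).resolve_left fun h0 => hx ((Complex.cpow_eq_zero_iff _ _).1 h0).1

lemma IsEBV.coeff_eq_zero {a : ℕ → ℂ} {F Λ : ℂ → ℂ} (h : IsEBV a F Λ) (hΛ : ∀ s, Λ s = 0) {n : ℕ}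
    (hn : n ≠ 0) : a n = 0 := by
  obtain ⟨σ, hσ⟩ := h.hasSum
  refine LSeries.eq_of_LSeries_eventually_eq (g := 0) ?_ ?_ ?_ hn
  · exact ((hσ (σ + 1 : ℝ) (by simp)).LSeriesSummable.abscissaOfAbsConv_le).trans_lt
      (EReal.coe_lt_top _)
  · exact (LSeries.abscissaOfAbsConv_le_of_le_const ⟨0, by simp⟩).trans_lt (EReal.coe_lt_top 1)
  · filter_upwards [Filter.eventually_gt_atTop σ, Filter.eventually_gt_atTop 0] with x h1 h2
    have hx (j : ℕ) : (x : ℂ) ≠ -(j : ℂ) := by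
      intro he
      have := congrArg Complex.re he
      simp at this
      linarith [(Nat.cast_nonneg j : (0 : ℝ) ≤ j)]
    have h3 := h.completed_eq x hx
    rw [hΛ, eq_comm, mul_eq_zero, or_iff_right (Gamma_ne_zero hx)] at h3
    rw [(hσ x (by simpa using h1)).LSeries_eq, h3]
    simp

lemma IsEBV.congr {a b : ℕ → ℂ} {F Λ : ℂ → ℂ} (h : IsEBV a F Λ) (hab : ∀ n ≠ 0, b n = a n) :
    IsEBV b F Λ where
  hasSum := h.hasSum.imp fun _ hσ s hs => (LSeriesHasSum_congr s _ fun {n} hn => hab n hn).2 (hσ s hs)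
  entire := h.entire
  entire_completed := h.entire_completed
  completed_eq := h.completed_eq
  bounded_strips := h.bounded_strips

lemma HasEulerProduct.congr {a b : ℕ → ℂ} {F : ℂ → ℂ} {N : ℕ} {k : ℤ} (h : HasEulerProduct a F N k)
    (hab : ∀ n ≠ 0, b n = a n) : HasEulerProduct b F N k := by
  obtain ⟨σ, hσ⟩ := h
  refine ⟨σ, fun s hs => ?_⟩
  have : (fun p : Nat.Primes => eulerFactor b N k p s) = fun p : Nat.Primes => eulerFactor a N k p s := by
    ext p
    rw [eulerFactor, eulerFactor, hab p p.2.ne_zero]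
  rw [this]
  exact hσ s hs

theorem corollary1 (N : ℕ) (hN : (5 ≤ N ∧ N ≤ 12) ∨ (14 ≤ N ∧ N ≤ 17) ∨ N = 23)
    (k : ℤ) (hk : 0 < k) (ε : ℂ) (hε : ε = 1 ∨ ε = -1)
    (a : ℕ → ℂ) (F Λ : ℂ → ℂ) (hEBV : IsEBV a F Λ)
    (hFE : HasFunctionalEquation Λ N k ε) (hEP : HasEulerProduct a F N k)
    (hgrowth : (N = 9 ∨ N = 16) → ε = -1 →
      ∃ δ : ℝ, 0 < δ ∧ ∀ s : ℂ, (k : ℝ) - δ < s.re → LSeriesSummable a s) :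
    ∃ f : CuspForm ((CongruenceSubgroup.Gamma0 N).map (Matrix.SpecialLinearGroup.mapGL ℝ)) k,
      ∀ z : UpperHalfPlane,
        HasSum (fun n : ℕ+ => a n * Complex.exp (2 * Real.pi * Complex.I * n * z)) (f z) := by
  rcases Int.even_or_odd' k with ⟨m, rfl | hkm⟩
  · have hm : 0 < m := by omega
    have hN0 : 0 < N := by omega
    have hε2 : ε ^ 2 = 1 := by rcases hε with rfl | rfl <;> norm_num
    -- The value `a 0` is arbitrary, whereas `qSeries` also sums over `n = 0`; it is therefore reset
    -- to 0.
    set b : ℕ → ℂ := Function.update a 0 0 with hb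
    have hab (n : ℕ) (hn : n ≠ 0) : b n = a n := Function.update_of_ne hn _ _
    have hb0 : b 0 = 0 := Function.update_self _ _ _
    have hE := hEBV.congr hab
    have hEP' := hEP.congr hab
    obtain ⟨C, K, hC, hbd⟩ := hE.exists_norm_le
    have hbd' (n : ℕ) : ‖b n‖ ≤ C * (n : ℝ) ^ K := by
      rcases eq_or_ne n 0 with rfl | hn
      · rw [hb0, norm_zero]
        positivity
      · exact hbd n hn
    have hH := act_fricke_qSeries hC hbd' hb0 hE hN0 hε2 hFE
    have hinv := act_eq_of_level hN hm hε2 hC hbd' hb0 hE hEP' hH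
    have hsum (h : N = 9 ∨ N = 16) (h' : ε = -1) : LSeriesSummable b ((2 * m : ℤ) : ℂ) := by
      obtain ⟨δ, hδ, hs⟩ := hgrowth h h'
      exact (LSeriesSummable_congr _ fun {n} hn => hab n hn).2 (hs _ (by simpa using hδ))
    obtain ⟨g, hg⟩ := exists_cuspForm hN0.ne' (mdifferentiable_qSeries hC hbd') hinv
      fun α β c d hdet => tendsto_act_zero hN hm hε hC hbd' hb0 hE hEP' hH hinv hsum hdet
    refine ⟨g, fun z => ?_⟩
    rw [hg]
    have h1 := hasSum_qSeries hC hbd' z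
    rw [← PNat.coe_injective.hasSum_iff] at h1
    · have e : (fun n : ℕ+ => a n * cexp (2 * Real.pi * Complex.I * n * z)) =
          (fun n : ℕ => b n * cexp (2 * Real.pi * Complex.I * n * z)) ∘ PNat.val := by
        ext n
        simp only [Function.comp_apply, hab n n.ne_zero]
      rw [e]
      exact h1
    · intro n hn
      have : n = 0 := by
        by_contra h0
        exact hn ⟨⟨n, Nat.pos_of_ne_zero h0⟩, rfl⟩
      rw [this, hb0, zero_mul]
  · have hodd : Odd k := ⟨m, hkm⟩
    have ha (n : ℕ+) : a n = 0 := hEBV.coeff_eq_zero (hFE.eq_zero_of_odd (by omega) hodd hε) n.ne_zero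
    refine ⟨0, fun z => ?_⟩
    simp only [ha, zero_mul]
    exact hasSum_zero
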